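/- For a positive integer $N$ let $\Gamma=\Gamma_0(N)\subset \mathrm{PSL}_2(\mathbb{Z})$ be the group of matrices $\pm\begin{pmatrix} a&b\\c&d\end{pmatrix}$ with $N\mid c$, let $v_\Gamma$ be the volume of $\Gamma\backslash\mathbb{H}$ with respect to $dx\,dy/y^2$, and let $g_\Gamma$ be the genus of the compact Riemann surface obtained from $\Gamma\backslash\mathbb{H}$ by adding the cusps. For cusps $p,q$ of a cofinite Fuchsian group $\Gamma\subset\mathrm{PSL}_2(\mathbb{R})$ choose scaling matrices $\sigma_p,\sigma_q\in \mathrm{SL}_2(\mathbb{R})$, i.e. $\sigma_p\infty=p$ and $\sigma_p^{-1}\Gamma_p\sigma_p$ is generated by $\begin{pmatrix}1&1\\0&1\end{pmatrix}$ in $\mathrm{PSL}_2(\mathbb{R})$, where $\Gamma_p$ is the stabilizer of $p$, and similarly for $q$. The scattering function $\varphi_{pq}$ is the meromorphic continuation to $\mathbb{C}$ of $$\varphi_{pq}(s)=\sqrt{\pi}\,\frac{\Gamma(s-\frac12)}{\Gamma(s)}\sum_{c>0}c^{-2s}\,\mathcal{S}_{pq}(0,0;c)\qquad(\Re s>1),$$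 where $\mathcal{S}_{pq}(0,0;c)$ is the number of double cosets $BgB$ of matrices $g\in\sigma_p^{-1}\Gamma\sigma_q$ with lower left entry $c$, and $B=\{\begin{pmatrix}1&k\\0&1\end{pmatrix}:k\in\mathbb{Z}\}$. The scattering constant is $$\mathcal{C}_{pq}=\lim_{s\to1}\Big(\varphi_{pq}(s)-\frac{1}{(s-1)v_\Gamma}\Big).$$ Let $\mathcal{C}$ be the scattering constant of $\mathrm{PSL}_2(\mathbb{Z})$ (with $p=q=\infty$). Then $\mathcal{C}=\frac{6}{\pi}\big(1-\log(4\pi)-12\,\zeta'(-1)\big)$. For every $N\ge1$ the scattering constant $\mathcal{C}_{0\infty}$ of $\Gamma=\Gamma_0(N)$ with respect to the cusps $0$ and $\infty$ exists, does not depend on the scaling matrices, and equals $$\mathcal{C}_{0\infty}=\frac{1}{v_\Gamma}\Big(\frac{\pi}{3}\,\mathcal{C}-\log N+\sum_{p\mid N,\ p\text{ prime}}\frac{2p\log p}{p^2-1}\Big).$$ Consequently, $$8\pi g_\Gamma(1-g_\Gamma)\,\mathcal{C}_{0\infty}=2g_\Gamma\log N+o(g_\Gamma\log N)\qquad\text{as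 }N\to\infty.$$ -/

import Mathlib

open scoped MatrixGroups UpperHalfPlane

noncomputable section

namespace CuspScattering

open Matrix OnePoint

/-! Throughout, a Fuchsian subgroup of `PSL(2, ℝ)` is represented by its full preimage `𝒢` in
`SL(2, ℝ)`, regarded as a subgroup of `GL(2, ℝ)`; thus `-1 ∈ 𝒢`. -/

/-- The group `PSL(2, ℤ)`, i.e. the image of `SL(2, ℤ)` in `GL(2, ℝ)`. -/
def modularGroup : Subgroup (GL (Fin 2) ℝ) :=
  (⊤ : Subgroup SL(2, ℤ)).map (SpecialLinearGroup.mapGL ℝ)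

/-- The Hecke congruence group `Γ₀(N)`, as a subgroup of `GL(2, ℝ)`. -/
def heckeGroup (N : ℕ) : Subgroup (GL (Fin 2) ℝ) :=
  (CongruenceSubgroup.Gamma0 N).map (SpecialLinearGroup.mapGL ℝ)

/-! ### Hyperbolic volume -/

/-- The hyperbolic volume `v_Γ` of `Γ \ ℍ`: the measure, with respect to `dx dy / y ^ 2`, of a
fundamental domain. The group that acts is the image of `𝒢` in `PGL(2, ℝ)`, so that `-1` is
identified with `1` and the action is faithful. -/
def hyperbolicVolume (𝒢 : Subgroup (GL (Fin 2) ℝ)) : ℝ :=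
  (MeasureTheory.covolume (𝒢.map ProjGenLinGroup.mk) ℍ MeasureTheory.volume).toReal

/-! ### The compactification of `Γ \ ℍ` by the cusps, and its genus -/

/-- The extended upper half-plane: `ℍ` together with the cusps of `𝒢`. -/
def ExtendedHalfPlane (𝒢 : Subgroup (GL (Fin 2) ℝ)) : Type :=
  ℍ ⊕ cuspsSubMulAction 𝒢

/-- The inclusion of `ℍ` into the extended upper half-plane. -/
def ofPoint (𝒢 : Subgroup (GL (Fin 2) ℝ)) (z : ℍ) : ExtendedHalfPlane 𝒢 := Sum.inl z

/-- The inclusion of the cusps into the extended upper half-plane. -/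
def ofCusp (𝒢 : Subgroup (GL (Fin 2) ℝ)) (c : cuspsSubMulAction 𝒢) : ExtendedHalfPlane 𝒢 :=
  Sum.inr c

instance (𝒢 : Subgroup (GL (Fin 2) ℝ)) : MulAction 𝒢 (ExtendedHalfPlane 𝒢) :=
  inferInstanceAs (MulAction 𝒢 (ℍ ⊕ cuspsSubMulAction 𝒢))

/-- The horoball topology: a set is open if its part in `ℍ` is open and if, around every cusp `c`
that it contains, it contains a horoball, i.e. the image of some half-plane `Im z > Y` under a
`σ ∈ SL(2, ℝ)` with `σ ∞ = c` (any two such `σ` give the same horoballs at `c`). -/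
instance (𝒢 : Subgroup (GL (Fin 2) ℝ)) : TopologicalSpace (ExtendedHalfPlane 𝒢) where
  IsOpen U :=
    IsOpen {z : ℍ | ofPoint 𝒢 z ∈ U} ∧
    ∀ c : cuspsSubMulAction 𝒢, ofCusp 𝒢 c ∈ U →
      ∀ σ : SL(2, ℝ), (σ : GL (Fin 2) ℝ) • (∞ : OnePoint ℝ) = (c : OnePoint ℝ) →
        ∃ Y : ℝ, ∀ z : ℍ, Y < z.im → ofPoint 𝒢 (σ • z) ∈ U
  isOpen_univ := ⟨by simp, fun _ _ _ _ ↦ ⟨0, fun _ _ ↦ trivial⟩⟩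
  isOpen_inter U V hU hV := by
    refine ⟨hU.1.inter hV.1, fun c hc σ hσ ↦ ?_⟩
    obtain ⟨Y₁, h₁⟩ := hU.2 c hc.1 σ hσ
    obtain ⟨Y₂, h₂⟩ := hV.2 c hc.2 σ hσ
    exact ⟨max Y₁ Y₂, fun z hz ↦ ⟨h₁ z (lt_of_le_of_lt (le_max_left _ _) hz),
      h₂ z (lt_of_le_of_lt (le_max_right _ _) hz)⟩⟩
  isOpen_sUnion S hS := by
    refine ⟨?_, ?_⟩
    · have : {z : ℍ | ofPoint 𝒢 z ∈ ⋃₀ S} =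
          ⋃ U ∈ S, {z : ℍ | ofPoint 𝒢 z ∈ U} := by
        ext z
        simp
      rw [this]
      exact isOpen_biUnion fun U hU ↦ (hS U hU).1
    · rintro c ⟨U, hU, hc⟩ σ hσ
      obtain ⟨Y, hY⟩ := (hS U hU).2 c hc σ hσ
      exact ⟨Y, fun z hz ↦ ⟨U, hU, hY z hz⟩⟩

/-- The compactification of `Γ \ ℍ` obtained by adding the cusps, with the quotient topology. -/
abbrev CompactifiedQuotient (𝒢 : Subgroup (GL (Fin 2) ℝ)) : Type :=
  MulAction.orbitRel.Quotient 𝒢 (ExtendedHalfPlane 𝒢)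

/-- The image of `i` in the compactified quotient. -/
def basePoint (𝒢 : Subgroup (GL (Fin 2) ℝ)) : CompactifiedQuotient 𝒢 :=
  Quotient.mk _ (ofPoint 𝒢 UpperHalfPlane.I)

/-- The genus `g_Γ` of the compactification of `Γ \ ℍ`: half of the first Betti number, i.e. half
of the rank of `H₁ = π₁ᵃᵇ`. (For a closed orientable surface this rank is even.) -/
def genus (𝒢 : Subgroup (GL (Fin 2) ℝ)) : ℕ :=
  Module.finrank ℤ
    (Additive (Abelianization (FundamentalGroup (CompactifiedQuotient 𝒢) (basePoint 𝒢)))) / 2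

/-! ### Scattering functions and scattering constants -/

/-- The translation `γ_∞ : z ↦ z + 1`. -/
def unitTranslation : SL(2, ℝ) := ⟨!![1, 1; 0, 1], by simp [det_fin_two]⟩

/-- `σ` is a scaling matrix of the cusp `p`: `σ ∞ = p`, and `σ⁻¹ Γ_p σ` is generated by `γ_∞` in
`PSL(2, ℝ)`, i.e. it consists of the matrices `± γ_∞ ^ k`. -/
def IsScalingMatrix (𝒢 : Subgroup (GL (Fin 2) ℝ)) (p : OnePoint ℝ) (σ : SL(2, ℝ)) : Prop :=
  (σ : GL (Fin 2) ℝ) • (∞ : OnePoint ℝ) = p ∧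
  ∀ h : GL (Fin 2) ℝ,
    ((σ : GL (Fin 2) ℝ) * h * (σ : GL (Fin 2) ℝ)⁻¹ ∈ 𝒢 ∧
      ((σ : GL (Fin 2) ℝ) * h * (σ : GL (Fin 2) ℝ)⁻¹) • p = p) ↔
    ∃ k : ℤ, h = ((unitTranslation ^ k : SL(2, ℝ)) : GL (Fin 2) ℝ) ∨
      h = -((unitTranslation ^ k : SL(2, ℝ)) : GL (Fin 2) ℝ)

/-- The Kloosterman sum `S(0, 0; c)` with respect to the scaling matrices `σ` and `τ`, for `c > 0`:
the number of double cosets `B g B` of matrices `g ∈ σ⁻¹ Γ τ` with lower left entry `c`, where `B`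
is the group of integral translations. (An element of `PSL(2, ℝ)` with non-zero lower left entry
has exactly one representative for which this entry is positive.) -/
def kloostermanZero (𝒢 : Subgroup (GL (Fin 2) ℝ)) (σ τ : SL(2, ℝ)) (c : ℝ) : ℕ :=
  ((fun g : SL(2, ℝ) ↦ DoubleCoset.doubleCoset g
      (Subgroup.zpowers unitTranslation : Set SL(2, ℝ))
      (Subgroup.zpowers unitTranslation : Set SL(2, ℝ))) ''
    {g : SL(2, ℝ) | ((σ * g * τ⁻¹ : SL(2, ℝ)) : GL (Fin 2) ℝ) ∈ 𝒢 ∧ g 1 0 = c}).ncard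

/-- `Φ` is the scattering function with respect to the scaling matrices `σ` and `τ`: it is
meromorphic on `ℂ`, and for `Re s > 1` it is given by the (absolutely convergent) series
`√π Γ(s - 1/2) / Γ(s) ∑_{c > 0} c ^ (-2s) S(0, 0; c)`. -/
def IsScatteringFunction (𝒢 : Subgroup (GL (Fin 2) ℝ)) (σ τ : SL(2, ℝ)) (Φ : ℂ → ℂ) : Prop :=
  Meromorphic Φ ∧
  ∀ s : ℂ, 1 < s.re → ∃ L : ℂ,
    HasSum (fun c : {c : ℝ // 0 < c} ↦
      ((c : ℝ) : ℂ) ^ (-2 * s) * (kloostermanZero 𝒢 σ τ (c : ℝ) : ℂ)) L ∧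
    Φ s = (Real.sqrt Real.pi : ℂ) * (Complex.Gamma (s - 1 / 2) / Complex.Gamma s) * L

/-- `C` is the scattering constant of `Γ` with respect to the cusps `p` and `q`: the cusps have
scaling matrices, and for every choice of them there is a scattering function `Φ` with
`C = lim_{s → 1} (Φ(s) - 1 / ((s - 1) v_Γ))`. -/
def IsScatteringConstant (𝒢 : Subgroup (GL (Fin 2) ℝ)) (p q : OnePoint ℝ) (C : ℂ) : Prop :=
  (∃ σ, IsScalingMatrix 𝒢 p σ) ∧ (∃ τ, IsScalingMatrix 𝒢 q τ) ∧
  ∀ σ τ : SL(2, ℝ), IsScalingMatrix 𝒢 p σ → IsScalingMatrix 𝒢 q τ →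
    ∃ Φ : ℂ → ℂ, IsScatteringFunction 𝒢 σ τ Φ ∧
      Filter.Tendsto (fun s : ℂ ↦ Φ s - 1 / ((s - 1) * (hyperbolicVolume 𝒢 : ℂ)))
        (nhdsWithin 1 {1}ᶜ) (nhds C)

end CuspScattering

end

/-!
The scattering constants are read off from an explicit formula for the scattering function, and
the asymptotics then needs only that the genus of `Γ₀(N)` is asymptotic to a twelfth of the index.

**The scattering constants.** Two scaling matrices of a cusp differ by a translation and a sign
(`IsScalingMatrix.eq_or_eq_neg`), so that the Kloosterman sums do not depend on them
(`kloostermanZero_congr`). For the cusps `0` and `∞` of `Γ₀(N)` take the Fricke matrix and the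
identity. Then the sum is `φ(n)` at `c = √N n` for `n` prime to `N`, and `0` at all other `c`
(`kloostermanZero_sqrt_mul`, `kloostermanZero_eq_zero`). The Dirichlet series is therefore
`N⁻ˢ ζ(2 s - 1) / ζ(2 s)` without the Euler factors at the primes dividing `N`
(`hasSum_kloostermanZero`). It is meromorphic with a simple pole at `s = 1`, the residue is the
inverse of the volume `π / 3 * N ∏ (1 + 1 / p)` (`hyperbolicVolume_realImage`,
`card_quotient_Gamma0`), and the constant term is the residue times a sum of logarithmic
derivatives (`hasLogDerivAt_scatteringNumerator`). The functional equation expresses `ζ'(2)` by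
`ζ'(-1)` (`deriv_riemannZeta_neg_one`). The modular group is the case `N = 1`.

**From the genus to homomorphisms on `Γ`.** The genus is half of the rank of the abelianized
fundamental group of the compactified quotient. The extended half-plane contracts to each of its
points, along geodesics to a point of `ℍ` and vertically to a cusp, compatibly with the stabilizer
of the point. Every homomorphism from the fundamental group to `ℚ` therefore is determined by the
homomorphism on `Γ` that it induces: if the latter is zero, integration along radial paths gives a
primitive that descends to the quotient (`LocalContraction.eq_one_of_loop`). Conversely, a
homomorphism on `Γ` that vanishes on all stabilizers is the monodromy of a covering of the quotient
(`LocalContraction.exists_hom_loop`). This bounds the genus by the dimensions of two spaces of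
homomorphisms (`genus_bounds`), without a triangulation or the theory of surfaces.

**Counting homomorphisms on `Γ`.** By Shapiro's lemma, the homomorphisms on `Γ` correspond to
cocycles of `SL(2, ℤ)` with values in the functions on the cosets. As `PSL(2, ℤ)` is the free
product of the groups of order `2` and `3` generated by `S` and `S T`
(`exists_hom_of_order_two_three`), such a cocycle amounts to two functions that are subject to one
condition each. Both dimensions are a sixth of the index, up to the numbers of fixed points of `S`,
`S T` and of small powers of `T` on the cosets (`finrank_hom_le`, `le_finrank_parabolicHoms`). A
fixed coset of `Γ₀(N)` is a primitive zero modulo `N` of a binary quadratic form, and the set of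
these zeros is disjoint from many of its translates, so that its density tends to `0`
(`genus_heckeGroup_bounds`, `tendsto_genus_div_card`).

**The asymptotics.** In the sum of `2 p log p / (p ^ 2 - 1)` over the primes dividing `N`, small
primes contribute a bounded amount and large primes a small multiple of `log N`, so that only the
term `-log N` of the scattering constant matters (`tendsto_sum_primeTerm_div_log`,
`isLittleO_scatteringConstant`).
-/

noncomputable section
namespace CuspScattering
open Matrix OnePoint
open scoped unitInterval Topology

/-! ### Homomorphisms on the fundamental group as functionals on paths -/

/-- An additive functional on the paths of `X` with values in `A`, invariant under homotopies that
fix the end points: a functor from the fundamental groupoid to `A`. It is defined on `C(I, X)`, so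
that the end points do not enter the type. -/
structure PathFunctional (X A : Type*) [TopologicalSpace X] [AddCommGroup A] where
  /-- The value on a path. -/
  toFun : C(I, X) → A
  homotopic' : ∀ {x y : X} (p q : Path x y), p.Homotopic q → toFun p = toFun q
  trans' : ∀ {x y z : X} (p : Path x y) (q : Path y z),
    toFun (p.trans q) = toFun p + toFun q

namespace PathFunctional

variable {X A : Type*} [TopologicalSpace X] [AddCommGroup A] (φ : PathFunctional X A)

lemma refl (x : X) : φ.toFun (Path.refl x) = 0 := by
  have h := φ.trans' (Path.refl x) (Path.refl x)
  rw [Path.refl_trans_refl] at h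
  simpa using h

lemma const (x : X) : φ.toFun (ContinuousMap.const I x) = 0 := φ.refl x

/-- The two ways around the boundary of a square have the same value. -/
lemma square (K : C(I × I, X)) :
    φ.toFun ⟨fun s ↦ K (s, 0), by fun_prop⟩ + φ.toFun ⟨fun t ↦ K (1, t), by fun_prop⟩ =
    φ.toFun ⟨fun t ↦ K (0, t), by fun_prop⟩ + φ.toFun ⟨fun s ↦ K (s, 1), by fun_prop⟩ := by
  let b : Path ((0, 0) : I × I) (1, 0) := ⟨⟨fun s ↦ (s, 0), by fun_prop⟩, rfl, rfl⟩
  let r : Path ((1, 0) : I × I) (1, 1) := ⟨⟨fun s ↦ (1, s), by fun_prop⟩, rfl, rfl⟩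
  let l : Path ((0, 0) : I × I) (0, 1) := ⟨⟨fun s ↦ (0, s), by fun_prop⟩, rfl, rfl⟩
  let t : Path ((0, 1) : I × I) (1, 1) := ⟨⟨fun s ↦ (s, 1), by fun_prop⟩, rfl, rfl⟩
  have h : (b.trans r).Homotopic (l.trans t) := by
    have : ContractibleSpace I := (convex_Icc (0 : ℝ) 1).contractibleSpace ⟨0, by simp⟩
    exact SimplyConnectedSpace.paths_homotopic _ _
  have h' := φ.homotopic' _ _ (h.map K)
  rw [Path.map_trans, Path.map_trans, φ.trans', φ.trans'] at h'
  exact h'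

/-- If a functional is locally the coboundary of `F`, it is so globally. -/
lemma eq_sub_of_local (F : X → A)
    (h : ∀ x : X, ∃ U : Set X, IsOpen U ∧ x ∈ U ∧
      ∀ f : C(I, X), (∀ s, f s ∈ U) → φ.toFun f = F (f 1) - F (f 0)) (f : C(I, X)) :
    φ.toFun f = F (f 1) - F (f 0) := by
  choose U hU hxU hF using h
  obtain ⟨t, ht0, htm, ⟨n, hn⟩, hsub⟩ := exists_monotone_Icc_subset_open_cover_unitInterval
    (c := fun x ↦ f ⁻¹' U x) (fun x ↦ (hU x).preimage f.continuous)
    (fun s _ ↦ Set.mem_iUnion.2 ⟨f s, hxU _⟩)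
  let q : Path (f 0) (f 1) := ⟨f, rfl, rfl⟩
  have key : ∀ k : ℕ, φ.toFun (q.subpath 0 (t k)) = F (f (t k)) - F (f 0) := by
    intro k
    induction k with
    | zero =>
      rw [ht0, Path.subpath_self, sub_self]
      exact φ.refl _
    | succ k ih =>
      obtain ⟨x, hx⟩ := hsub k
      have h1 : φ.toFun (q.subpath (t k) (t (k + 1))) = F (f (t (k + 1))) - F (f (t k)) := by
        have := hF x (q.subpath (t k) (t (k + 1)) : C(I, X)) (fun s ↦ by
          have hm : q.subpath (t k) (t (k + 1)) s ∈
              Set.range (q.subpath (t k) (t (k + 1))) := ⟨s, rfl⟩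
          rw [Path.range_subpath_of_le _ _ _ (htm (Nat.le_succ k))] at hm
          obtain ⟨u, hu, hu'⟩ := hm
          have := hx hu
          simp only [Set.mem_preimage] at this
          exact hu' ▸ this)
        rw [this]
        congr 2
        · exact congrArg f (by simp)
        · exact congrArg f (by simp)
      have h2 := φ.homotopic' _ _ ⟨Path.Homotopy.subpathTransSubpath q 0 (t k) (t (k + 1))⟩
      rw [← h2, φ.trans', ih, h1]
      abel
  have := key n
  rw [hn n le_rfl, Path.subpath_zero_one] at this
  exact this

/-- A homomorphism from the fundamental group of a path connected space to an abelian group extends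
to the fundamental groupoid. -/
lemma exists_extension [PathConnectedSpace X] {x₀ : X}
    (ψ : FundamentalGroup X x₀ →* Multiplicative A) :
    ∃ φ : PathFunctional X A, ∀ p : Path x₀ x₀,
      φ.toFun p = (ψ (Path.Homotopic.Quotient.mk p)).toAdd := by
  have hJ : ∀ x : X, Joined x₀ x := fun x ↦ PathConnectedSpace.joined x₀ x
  let c : ∀ x : X, Path x₀ x := fun x ↦ (hJ x).somePath
  let loop : ∀ {x y : X}, Path x y → Path.Homotopic.Quotient x₀ x₀ := fun {x y} p ↦
    ((Path.Homotopic.Quotient.mk (c x)).trans (.mk p)).trans (Path.Homotopic.Quotient.mk (c y)).symm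
  let P : ∀ f : C(I, X), Path (f 0) (f 1) := fun f ↦ ⟨f, rfl, rfl⟩
  have hP : ∀ {x y : X} (p : Path x y), loop (P p) = loop p := by
    intro x y p
    obtain ⟨f, rfl, rfl⟩ := p
    rfl
  have hmul : ∀ a b : Path.Homotopic.Quotient x₀ x₀,
      (ψ (a.trans b)).toAdd = (ψ a).toAdd + (ψ b).toAdd := by
    intro a b
    have := map_mul ψ (show FundamentalGroup X x₀ from b) (show FundamentalGroup X x₀ from a)
    rw [FundamentalGroup.mul_def] at this
    rw [this, toAdd_mul, add_comm]
  have hsymm : ∀ a : Path.Homotopic.Quotient x₀ x₀, (ψ a.symm).toAdd = - (ψ a).toAdd := by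
    intro a
    have := map_inv ψ (show FundamentalGroup X x₀ from a)
    rw [FundamentalGroup.inv_def] at this
    rw [this, toAdd_inv]
  refine ⟨⟨fun f ↦ (ψ (loop (P f))).toAdd, ?_, ?_⟩, ?_⟩
  · intro x y p q h
    rw [hP, hP]
    have : (Path.Homotopic.Quotient.mk p) = .mk q := Quotient.sound h
    simp only [loop, this]
  · intro x y z p q
    rw [hP, hP, hP, ← hmul]
    congr 2
    simp only [loop, Path.Homotopic.Quotient.mk_trans, Path.Homotopic.Quotient.trans_assoc]
    rw [← Path.Homotopic.Quotient.trans_assoc (Path.Homotopic.Quotient.mk (c y)).symm,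
      Path.Homotopic.Quotient.symm_trans, Path.Homotopic.Quotient.refl_trans]
  · intro p
    change (ψ (loop (P p))).toAdd = _
    rw [hP]
    change (ψ (((Path.Homotopic.Quotient.mk (c x₀)).trans (.mk p)).trans
      (Path.Homotopic.Quotient.mk (c x₀)).symm)).toAdd = _
    rw [hmul, hmul, hsymm]
    abel

end PathFunctional
end CuspScattering

end

noncomputable section
namespace CuspScattering
open Matrix OnePoint
open scoped unitInterval Topology

/-! ### Quotients by a group with local contractions -/

/-- For a group `G` acting on `Y` with an invariant set `D` of ordinary points, a contraction of
`D ∪ {y}` to the point `y`, together with a neighbourhood `U` of `y` that is moved off itself by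
the elements outside the stabilizer of `y`, and on which the contraction commutes with that
stabilizer. -/
structure LocalContraction (G : Type*) {Y : Type*} [TopologicalSpace Y] [Group G] [MulAction G Y]
    (D : Set Y) (y : Y) where
  /-- The neighbourhood of `y`. -/
  U : Set Y
  isOpen_U : IsOpen U
  mem_U : y ∈ U
  U_subset : U ⊆ insert y D
  smul_eq_of_mem : ∀ (γ : G), ∀ u ∈ U, γ • u ∈ U → γ • y = y
  /-- The contraction. -/
  h : I → Y → Y
  continuousOn_h : ContinuousOn (fun p : I × Y ↦ h p.1 p.2) (Set.univ ×ˢ insert y D)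
  h_zero : ∀ z ∈ insert y D, h 0 z = z
  h_one : ∀ z ∈ insert y D, h 1 z = y
  h_mem : ∀ t, ∀ z ∈ insert y D, h t z ∈ insert y D
  h_self : ∀ t, h t y = y
  h_smul : ∀ (γ : G) (t : I), ∀ z ∈ U, γ • y = y → h t (γ • z) = γ • h t z

namespace LocalContraction

variable {G Y A : Type*} [TopologicalSpace Y] [Group G] [MulAction G Y]
  [AddCommGroup A] {D : Set Y}

/-- The quotient map `Y → G \ Y`. -/
def proj (G Y : Type*) [TopologicalSpace Y] [Group G] [MulAction G Y] :
    C(Y, MulAction.orbitRel.Quotient G Y) :=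
  ⟨fun y ↦ Quotient.mk _ y, continuous_quotient_mk'⟩

lemma proj_smul (γ : G) (y : Y) : proj G Y (γ • y) = proj G Y y :=
  Quotient.sound ⟨γ, rfl⟩

lemma exists_smul_eq_of_proj_eq {a b : Y} (h : proj G Y a = proj G Y b) : ∃ γ : G, γ • a = b := by
  obtain ⟨γ, hγ⟩ := Quotient.exact h.symm
  exact ⟨γ, hγ⟩

/-- The radial path from `z` to `y`. -/
def radial {y : Y} (c : LocalContraction G D y) (z : Y) (hz : z ∈ insert y D) : C(I, Y) :=
  ⟨fun t ↦ c.h t z, c.continuousOn_h.comp_continuous (f := fun t : I ↦ (t, z)) (by fun_prop)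
    (fun _ ↦ ⟨trivial, hz⟩)⟩

/-- A path in `D ∪ {y}` is homotopic to the radial path from its start to `y`, followed by the
reversed radial path to its end. -/
lemma value_path (φ : PathFunctional (MulAction.orbitRel.Quotient G Y) A)
    {y : Y} (c : LocalContraction G D y) (p : C(I, Y)) (hp : ∀ s, p s ∈ insert y D) :
    φ.toFun ((proj G Y).comp p) =
      φ.toFun ((proj G Y).comp (c.radial (p 0) (hp 0))) -
      φ.toFun ((proj G Y).comp (c.radial (p 1) (hp 1))) := by
  have hK : Continuous fun st : I × I ↦ c.h st.2 (p st.1) :=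
    c.continuousOn_h.comp_continuous (f := fun st : I × I ↦ (st.2, p st.1)) (by fun_prop)
    (fun st ↦ ⟨trivial, hp _⟩)
  have := φ.square ((proj G Y).comp ⟨_, hK⟩)
  have h1 : (⟨fun s ↦ ((proj G Y).comp ⟨_, hK⟩) (s, 0), by fun_prop⟩ :
      C(I, MulAction.orbitRel.Quotient G Y)) = (proj G Y).comp p := by
    ext s
    simp [c.h_zero _ (hp s)]
  have h2 : (⟨fun s ↦ ((proj G Y).comp ⟨_, hK⟩) (s, 1), by fun_prop⟩ :
      C(I, MulAction.orbitRel.Quotient G Y)) = ContinuousMap.const I (proj G Y y) := by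
    ext s
    simp [c.h_one _ (hp s)]
  rw [h1, h2, φ.const, add_zero] at this
  exact eq_sub_of_add_eq this

section potential
variable (φ : PathFunctional (MulAction.orbitRel.Quotient G Y) A) {y₀ : Y} (hy₀ : y₀ ∈ D)
  (c : ∀ y : Y, LocalContraction G D y)

/-- The value of `φ` on the image of the radial path from `y₀` to `y`. -/
def potential (y : Y) : A :=
  φ.toFun ((proj G Y).comp ((c y).radial y₀ (Set.mem_insert_of_mem _ hy₀)))

lemma value_radial_self (y : Y) (hy : y ∈ insert y D) :
    φ.toFun ((proj G Y).comp ((c y).radial y hy)) = 0 := by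
  rw [← φ.const (proj G Y y)]
  congr 1
  ext t
  simp [radial, (c y).h_self]

/-- Additivity of the potential along the radial path from `a` to `y`. -/
lemma potential_add {a y : Y} (ha : a ∈ insert y D) :
    potential φ hy₀ c a + φ.toFun ((proj G Y).comp ((c y).radial a ha)) = potential φ hy₀ c y := by
  rcases Set.mem_insert_iff.1 ha with rfl | haD
  · rw [value_radial_self φ c, add_zero]
  · have hD : ∀ s, (c a).radial y₀ (Set.mem_insert_of_mem _ hy₀) s ∈ insert y D := by
      intro s
      rcases Set.mem_insert_iff.1 ((c a).h_mem s _ (Set.mem_insert_of_mem _ hy₀)) with h | h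
      · change (c a).h s y₀ ∈ _
        rw [h]
        exact ha
      · exact Set.mem_insert_of_mem _ h
    have := value_path φ (c y) ((c a).radial y₀ (Set.mem_insert_of_mem _ hy₀)) hD
    rw [potential, this]
    have e0 : (c a).radial y₀ (Set.mem_insert_of_mem _ hy₀) 0 = y₀ :=
      (c a).h_zero _ (Set.mem_insert_of_mem _ hy₀)
    have e1 : (c a).radial y₀ (Set.mem_insert_of_mem _ hy₀) 1 = a :=
      (c a).h_one _ (Set.mem_insert_of_mem _ hy₀)
    simp only [e0, e1, sub_add_cancel]
    rfl

/-- Under `γ` the potential changes by a constant, the value of `φ` on the loop given by `γ`. -/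
lemma potential_smul (hD : ∀ (γ : G), ∀ z ∈ D, γ • z ∈ D) [ContinuousConstSMul G Y]
    (γ : G) (y : Y) :
    potential φ hy₀ c (γ • y) = potential φ hy₀ c y + potential φ hy₀ c (γ • y₀) := by
  have hDy : ∀ z ∈ insert y D, γ • z ∈ insert (γ • y) D := by
    intro z hz
    rcases Set.mem_insert_iff.1 hz with rfl | h
    · exact Set.mem_insert _ _
    · exact Set.mem_insert_of_mem _ (hD γ z h)
  have hy₀' : y₀ ∈ insert y D := Set.mem_insert_of_mem _ hy₀
  let p : C(I, Y) := ⟨fun t ↦ γ • (c y).radial y₀ hy₀' t, by fun_prop⟩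
  have hp : ∀ s, p s ∈ insert (γ • y) D := fun s ↦ hDy _ ((c y).h_mem s _ hy₀')
  have e0 : p 0 = γ • y₀ := congrArg (γ • ·) ((c y).h_zero _ hy₀')
  have e1 : p 1 = γ • y := congrArg (γ • ·) ((c y).h_one _ hy₀')
  have h1 : (proj G Y).comp p = (proj G Y).comp ((c y).radial y₀ hy₀') := by
    ext s
    exact proj_smul γ _
  have h2 := value_path φ (c (γ • y)) p hp
  simp only [e0, e1] at h2
  rw [value_radial_self φ c, sub_zero, h1] at h2
  rw [← potential_add φ hy₀ c (hDy _ hy₀'), ← h2, add_comm]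
  rfl

/-- If the potential is `G`-invariant, then `φ` is its coboundary. The contraction of the
neighbourhood of a point of `Y` descends to its image in the quotient, since the quotient map is
open. -/
lemma eq_sub_of_potential_smul [ContinuousConstSMul G Y] (F : MulAction.orbitRel.Quotient G Y → A)
    (hF : ∀ y, F (proj G Y y) = potential φ hy₀ c y)
    (q : C(I, MulAction.orbitRel.Quotient G Y)) : φ.toFun q = F (q 1) - F (q 0) := by
  refine φ.eq_sub_of_local F (fun x ↦ ?_) q
  obtain ⟨y, rfl⟩ : ∃ y, proj G Y y = x := Quotient.exists_rep x
  have hopen : IsOpenMap (proj G Y) := isOpenMap_quotient_mk'_mul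
  refine ⟨proj G Y '' (c y).U, hopen _ (c y).isOpen_U, ⟨y, (c y).mem_U, rfl⟩, fun f hf ↦ ?_⟩
  choose l hlU hl using hf
  have hwd : ∀ s t, ∀ u ∈ (c y).U, proj G Y u = f s →
      proj G Y ((c y).h t (l s)) = proj G Y ((c y).h t u) := by
    intro s t u hu hus
    obtain ⟨γ, hγ⟩ := exists_smul_eq_of_proj_eq (hus.trans (hl s).symm)
    have hfix := (c y).smul_eq_of_mem γ u hu (hγ ▸ hlU s)
    rw [← hγ, (c y).h_smul γ t u hu hfix, proj_smul]
  have hK : Continuous fun st : I × I ↦ proj G Y ((c y).h st.2 (l st.1)) := by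
    rw [continuous_iff_continuousAt]
    rintro ⟨s, t⟩
    have hc : ContinuousAt (fun p : I × Y ↦ proj G Y ((c y).h p.1 p.2)) (t, l s) := by
      refine (proj G Y).continuous.continuousAt.comp ((c y).continuousOn_h.continuousAt ?_)
      exact Filter.mem_of_superset
        ((isOpen_univ.prod (c y).isOpen_U).mem_nhds ⟨trivial, hlU s⟩)
        (Set.prod_mono le_rfl (c y).U_subset)
    intro V hV
    have hV' := hc hV
    obtain ⟨B, hB, W, hW, hBW⟩ := mem_nhds_prod_iff.1 hV'
    have hW' : proj G Y '' (W ∩ (c y).U) ∈ 𝓝 (f s) := by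
      rw [← hl s]
      exact hopen.image_mem_nhds (Filter.inter_mem hW ((c y).isOpen_U.mem_nhds (hlU s)))
    rw [Filter.mem_map]
    refine Filter.mem_of_superset
      (prod_mem_nhds (f.continuous.continuousAt hW') hB) ?_
    rintro ⟨s', t'⟩ ⟨⟨u, ⟨huW, huU⟩, hu⟩, ht'⟩
    change proj G Y ((c y).h t' (l s')) ∈ V
    rw [hwd s' t' u huU hu]
    exact hBW (show (t', u) ∈ B ×ˢ W from ⟨ht', huW⟩)
  have hsq := φ.square ⟨_, hK⟩
  have hlZ : ∀ s, l s ∈ insert y D := fun s ↦ (c y).U_subset (hlU s)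
  have h1 : (⟨fun s ↦ (⟨_, hK⟩ : C(I × I, MulAction.orbitRel.Quotient G Y)) (s, 0), by fun_prop⟩ :
      C(I, MulAction.orbitRel.Quotient G Y)) = f := by
    ext s
    simp [(c y).h_zero _ (hlZ s), hl]
  have h2 : (⟨fun s ↦ (⟨_, hK⟩ : C(I × I, MulAction.orbitRel.Quotient G Y)) (s, 1), by fun_prop⟩ :
      C(I, MulAction.orbitRel.Quotient G Y)) = ContinuousMap.const I (proj G Y y) := by
    ext s
    simp [(c y).h_one _ (hlZ s)]
  rw [h1, h2, φ.const, add_zero] at hsq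
  rw [← hl 0, ← hl 1, hF, hF]
  have a0 := potential_add φ hy₀ c (hlZ 0)
  have a1 := potential_add φ hy₀ c (hlZ 1)
  have b0 : φ.toFun ⟨fun t ↦ (⟨_, hK⟩ : C(I × I, MulAction.orbitRel.Quotient G Y)) (0, t),
      by fun_prop⟩ = φ.toFun ((proj G Y).comp ((c y).radial (l 0) (hlZ 0))) := rfl
  have b1 : φ.toFun ⟨fun t ↦ (⟨_, hK⟩ : C(I × I, MulAction.orbitRel.Quotient G Y)) (1, t),
      by fun_prop⟩ = φ.toFun ((proj G Y).comp ((c y).radial (l 1) (hlZ 1))) := rfl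
  rw [b0, b1] at hsq
  rw [eq_sub_of_add_eq hsq, eq_sub_of_add_eq' a0, eq_sub_of_add_eq' a1]
  abel

end potential

/-- The loop in the quotient given by `γ`: the image of the radial path from `y₀` to `γ y₀`. -/
def loop (c : ∀ y : Y, LocalContraction G D y) {y₀ : Y} (hy₀ : y₀ ∈ D) (γ : G) :
    Path (proj G Y y₀) (proj G Y y₀) where
  toContinuousMap := (proj G Y).comp ((c (γ • y₀)).radial y₀ (Set.mem_insert_of_mem _ hy₀))
  source' := congrArg (proj G Y) ((c (γ • y₀)).h_zero _ (Set.mem_insert_of_mem _ hy₀))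
  target' := (congrArg (proj G Y) ((c (γ • y₀)).h_one _ (Set.mem_insert_of_mem _ hy₀))).trans
    (proj_smul γ y₀)

lemma pathConnectedSpace (c : ∀ y : Y, LocalContraction G D y) {y₀ : Y} (hy₀ : y₀ ∈ D) :
    PathConnectedSpace Y := by
  have h : ∀ y, Joined y₀ y := fun y ↦
    ⟨⟨(c y).radial y₀ (Set.mem_insert_of_mem _ hy₀), (c y).h_zero _ (Set.mem_insert_of_mem _ hy₀),
      (c y).h_one _ (Set.mem_insert_of_mem _ hy₀)⟩⟩
  exact ⟨⟨y₀⟩, fun x y ↦ (h x).symm.trans (h y)⟩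

lemma pathConnectedSpace_quotient (c : ∀ y : Y, LocalContraction G D y) {y₀ : Y} (hy₀ : y₀ ∈ D) :
    PathConnectedSpace (MulAction.orbitRel.Quotient G Y) := by
  have := pathConnectedSpace c hy₀
  exact Quotient.mk_surjective.pathConnectedSpace (proj G Y).continuous

/-- A homomorphism on the fundamental group of the quotient gives one on `G`. -/
lemma value_loop_mul [ContinuousConstSMul G Y] (c : ∀ y : Y, LocalContraction G D y) {y₀ : Y}
    (hy₀ : y₀ ∈ D) (hD : ∀ (γ : G), ∀ z ∈ D, γ • z ∈ D)
    (ψ : FundamentalGroup (MulAction.orbitRel.Quotient G Y) (proj G Y y₀) →* Multiplicative A)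
    (γ δ : G) : ψ (.mk (loop c hy₀ (γ * δ))) = ψ (.mk (loop c hy₀ γ)) * ψ (.mk (loop c hy₀ δ)) := by
  have := pathConnectedSpace_quotient c hy₀
  obtain ⟨φ, hφ⟩ := PathFunctional.exists_extension ψ
  have h : ∀ γ : G, (ψ (.mk (loop c hy₀ γ))).toAdd = potential φ hy₀ c (γ • y₀) :=
    fun γ ↦ (hφ _).symm
  apply Multiplicative.toAdd.injective
  rw [toAdd_mul, h, h, h, mul_smul, potential_smul φ hy₀ c hD, add_comm]

/-- A homomorphism on the fundamental group of the quotient is determined by its values on the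
loops given by the elements of `G`. -/
lemma eq_one_of_loop [ContinuousConstSMul G Y] (c : ∀ y : Y, LocalContraction G D y) {y₀ : Y}
    (hy₀ : y₀ ∈ D) (hD : ∀ (γ : G), ∀ z ∈ D, γ • z ∈ D)
    (ψ : FundamentalGroup (MulAction.orbitRel.Quotient G Y) (proj G Y y₀) →* Multiplicative A)
    (hψ : ∀ γ, ψ (.mk (loop c hy₀ γ)) = 1) : ψ = 1 := by
  have := pathConnectedSpace_quotient c hy₀
  obtain ⟨φ, hφ⟩ := PathFunctional.exists_extension ψ
  have h : ∀ γ : G, potential φ hy₀ c (γ • y₀) = 0 := by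
    intro γ
    have : potential φ hy₀ c (γ • y₀) = (ψ (.mk (loop c hy₀ γ))).toAdd := hφ (loop c hy₀ γ)
    rw [this, hψ]
    rfl
  have hinv : ∀ a b : Y, (MulAction.orbitRel G Y) a b →
      potential φ hy₀ c a = potential φ hy₀ c b := by
    rintro _ b ⟨γ, rfl⟩
    change potential φ hy₀ c (γ • b) = _
    rw [potential_smul φ hy₀ c hD, h, add_zero]
  refine MonoidHom.ext fun p ↦ ?_
  induction p using Path.Homotopic.Quotient.ind with
  | mk p =>
    have h1 := eq_sub_of_potential_smul φ hy₀ c (Quotient.lift _ hinv) (fun y ↦ rfl) p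
    have hp : φ.toFun p = (ψ (Path.Homotopic.Quotient.mk p)).toAdd := hφ p
    have e1 : (p : C(I, _)) 1 = proj G Y y₀ := p.target
    have e0 : (p : C(I, _)) 0 = proj G Y y₀ := p.source
    rw [e1, e0, sub_self] at h1
    exact Multiplicative.toAdd.injective (hp.symm.trans h1)

end LocalContraction
end CuspScattering

end

noncomputable section
namespace CuspScattering
open Matrix OnePoint
open scoped unitInterval Topology

/-! ### The covering attached to a homomorphism -/

/-- The product of `Y` with an abelian group `M`, on which `G` acts diagonally, through a
homomorphism `χ : G → M` on the second factor. Its quotient by `G` is a covering of the quotient of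
`Y` if `χ` is trivial on the stabilizers. -/
def TwistedProduct {G M : Type*} (Y : Type*) [Group G] [CommGroup M] (_χ : G →* M) : Type _ := Y × M

namespace TwistedProduct

variable {G M Y : Type*} [Group G] [MulAction G Y] [CommGroup M] (χ : G →* M)

instance : MulAction G (TwistedProduct Y χ) where
  smul γ p := (γ • p.1, χ γ * p.2)
  one_smul p := Prod.ext (one_smul G p.1) (by change χ 1 * p.2 = p.2; simp)
  mul_smul γ δ p := Prod.ext (mul_smul γ δ p.1)
    (by change χ (γ * δ) * p.2 = χ γ * (χ δ * p.2); rw [map_mul, mul_assoc])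

/-- The total space of the covering given by `χ`. -/
abbrev Total (Y : Type*) [MulAction G Y] (χ : G →* M) : Type _ :=
  MulAction.orbitRel.Quotient G (TwistedProduct Y χ)

/-- The class of `(y, a)`. -/
def mk (y : Y) (a : M) : Total Y χ := Quotient.mk _ (show TwistedProduct Y χ from (y, a))

lemma mk_smul (γ : G) (y : Y) (a : M) : mk χ (γ • y) (χ γ * a) = mk χ y a :=
  Quotient.sound ⟨γ, rfl⟩

lemma exists_of_mk_eq {y y' : Y} {a a' : M} (h : mk χ y a = mk χ y' a') :
    ∃ γ : G, γ • y' = y ∧ χ γ * a' = a := by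
  obtain ⟨γ, hγ⟩ := Quotient.exact h
  exact ⟨γ, congrArg Prod.fst hγ, congrArg Prod.snd hγ⟩

lemma exists_mk (e : Total Y χ) : ∃ y a, mk χ y a = e := by
  obtain ⟨⟨y, a⟩, rfl⟩ := Quotient.exists_rep e
  exact ⟨y, a, rfl⟩

instance : MulAction M (Total Y χ) where
  smul m := Quotient.map (fun p : Y × M ↦ (p.1, m * p.2)) (by
    rintro _ b ⟨γ, rfl⟩
    exact ⟨γ, Prod.ext rfl (mul_left_comm _ _ _)⟩)
  one_smul e := by
    obtain ⟨y, a, rfl⟩ := exists_mk χ e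
    exact congrArg (mk χ y) (one_mul a)
  mul_smul m n e := by
    obtain ⟨y, a, rfl⟩ := exists_mk χ e
    exact congrArg (mk χ y) (mul_assoc m n a)

/-- The covering map. -/
def toQuotient : Total Y χ → MulAction.orbitRel.Quotient G Y :=
  Quotient.map (fun p : Y × M ↦ p.1) (by
    rintro _ b ⟨γ, rfl⟩
    exact ⟨γ, rfl⟩)

variable [TopologicalSpace Y] [TopologicalSpace M]

instance : TopologicalSpace (TwistedProduct Y χ) := inferInstanceAs (TopologicalSpace (Y × M))

lemma continuous_mk : Continuous fun p : Y × M ↦ mk χ p.1 p.2 := continuous_quotient_mk'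

variable [DiscreteTopology M]

instance [ContinuousConstSMul G Y] : ContinuousConstSMul G (TwistedProduct Y χ) where
  continuous_const_smul γ := by
    change Continuous fun p : Y × M ↦ (γ • p.1, χ γ * p.2)
    have : Continuous fun a : M ↦ χ γ * a := continuous_of_discreteTopology
    fun_prop

lemma isOpenMap_mk [ContinuousConstSMul G Y] : IsOpenMap fun p : Y × M ↦ mk χ p.1 p.2 :=
  isOpenMap_quotient_mk'_mul (T := TwistedProduct Y χ)

lemma isQuotientCoveringMap [ContinuousConstSMul G Y]
    (hχ : ∀ (γ : G) (y : Y), γ • y = y → χ γ = 1)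
    (hU : ∀ y : Y, ∃ U : Set Y, IsOpen U ∧ y ∈ U ∧
      ∀ (γ : G), ∀ u ∈ U, γ • u ∈ U → γ • y = y) :
    IsQuotientCoveringMap (toQuotient (Y := Y) χ) M := by
  have hcont : Continuous (toQuotient (Y := Y) χ) := by
    refine continuous_coinduced_dom.2 ?_
    exact (LocalContraction.proj G Y).continuous.comp continuous_fst
  have hsurj : Function.Surjective (toQuotient (Y := Y) χ) := by
    intro x
    obtain ⟨y, rfl⟩ := Quotient.exists_rep x
    exact ⟨mk χ y 1, rfl⟩
  have hopen : IsOpenMap (toQuotient (Y := Y) χ) := by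
    have h : IsOpenMap (LocalContraction.proj G Y ∘ (Prod.fst : Y × M → Y)) :=
      (isOpenMap_quotient_mk'_mul).comp isOpenMap_fst
    intro V hV
    convert h _ (hV.preimage (continuous_mk χ)) using 1
    ext x
    constructor
    · rintro ⟨e, he, rfl⟩
      obtain ⟨y, a, rfl⟩ := exists_mk χ e
      exact ⟨(y, a), he, rfl⟩
    · rintro ⟨⟨y, a⟩, he, rfl⟩
      exact ⟨_, he, rfl⟩
  refine { toIsQuotientMap := hopen.isQuotientMap hcont hsurj
           continuous_const_smul := fun m ↦ ?_
           apply_eq_iff_mem_orbit := fun {e₁ e₂} ↦ ?_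
           disjoint := fun e ↦ ?_ }
  · refine continuous_coinduced_dom.2 ?_
    have : Continuous fun a : M ↦ m * a := continuous_of_discreteTopology
    exact (continuous_mk χ).comp (f := fun p : Y × M ↦ (p.1, m * p.2)) (by fun_prop)
  · obtain ⟨y₁, a₁, rfl⟩ := exists_mk χ e₁
    obtain ⟨y₂, a₂, rfl⟩ := exists_mk χ e₂
    constructor
    · intro h
      obtain ⟨γ, rfl⟩ := LocalContraction.exists_smul_eq_of_proj_eq h
      refine ⟨(χ γ * a₁) * a₂⁻¹, ?_⟩
      change mk χ _ _ = _
      rw [inv_mul_cancel_right, mk_smul]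
    · rintro ⟨m, hm⟩
      rw [← hm]
      rfl
  · obtain ⟨y, a, rfl⟩ := exists_mk χ e
    obtain ⟨U, hUo, hyU, hU⟩ := hU y
    refine ⟨(fun p : Y × M ↦ mk χ p.1 p.2) '' (U ×ˢ {a}),
      (isOpenMap_mk χ).image_mem_nhds ((hUo.prod (isOpen_discrete {a})).mem_nhds
        (show (y, a) ∈ U ×ˢ {a} from ⟨hyU, rfl⟩)), ?_⟩
    rintro m ⟨_, ⟨_, ⟨⟨u, b⟩, ⟨hu, rfl⟩, rfl⟩, rfl⟩, ⟨⟨u', b'⟩, ⟨hu', hb'⟩, h⟩⟩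
    simp only [Set.mem_singleton_iff] at hb'
    subst hb'
    obtain ⟨γ, h1, h2⟩ := exists_of_mk_eq χ (h : mk χ u' b' = mk χ u (m * b'))
    have h3 := hχ γ y (hU γ u hu (by rw [h1]; exact hu'))
    simpa [h3] using h2

end TwistedProduct

/-- A homomorphism on `G` that is trivial on the stabilizers comes from one on the fundamental group
of the quotient: it is the monodromy of the covering that it defines. -/
lemma LocalContraction.exists_hom_loop {G M Y : Type*} [TopologicalSpace Y] [Group G]
    [MulAction G Y] [CommGroup M] [ContinuousConstSMul G Y] {D : Set Y}
    (c : ∀ y : Y, LocalContraction G D y) {y₀ : Y} (hy₀ : y₀ ∈ D) (χ : G →* M)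
    (hχ : ∀ (γ : G) (y : Y), γ • y = y → χ γ = 1) :
    ∃ ψ : FundamentalGroup (MulAction.orbitRel.Quotient G Y) (proj G Y y₀) →* M,
      ∀ γ, ψ (.mk (loop c hy₀ γ)) = χ γ := by
  let : TopologicalSpace M := ⊥
  have : DiscreteTopology M := ⟨rfl⟩
  have hp := TwistedProduct.isQuotientCoveringMap (Y := Y) χ hχ
    (fun y ↦ ⟨(c y).U, (c y).isOpen_U, (c y).mem_U, (c y).smul_eq_of_mem⟩)
  let e : TwistedProduct.toQuotient (Y := Y) χ ⁻¹' {proj G Y y₀} :=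
    ⟨TwistedProduct.mk χ y₀ 1, rfl⟩
  let ψ : FundamentalGroup (MulAction.orbitRel.Quotient G Y) (proj G Y y₀) →* M :=
    (MulEquiv.inv M).toMonoidHom.comp
      ((MulOpposite.opMulEquiv (M := M)).symm.toMonoidHom.comp (hp.fundamentalGroupToMulOpposite e))
  refine ⟨ψ, fun γ ↦ ?_⟩
  suffices h : hp.fundamentalGroupToMulOpposite e (.mk (loop c hy₀ γ)) = MulOpposite.op (χ γ)⁻¹ by
    change (MulOpposite.unop (hp.fundamentalGroupToMulOpposite e (.mk (loop c hy₀ γ))))⁻¹ = _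
    rw [h]
    simp
  rw [hp.fundamentalGroupToMulOpposite_apply_eq_Iff]
  have hy₀' : y₀ ∈ insert (γ • y₀) D := Set.mem_insert_of_mem _ hy₀
  let Γ : C(I, TwistedProduct.Total Y χ) :=
    ⟨fun t ↦ TwistedProduct.mk χ ((c (γ • y₀)).radial y₀ hy₀' t) 1,
      (TwistedProduct.continuous_mk χ).comp
        (f := fun t : I ↦ ((c (γ • y₀)).radial y₀ hy₀' t, (1 : M))) (by fun_prop)⟩
  have h0 : Γ 0 = e.1 := congrArg (TwistedProduct.mk χ · 1) ((c (γ • y₀)).h_zero _ hy₀')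
  have h1 : Γ 1 = TwistedProduct.mk χ (γ • y₀) 1 :=
    congrArg (TwistedProduct.mk χ · 1) ((c (γ • y₀)).h_one _ hy₀')
  have hΓ := (hp.isCoveringMap.eq_liftPath_iff' (γ := loop c hy₀ γ) (e := e.1)
    (loop c hy₀ γ).source (Γ := Γ)).2 ⟨rfl, h0⟩
  change _ = hp.isCoveringMap.liftPath _ _ _ 1
  rw [← hΓ, h1]
  have := TwistedProduct.mk_smul χ γ y₀ (χ γ)⁻¹
  rw [mul_inv_cancel] at this
  rw [this]
  change TwistedProduct.mk χ y₀ _ = _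
  simp
end CuspScattering

end

noncomputable section
namespace CuspScattering
open Matrix OnePoint
open scoped unitInterval Topology TensorProduct

/-! ### The abelianized fundamental group of a quotient -/

/-- Both sides are the dimension of `ℚ ⊗ M`. No finiteness is needed: if this space is
infinite-dimensional, both ranks are `0`. -/
lemma finrank_int_eq_finrank_hom (M : Type*) [AddCommGroup M] :
    Module.finrank ℤ M = Module.finrank ℚ (M →ₗ[ℤ] ℚ) := by
  rw [(LinearMap.liftBaseChangeEquiv (R := ℤ) (M := M) (N := ℚ) ℚ).finrank_eq]
  exact ((TensorProduct.isBaseChange ℤ M ℚ).finrank_eq).symm.trans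
    (Subspace.dual_finrank_eq (K := ℚ) (V := ℚ ⊗[ℤ] M)).symm

/-- The homomorphisms `G → ℚ` that vanish on the stabilizers of the points of `Y`. -/
def homsVanishingOnStabilizers (G Y : Type*) [Group G] [MulAction G Y] :
    Submodule ℚ (Additive G →+ ℚ) where
  carrier := {χ | ∀ (γ : G) (y : Y), γ • y = y → χ (Additive.ofMul γ) = 0}
  add_mem' {χ₁ χ₂} h₁ h₂ γ y h := by simp [h₁ γ y h, h₂ γ y h]
  zero_mem' γ y h := rfl
  smul_mem' q χ hχ γ y h := by simp [hχ γ y h]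

namespace LocalContraction

variable {G Y : Type*} [TopologicalSpace Y] [Group G] [MulAction G Y]
  {D : Set Y} [ContinuousConstSMul G Y] (c : ∀ y : Y, LocalContraction G D y) {y₀ : Y}
  (hy₀ : y₀ ∈ D) (hD : ∀ (γ : G), ∀ z ∈ D, γ • z ∈ D)

/-- The pullback of rational homomorphisms from the fundamental group of the quotient to `G`. -/
def pullback :
    (Additive (Abelianization (FundamentalGroup (MulAction.orbitRel.Quotient G Y)
      (proj G Y y₀))) →ₗ[ℤ] ℚ) →ₗ[ℚ] (Additive G →+ ℚ) where
  toFun ψ := AddMonoidHom.mk' (fun γ ↦ ψ (Additive.ofMul (Abelianization.of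
      (.mk (loop c hy₀ γ.toMul))))) (fun γ δ ↦ by
    have := value_loop_mul c hy₀ hD
      ((AddMonoidHom.toMultiplicativeRight ψ.toAddMonoidHom).comp Abelianization.of)
      γ.toMul δ.toMul
    exact congrArg Multiplicative.toAdd this)
  map_add' ψ₁ ψ₂ := rfl
  map_smul' q ψ := rfl

lemma pullback_injective : Function.Injective (pullback c hy₀ hD) := by
  rw [← LinearMap.ker_eq_bot, LinearMap.ker_eq_bot']
  intro ψ hψ
  have := eq_one_of_loop c hy₀ hD
      ((AddMonoidHom.toMultiplicativeRight ψ.toAddMonoidHom).comp Abelianization.of)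
      (fun γ ↦ congrArg Multiplicative.ofAdd (DFunLike.congr_fun hψ (Additive.ofMul γ)))
  ext m
  obtain ⟨p, hp⟩ := QuotientGroup.mk_surjective m.toMul
  have h2 := congrArg Multiplicative.toAdd (DFunLike.congr_fun this p)
  have h3 : m = Additive.ofMul (Abelianization.of p) := congrArg Additive.ofMul hp.symm
  rw [h3]
  exact h2

lemma le_range_pullback :
    homsVanishingOnStabilizers G Y ≤ LinearMap.range (pullback c hy₀ hD) := by
  intro χ hχ
  obtain ⟨ψ, hψ⟩ := exists_hom_loop c hy₀ (M := Multiplicative ℚ)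
    (AddMonoidHom.toMultiplicativeRight χ)
    (fun γ y h ↦ congrArg Multiplicative.ofAdd (hχ γ y h))
  refine ⟨(MonoidHom.toAdditiveLeft (Abelianization.lift ψ)).toIntLinearMap, ?_⟩
  ext γ
  exact congrArg Multiplicative.toAdd (hψ γ)

include c hy₀ hD in
/-- The rank of the abelianized fundamental group of the quotient lies between the dimension of the
space of homomorphisms `G → ℚ` that vanish on the stabilizers, and that of all of them. -/
theorem finrank_bounds [FiniteDimensional ℚ (Additive G →+ ℚ)] :
    Module.finrank ℚ (homsVanishingOnStabilizers G Y) ≤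
      Module.finrank ℤ (Additive (Abelianization
        (FundamentalGroup (MulAction.orbitRel.Quotient G Y) (proj G Y y₀)))) ∧
    Module.finrank ℤ (Additive (Abelianization
        (FundamentalGroup (MulAction.orbitRel.Quotient G Y) (proj G Y y₀)))) ≤
      Module.finrank ℚ (Additive G →+ ℚ) := by
  rw [finrank_int_eq_finrank_hom, ← LinearMap.finrank_range_of_inj (pullback_injective c hy₀ hD)]
  exact ⟨Submodule.finrank_mono (le_range_pullback c hy₀ hD), Submodule.finrank_le _⟩

end LocalContraction
end CuspScattering

end

noncomputable section
namespace CuspScattering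
open Matrix OnePoint
open scoped unitInterval Topology ComplexConjugate

/-! ### The contraction of the upper half-plane to a point -/

/-- The coordinate of `z` in the disc model of the hyperbolic plane centred at `z₀`. -/
def toDisc (z₀ z : ℍ) : ℂ := ((z : ℂ) - z₀) / ((z : ℂ) - conj (z₀ : ℂ))

lemma sub_conj_ne_zero (z₀ z : ℍ) : (z : ℂ) - conj (z₀ : ℂ) ≠ 0 := by
  intro h
  have := congrArg Complex.im h
  simp at this
  have h1 := z.im_pos
  have h2 := z₀.im_pos
  linarith

lemma norm_toDisc_lt_one (z₀ z : ℍ) : ‖toDisc z₀ z‖ < 1 := by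
  have h := UpperHalfPlane.tanh_half_dist z z₀
  rw [toDisc, norm_div, ← dist_eq_norm, ← dist_eq_norm, ← h]
  exact Real.tanh_lt_one _

/-- The inverse of `toDisc z₀`. -/
def fromDisc (z₀ : ℍ) (w : ℂ) (hw : ‖w‖ < 1) : ℍ :=
  ⟨((z₀ : ℂ) - conj (z₀ : ℂ) * w) / (1 - w), by
    have h1 : (1 : ℂ) - w ≠ 0 := by
      intro h
      rw [sub_eq_zero] at h
      rw [← h, norm_one] at hw
      exact lt_irrefl _ hw
    have h2 : (((z₀ : ℂ) - conj (z₀ : ℂ) * w) / (1 - w)).im =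
        z₀.im * (1 - Complex.normSq w) / Complex.normSq (1 - w) := by
      rw [Complex.div_im]
      simp [Complex.normSq_apply]
      field_simp
      ring
    rw [h2]
    have h3 : Complex.normSq w < 1 := by
      rw [Complex.normSq_eq_norm_sq]
      have := norm_nonneg w
      nlinarith
    exact div_pos (mul_pos z₀.im_pos (by linarith)) (Complex.normSq_pos.2 h1)⟩

lemma toDisc_fromDisc (z₀ : ℍ) (w : ℂ) (hw : ‖w‖ < 1) : toDisc z₀ (fromDisc z₀ w hw) = w := by
  have h1 : (1 : ℂ) - w ≠ 0 := by
    intro h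
    rw [sub_eq_zero] at h
    rw [← h, norm_one] at hw
    exact lt_irrefl _ hw
  have h2 := sub_conj_ne_zero z₀ (fromDisc z₀ w hw)
  rw [toDisc, div_eq_iff h2]
  simp only [fromDisc]
  field_simp
  ring

lemma toDisc_injective (z₀ : ℍ) : Function.Injective (toDisc z₀) := by
  intro a b h
  rw [toDisc, toDisc, div_eq_div_iff (sub_conj_ne_zero _ _) (sub_conj_ne_zero _ _)] at h
  have h3 : ((a : ℂ) - b) * ((z₀ : ℂ) - conj (z₀ : ℂ)) = 0 := by linear_combination h
  rcases mul_eq_zero.1 h3 with h4 | h4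
  · exact UpperHalfPlane.ext (sub_eq_zero.1 h4)
  · exact absurd h4 (sub_conj_ne_zero z₀ z₀)

lemma continuous_toDisc (z₀ : ℍ) : Continuous (toDisc z₀) :=
  Continuous.div (by fun_prop) (by fun_prop) (sub_conj_ne_zero z₀)

lemma sub_eq_of_fixed {a b c d z w : ℂ} (hdet : a * d - b * c = 1) (hz : c * z + d ≠ 0)
    (hw : c * w + d ≠ 0) (h : (a * w + b) / (c * w + d) = w) :
    (a * z + b) / (c * z + d) - w = (z - w) / ((c * z + d) * (c * w + d)) := by
  nth_rewrite 1 [← h]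
  rw [div_sub_div _ _ hz hw]
  congr 1
  linear_combination (z - w) * hdet

/-- An element of the stabilizer of `z₀` acts on the disc model as a rotation. -/
lemma exists_toDisc_smul (z₀ : ℍ) (g : SL(2, ℤ)) (hg : g • z₀ = z₀) :
    ∃ u : ℂ, ∀ z, toDisc z₀ (g • z) = u * toDisc z₀ z := by
  have hd : ∀ z : ℍ, ((g 1 0 : ℤ) : ℂ) * z + ((g 1 1 : ℤ) : ℂ) ≠ 0 := by
    intro z
    have := UpperHalfPlane.denom_ne_zero (SpecialLinearGroup.mapGL ℝ g) z
    simpa [UpperHalfPlane.denom] using this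
  have hdet : ((g 0 0 : ℤ) : ℂ) * (g 1 1 : ℤ) - (g 0 1 : ℤ) * (g 1 0 : ℤ) = 1 := by
    have := g.det_coe
    rw [det_fin_two] at this
    exact_mod_cast this
  have hdc : ((g 1 0 : ℤ) : ℂ) * conj (z₀ : ℂ) + ((g 1 1 : ℤ) : ℂ) ≠ 0 := by
    have h := (map_ne_zero (starRingEnd ℂ)).2 (hd z₀)
    simpa using h
  have h0 : (((g 0 0 : ℤ) : ℂ) * z₀ + ((g 0 1 : ℤ) : ℂ)) /
      (((g 1 0 : ℤ) : ℂ) * z₀ + ((g 1 1 : ℤ) : ℂ)) = z₀ := by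
    have := UpperHalfPlane.coe_specialLinearGroup_apply g z₀
    rw [hg] at this
    simpa using this.symm
  have h0c : (((g 0 0 : ℤ) : ℂ) * conj (z₀ : ℂ) + ((g 0 1 : ℤ) : ℂ)) /
      (((g 1 0 : ℤ) : ℂ) * conj (z₀ : ℂ) + ((g 1 1 : ℤ) : ℂ)) = conj (z₀ : ℂ) := by
    have := congrArg (starRingEnd ℂ) h0
    simpa using this
  refine ⟨(((g 1 0 : ℤ) : ℂ) * conj (z₀ : ℂ) + ((g 1 1 : ℤ) : ℂ)) /
    (((g 1 0 : ℤ) : ℂ) * z₀ + ((g 1 1 : ℤ) : ℂ)), fun z ↦ ?_⟩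
  have e : ((g • z : ℍ) : ℂ) = (((g 0 0 : ℤ) : ℂ) * z + ((g 0 1 : ℤ) : ℂ)) /
      (((g 1 0 : ℤ) : ℂ) * z + ((g 1 1 : ℤ) : ℂ)) := by
    simpa using UpperHalfPlane.coe_specialLinearGroup_apply g z
  rw [toDisc, toDisc, e, sub_eq_of_fixed hdet (hd z) (hd z₀) h0,
    sub_eq_of_fixed hdet (hd z) hdc h0c, div_div_div_eq, div_mul_div_comm, div_eq_div_iff
      (mul_ne_zero (mul_ne_zero (hd z) (hd z₀)) (sub_conj_ne_zero z₀ z))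
      (mul_ne_zero (hd z₀) (sub_conj_ne_zero z₀ z))]
  ring

lemma norm_smul_toDisc_lt_one (t : I) (z₀ z : ℍ) : ‖(1 - (t : ℝ) : ℂ) * toDisc z₀ z‖ < 1 := by
  have h := norm_toDisc_lt_one z₀ z
  have h2 : ‖(1 - (t : ℝ) : ℂ)‖ ≤ 1 := by
    rw [← Complex.ofReal_one, ← Complex.ofReal_sub, Complex.norm_real, Real.norm_eq_abs, abs_le]
    constructor <;> linarith [t.2.1, t.2.2]
  rw [norm_mul]
  have := norm_nonneg (toDisc z₀ z)
  nlinarith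

/-- The contraction of the upper half-plane to `z₀` along geodesics. -/
def discContraction (z₀ : ℍ) (t : I) (z : ℍ) : ℍ :=
  fromDisc z₀ ((1 - (t : ℝ) : ℂ) * toDisc z₀ z) (norm_smul_toDisc_lt_one t z₀ z)

lemma toDisc_discContraction (z₀ : ℍ) (t : I) (z : ℍ) :
    toDisc z₀ (discContraction z₀ t z) = (1 - (t : ℝ) : ℂ) * toDisc z₀ z :=
  toDisc_fromDisc _ _ _

lemma continuous_discContraction (z₀ : ℍ) :
    Continuous fun p : I × ℍ ↦ discContraction z₀ p.1 p.2 := by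
  rw [UpperHalfPlane.isEmbedding_coe.continuous_iff]
  have hc : Continuous fun p : I × ℍ ↦ (1 - ((p.1 : ℝ) : ℂ)) * toDisc z₀ p.2 := by
    have := (continuous_toDisc z₀).comp (continuous_snd (X := I))
    have h2 : Continuous fun p : I × ℍ ↦ toDisc z₀ p.2 := this
    fun_prop
  refine Continuous.div (continuous_const.sub (continuous_const.mul hc))
    (continuous_const.sub hc) ?_
  rintro ⟨t, z⟩ h
  rw [sub_eq_zero] at h
  have := norm_smul_toDisc_lt_one t z₀ z
  rw [← h, norm_one] at this
  exact lt_irrefl _ this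

lemma discContraction_zero (z₀ z : ℍ) : discContraction z₀ 0 z = z := by
  apply toDisc_injective z₀
  simp [toDisc_discContraction]

lemma discContraction_one (z₀ z : ℍ) : discContraction z₀ 1 z = z₀ := by
  apply toDisc_injective z₀
  rw [toDisc_discContraction]
  simp [toDisc]

lemma discContraction_self (z₀ : ℍ) (t : I) : discContraction z₀ t z₀ = z₀ := by
  apply toDisc_injective z₀
  rw [toDisc_discContraction]
  simp [toDisc]

lemma discContraction_smul (z₀ : ℍ) (g : SL(2, ℤ)) (hg : g • z₀ = z₀) (t : I) (z : ℍ) :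
    discContraction z₀ t (g • z) = g • discContraction z₀ t z := by
  obtain ⟨u, hu⟩ := exists_toDisc_smul z₀ g hg
  apply toDisc_injective z₀
  rw [toDisc_discContraction, hu, hu, toDisc_discContraction]
  ring

/-! ### The topology of the extended half-plane -/

section
variable {𝒢 : Subgroup (GL (Fin 2) ℝ)}

lemma isOpen_extended_iff {U : Set (ExtendedHalfPlane 𝒢)} : IsOpen U ↔
    IsOpen {z : ℍ | ofPoint 𝒢 z ∈ U} ∧
    ∀ c : cuspsSubMulAction 𝒢, ofCusp 𝒢 c ∈ U →
      ∀ τ : SL(2, ℝ), (τ : GL (Fin 2) ℝ) • (∞ : OnePoint ℝ) = (c : OnePoint ℝ) →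
        ∃ Y : ℝ, ∀ z : ℍ, Y < z.im → ofPoint 𝒢 (τ • z) ∈ U := Iff.rfl

lemma continuous_ofPoint : Continuous (ofPoint 𝒢) :=
  ⟨fun _ hU ↦ (isOpen_extended_iff.1 hU).1⟩

lemma isOpenMap_ofPoint : IsOpenMap (ofPoint 𝒢) := by
  intro V hV
  refine isOpen_extended_iff.2 ⟨?_, ?_⟩
  · convert hV
    ext z
    exact ⟨fun ⟨w, hw, h⟩ ↦ Sum.inl.inj h ▸ hw, fun h ↦ ⟨z, h, rfl⟩⟩
  · rintro c ⟨w, -, h⟩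
    cases h

lemma smul_ofPoint (γ : 𝒢) (z : ℍ) : γ • ofPoint 𝒢 z = ofPoint 𝒢 ((γ : GL (Fin 2) ℝ) • z) := rfl

lemma ofPoint_ne_ofCusp (z : ℍ) (c : cuspsSubMulAction 𝒢) : ofPoint 𝒢 z ≠ ofCusp 𝒢 c := by
  intro h
  cases h

lemma ofPoint_injective : Function.Injective (ofPoint 𝒢) := Sum.inl_injective

lemma ofCusp_injective : Function.Injective (ofCusp 𝒢) := Sum.inr_injective

end

end CuspScattering

end

noncomputable section
namespace CuspScattering
open Matrix OnePoint
open scoped unitInterval Topology ComplexConjugate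

/-! ### Vertical movement in the upper half-plane -/

section smul
variable {Γ : Subgroup SL(2, ℤ)}

/-- The inclusion of `SL(2, ℤ)` into `SL(2, ℝ)`. -/
abbrev mapR : SL(2, ℤ) →* SL(2, ℝ) := SpecialLinearGroup.map (n := Fin 2) (Int.castRingHom ℝ)

lemma coe_mapR (g : SL(2, ℤ)) : ((mapR g : SL(2, ℝ)) : GL (Fin 2) ℝ) =
    SpecialLinearGroup.mapGL ℝ g := rfl

lemma mapR_smul (g : SL(2, ℤ)) (z : ℍ) : (mapR g : SL(2, ℝ)) • z = g • z := rfl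

/-- An element of `SL(2, ℝ)` that fixes `∞` scales the imaginary part. -/
lemma exists_im_smul_of_smul_infty (ρ : SL(2, ℝ))
    (h : (ρ : GL (Fin 2) ℝ) • (∞ : OnePoint ℝ) = ∞) :
    ∃ r : ℝ, 0 < r ∧ ∀ z : ℍ, (ρ • z).im = r * z.im := by
  rw [smul_infty_eq_self_iff] at h
  have h10 : ρ 1 0 = 0 := h
  have hdet : ρ 0 0 * ρ 1 1 - ρ 0 1 * ρ 1 0 = 1 := by
    have := ρ.det_coe
    rwa [det_fin_two] at this
  have h11 : ρ 1 1 ≠ 0 := by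
    intro h11
    rw [h10, h11] at hdet
    simp at hdet
  refine ⟨(ρ 1 1 ^ 2)⁻¹, by positivity, fun z ↦ ?_⟩
  have := UpperHalfPlane.im_smul_eq_div_normSq (SpecialLinearGroup.mapGL ℝ ρ) z
  have e : ρ • z = SpecialLinearGroup.mapGL ℝ ρ • z := rfl
  rw [e, this]
  simp [UpperHalfPlane.denom, h10, Complex.normSq_apply]
  field_simp

lemma exists_im_inv_smul {g : SL(2, ℤ)} {τ : SL(2, ℝ)}
    (h : (τ : GL (Fin 2) ℝ) • (∞ : OnePoint ℝ) = SpecialLinearGroup.mapGL ℝ g • (∞ : OnePoint ℝ)) :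
    ∃ r : ℝ, 0 < r ∧ ∀ z : ℍ, (g⁻¹ • (τ • z)).im = r * z.im := by
  obtain ⟨r, hr, h2⟩ := exists_im_smul_of_smul_infty ((mapR g)⁻¹ * τ) (by
    rw [map_mul, mul_smul, h, ← mul_smul, ← coe_mapR, ← map_mul, inv_mul_cancel, map_one, one_smul])
  refine ⟨r, hr, fun z ↦ ?_⟩
  rw [← h2, mul_smul, ← map_inv, mapR_smul]

/-- The vertical shift by `|r|`. -/
def verticalShift (r : ℝ) (z : ℍ) : ℍ := ⟨(z : ℂ) + (|r| : ℝ) * Complex.I, by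
  have := z.im_pos
  simp only [Complex.add_im, Complex.mul_im, Complex.ofReal_re, Complex.I_im, mul_one,
    Complex.ofReal_im, Complex.I_re, mul_zero, add_zero, UpperHalfPlane.coe_im]
  positivity⟩

lemma im_verticalShift (r : ℝ) (z : ℍ) : (verticalShift r z).im = z.im + |r| := by
  rw [← UpperHalfPlane.coe_im]
  simp [verticalShift]

lemma continuousAt_verticalShift {X : Type*} [TopologicalSpace X] {f : X → ℝ} {k : X → ℍ} {x : X}
    (hf : ContinuousAt f x) (hk : ContinuousAt k x) :
    ContinuousAt (fun x ↦ verticalShift (f x) (k x)) x := by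
  rw [UpperHalfPlane.isEmbedding_coe.continuousAt_iff]
  have h1 : ContinuousAt (fun x ↦ (k x : ℂ)) x := UpperHalfPlane.continuous_coe.continuousAt.comp hk
  have h2 : ContinuousAt (fun x ↦ ((|f x| : ℝ) : ℂ)) x :=
    Complex.continuous_ofReal.continuousAt.comp (continuous_abs.continuousAt.comp hf)
  exact h1.add (h2.mul continuousAt_const)

lemma verticalShift_zero (z : ℍ) : verticalShift 0 z = z := by
  ext
  simp [verticalShift]

lemma verticalShift_T_zpow (r : ℝ) (n : ℤ) (z : ℍ) :
    verticalShift r (ModularGroup.T ^ n • z) = ModularGroup.T ^ n • verticalShift r z := by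
  ext
  rw [ModularGroup.coe_T_zpow_smul_eq]
  simp only [verticalShift, ModularGroup.coe_T_zpow_smul_eq]
  ring

lemma verticalShift_smul (r : ℝ) (δ : SL(2, ℤ)) (h : δ 1 0 = 0) (z : ℍ) :
    verticalShift r (δ • z) = δ • verticalShift r z := by
  obtain ⟨n, hn⟩ := ModularGroup.exists_eq_T_zpow_of_c_eq_zero h
  rw [hn, hn, verticalShift_T_zpow]

/-- Two points of height more than `1` are only equivalent under elements that fix `∞`. -/
lemma apply_one_zero_eq_zero_of_one_lt_im (δ : SL(2, ℤ)) (w : ℍ) (hw : 1 < w.im)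
    (hδ : 1 < (δ • w).im) : δ 1 0 = 0 := by
  have h1 := UpperHalfPlane.im_smul_eq_div_normSq (SpecialLinearGroup.mapGL ℝ δ) w
  have h2 := UpperHalfPlane.c_mul_im_sq_le_normSq_denom (SpecialLinearGroup.mapGL ℝ δ) w
  have e : δ • w = SpecialLinearGroup.mapGL ℝ δ • w := rfl
  rw [e, h1] at hδ
  have h3 : 0 < Complex.normSq (UpperHalfPlane.denom (SpecialLinearGroup.mapGL ℝ δ) w) :=
    UpperHalfPlane.normSq_denom_pos _ w.im_ne_zero
  rw [lt_div_iff₀ h3] at hδ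
  simp at hδ h2
  by_contra hc
  have h4 : (1 : ℝ) ≤ ((δ 1 0 : ℤ) : ℝ) ^ 2 := by
    have : 1 ≤ (δ 1 0) ^ 2 := by
      have := sq_pos_of_ne_zero hc
      linarith
    exact_mod_cast this
  nlinarith [mul_le_mul_of_nonneg_right h4 (sq_nonneg w.im)]

end smul

/-! ### The contraction of the extended half-plane to an ordinary point -/

section contraction
variable {Γ : Subgroup SL(2, ℤ)}

/-- The image in `GL(2, ℝ)` of a subgroup of `SL(2, ℤ)`. -/
abbrev realImage (Γ : Subgroup SL(2, ℤ)) : Subgroup (GL (Fin 2) ℝ) :=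
  Γ.map (SpecialLinearGroup.mapGL ℝ)

/-- The points of the upper half-plane. -/
def ordinaryPoints (𝒢 : Subgroup (GL (Fin 2) ℝ)) : Set (ExtendedHalfPlane 𝒢) :=
  Set.range (ofPoint 𝒢)

lemma isOpenEmbedding_ofPoint (𝒢 : Subgroup (GL (Fin 2) ℝ)) :
    Topology.IsOpenEmbedding (ofPoint 𝒢) :=
  .of_continuous_injective_isOpenMap continuous_ofPoint ofPoint_injective isOpenMap_ofPoint

lemma smul_mem_ordinaryPoints {𝒢 : Subgroup (GL (Fin 2) ℝ)} (γ : 𝒢) :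
    ∀ z ∈ ordinaryPoints 𝒢, γ • z ∈ ordinaryPoints 𝒢 := by
  rintro _ ⟨z, rfl⟩
  exact ⟨_, rfl⟩

lemma exists_eq_mapGL (γ : realImage Γ) :
    ∃ k ∈ Γ, (γ : GL (Fin 2) ℝ) = SpecialLinearGroup.mapGL ℝ k := by
  obtain ⟨γ, k, hk, rfl⟩ := γ
  exact ⟨k, hk, rfl⟩

instance : ContinuousConstSMul (realImage Γ) (ExtendedHalfPlane (realImage Γ)) where
  continuous_const_smul γ := by
    obtain ⟨k, hk, hγ⟩ := exists_eq_mapGL γ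
    refine ⟨fun U hU ↦ isOpen_extended_iff.2 ⟨?_, ?_⟩⟩
    · exact (isOpen_extended_iff.1 hU).1.preimage (continuous_const_smul (γ : GL (Fin 2) ℝ))
    · intro c hc τ hτ
      obtain ⟨Y, hY⟩ := (isOpen_extended_iff.1 hU).2 (γ • c) hc
        (mapR k * τ) (by
          rw [map_mul, mul_smul, hτ, coe_mapR, ← hγ]
          rfl)
      refine ⟨Y, fun z hz ↦ ?_⟩
      have := hY z hz
      rw [mul_smul, mapR_smul] at this
      change ofPoint (realImage Γ) ((γ : GL (Fin 2) ℝ) • (τ • z)) ∈ U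
      rw [hγ]
      exact this

instance : ProperlyDiscontinuousSMul (realImage Γ) ℍ := by
  have h := properlyDiscontinuousSL2ZRange
  rw [Subgroup.properlyDiscontinuousSMul_iff] at h ⊢
  intro K L hK hL
  refine (h hK hL).subset ?_
  rintro γ ⟨⟨k, hk, rfl⟩, h2⟩
  exact ⟨⟨k, rfl⟩, h2⟩

/-- The contraction to an ordinary point. -/
def pointContraction (z₀ : ℍ) :
    LocalContraction (realImage Γ) (ordinaryPoints (realImage Γ)) (ofPoint (realImage Γ) z₀) :=
  have hN := ProperlyDiscontinuousSMul.exists_nhds_image_smul_eq_self (realImage Γ) z₀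
  have hZ : insert (ofPoint (realImage Γ) z₀) (ordinaryPoints (realImage Γ)) =
      ordinaryPoints (realImage Γ) :=
    Set.insert_eq_of_mem ⟨z₀, rfl⟩
  { U := ofPoint (realImage Γ) '' interior hN.choose
    isOpen_U := isOpenMap_ofPoint _ isOpen_interior
    mem_U := ⟨z₀, mem_interior_iff_mem_nhds.2 hN.choose_spec.1, rfl⟩
    U_subset := by
      rw [hZ]
      exact Set.image_subset_range _ _
    smul_eq_of_mem := by
      rintro γ _ ⟨z, hz, rfl⟩ ⟨w, hw, h⟩
      have h1 : w = γ • z := ofPoint_injective h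
      exact congrArg (ofPoint (realImage Γ)) (hN.choose_spec.2 γ
        ⟨w, ⟨z, interior_subset hz, h1.symm⟩, interior_subset hw⟩)
    h := fun t ↦ Sum.elim (fun z ↦ ofPoint (realImage Γ) (discContraction z₀ t z))
      (fun c ↦ ofCusp (realImage Γ) c)
    continuousOn_h := by
      rw [hZ]
      rintro ⟨t, _⟩ ⟨-, ⟨z, rfl⟩⟩
      refine ContinuousAt.continuousWithinAt ?_
      have he := (Topology.IsOpenEmbedding.id (X := I)).prodMap
        (isOpenEmbedding_ofPoint (realImage Γ))
      refine (he.continuousAt_iff (x := (t, z))).1 ?_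
      exact (continuous_ofPoint.comp (continuous_discContraction z₀)).continuousAt
    h_zero := by
      rw [hZ]
      rintro _ ⟨z, rfl⟩
      exact congrArg (ofPoint (realImage Γ)) (discContraction_zero z₀ z)
    h_one := by
      rw [hZ]
      rintro _ ⟨z, rfl⟩
      exact congrArg (ofPoint (realImage Γ)) (discContraction_one z₀ z)
    h_mem := by
      rw [hZ]
      rintro t _ ⟨z, rfl⟩
      exact ⟨_, rfl⟩
    h_self := fun t ↦ congrArg (ofPoint (realImage Γ)) (discContraction_self z₀ t)
    h_smul := by
      rintro γ t _ ⟨z, hz, rfl⟩ hγ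
      obtain ⟨k, hk, hγk⟩ := exists_eq_mapGL γ
      have h1 : k • z₀ = z₀ := by
        have : (γ : GL (Fin 2) ℝ) • z₀ = z₀ := ofPoint_injective hγ
        rwa [hγk] at this
      have h2 := discContraction_smul z₀ k h1 t z
      change ofPoint (realImage Γ) (discContraction z₀ t ((γ : GL (Fin 2) ℝ) • z)) =
        ofPoint (realImage Γ) ((γ : GL (Fin 2) ℝ) • discContraction z₀ t z)
      rw [hγk]
      exact congrArg (ofPoint (realImage Γ)) h2 }

end contraction
end CuspScattering

end

noncomputable section
namespace CuspScattering
open Matrix OnePoint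
open scoped unitInterval Topology ComplexConjugate

/-! ### The contraction to a cusp, and the genus -/

section cusp
variable {Γ : Subgroup SL(2, ℤ)}

lemma exists_cusp_eq (c : cuspsSubMulAction (realImage Γ)) :
    ∃ g : SL(2, ℤ), SpecialLinearGroup.mapGL ℝ g • (∞ : OnePoint ℝ) = c := by
  have h : IsCusp (c : OnePoint ℝ) (realImage Γ) := c.2
  have h2 : IsCusp (c : OnePoint ℝ) 𝒮ℒ := h.mono (by
    rintro _ ⟨k, -, rfl⟩
    exact ⟨k, rfl⟩)
  obtain ⟨g, hg⟩ := isCusp_SL2Z_iff'.1 h2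
  exact ⟨g, hg.symm⟩

/-- The horoball of the points above height `Y` at the cusp `c = g ∞`, together with `c`. -/
def horoball (c : cuspsSubMulAction (realImage Γ)) (g : SL(2, ℤ)) (Y : ℝ) :
    Set (ExtendedHalfPlane (realImage Γ)) :=
  insert (ofCusp _ c) (ofPoint _ '' {z | Y < (g⁻¹ • z).im})

lemma isOpen_horoball {c : cuspsSubMulAction (realImage Γ)} {g : SL(2, ℤ)}
    (hg : SpecialLinearGroup.mapGL ℝ g • (∞ : OnePoint ℝ) = c) (Y : ℝ) :
    IsOpen (horoball c g Y) := by
  refine isOpen_extended_iff.2 ⟨?_, ?_⟩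
  · have : {z | ofPoint (realImage Γ) z ∈ horoball c g Y} = {z : ℍ | Y < (g⁻¹ • z).im} := by
      ext z
      constructor
      · rintro (h | ⟨w, hw, h⟩)
        · exact absurd h (ofPoint_ne_ofCusp z c)
        · exact ofPoint_injective h ▸ hw
      · intro h
        exact Or.inr ⟨z, h, rfl⟩
    rw [this]
    have hc : Continuous fun z : ℍ ↦ g⁻¹ • z :=
      continuous_const_smul (SpecialLinearGroup.mapGL ℝ g⁻¹)
    exact isOpen_lt continuous_const (UpperHalfPlane.continuous_im.comp hc)
  · rintro c' (h | ⟨w, hw, h⟩) τ hτ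
    · obtain rfl := ofCusp_injective h
      obtain ⟨r, hr, h2⟩ := exists_im_inv_smul (hτ.trans hg.symm)
      refine ⟨Y / r, fun z hz ↦ Or.inr ⟨_, ?_, rfl⟩⟩
      change Y < (g⁻¹ • (τ • z)).im
      rw [h2]
      rwa [div_lt_iff₀' hr] at hz
    · exact absurd h (ofPoint_ne_ofCusp w c')

lemma exists_horoball_subset {c : cuspsSubMulAction (realImage Γ)} {g : SL(2, ℤ)}
    (hg : SpecialLinearGroup.mapGL ℝ g • (∞ : OnePoint ℝ) = c)
    {V : Set (ExtendedHalfPlane (realImage Γ))} (hV : V ∈ 𝓝 (ofCusp _ c)) :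
    ∃ Y, horoball c g Y ⊆ V := by
  obtain ⟨W, hWV, hW, hcW⟩ := mem_nhds_iff.1 hV
  obtain ⟨Y, hY⟩ := (isOpen_extended_iff.1 hW).2 c hcW (mapR g) (by rw [coe_mapR, hg])
  refine ⟨Y, ?_⟩
  rintro _ (rfl | ⟨z, hz, rfl⟩)
  · exact hWV hcW
  · have := hY (g⁻¹ • z) hz
    rw [mapR_smul, smul_inv_smul] at this
    exact hWV this

/-- The vertical movement towards the cusp `c = g ∞`. -/
def toCusp (c : cuspsSubMulAction (realImage Γ)) (g : SL(2, ℤ)) (t : I) :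
    ExtendedHalfPlane (realImage Γ) → ExtendedHalfPlane (realImage Γ) :=
  Sum.elim
    (fun z ↦ if (t : ℝ) < 1 then ofPoint _ (g • verticalShift ((t : ℝ) / (1 - t)) (g⁻¹ • z))
      else ofCusp _ c)
    (fun c' ↦ ofCusp _ c')

lemma toCusp_ofPoint_of_lt (c : cuspsSubMulAction (realImage Γ)) (g : SL(2, ℤ)) (t : I)
    (ht : (t : ℝ) < 1) (z : ℍ) : toCusp c g t (ofPoint _ z) =
      ofPoint _ (g • verticalShift ((t : ℝ) / (1 - t)) (g⁻¹ • z)) := if_pos ht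

lemma toCusp_one (c : cuspsSubMulAction (realImage Γ)) (g : SL(2, ℤ)) (z : ℍ) :
    toCusp c g 1 (ofPoint _ z) = ofCusp _ c := if_neg (by simp)

lemma toCusp_ofCusp (c c' : cuspsSubMulAction (realImage Γ)) (g : SL(2, ℤ)) (t : I) :
    toCusp c g t (ofCusp _ c') = ofCusp _ c' := rfl

lemma toCusp_mem_horoball (c : cuspsSubMulAction (realImage Γ)) (g : SL(2, ℤ)) (Y : ℝ) (t : I)
    (z : ℍ) (h : (t : ℝ) < 1 → Y < (g⁻¹ • z).im + (t : ℝ) / (1 - t)) :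
    toCusp c g t (ofPoint _ z) ∈ horoball c g Y := by
  by_cases ht : (t : ℝ) < 1
  · rw [toCusp_ofPoint_of_lt _ _ _ ht]
    refine Or.inr ⟨_, ?_, rfl⟩
    change Y < (g⁻¹ • (g • _) : ℍ).im
    rw [inv_smul_smul, im_verticalShift, abs_of_nonneg (div_nonneg t.2.1 (by linarith))]
    exact h ht
  · have : t = 1 := le_antisymm le_top (not_lt.1 ht)
    rw [this, toCusp_one]
    exact Or.inl rfl

lemma continuousOn_toCusp {c : cuspsSubMulAction (realImage Γ)} {g : SL(2, ℤ)}
    (hg : SpecialLinearGroup.mapGL ℝ g • (∞ : OnePoint ℝ) = c) :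
    ContinuousOn (fun p : I × ExtendedHalfPlane (realImage Γ) ↦ toCusp c g p.1 p.2)
      (Set.univ ×ˢ insert (ofCusp _ c) (ordinaryPoints (realImage Γ))) := by
  have hone : ∀ y ∈ insert (ofCusp _ c) (ordinaryPoints (realImage Γ)),
      ContinuousWithinAt (fun p : I × ExtendedHalfPlane (realImage Γ) ↦ toCusp c g p.1 p.2)
      (Set.univ ×ˢ insert (ofCusp _ c) (ordinaryPoints (realImage Γ))) (1, y) := by
    intro y hy V hV
    have hval : toCusp c g 1 y = ofCusp _ c := by
      rcases hy with rfl | ⟨z, rfl⟩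
      · rfl
      · exact toCusp_one c g z
    simp only [hval] at hV
    obtain ⟨Y, hY⟩ := exists_horoball_subset hg hV
    have hB : {p : I × ExtendedHalfPlane (realImage Γ) | Y * (1 - (p.1 : ℝ)) < p.1} ∈ 𝓝 (1, y) := by
      refine (isOpen_lt (by fun_prop) (by fun_prop)).mem_nhds ?_
      simp
    rw [Filter.mem_map]
    filter_upwards [mem_nhdsWithin_of_mem_nhds hB, self_mem_nhdsWithin]
    rintro ⟨t, _⟩ ht ⟨-, (rfl | ⟨z, rfl⟩)⟩
    · exact show ofCusp _ c ∈ V from mem_of_mem_nhds hV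
    · refine hY (toCusp_mem_horoball c g Y t z fun ht1 ↦ ?_)
      have h1 : 0 < 1 - (t : ℝ) := by linarith
      have h2 : Y < (t : ℝ) / (1 - t) := (lt_div_iff₀ h1).2 ht
      have h3 := (g⁻¹ • z).im_pos
      linarith
  rintro ⟨t, y⟩ ⟨-, hy⟩
  rcases eq_or_ne t 1 with rfl | ht
  · exact hone y hy
  rcases hy with rfl | ⟨z, rfl⟩
  · intro V hV
    obtain ⟨Y, hY⟩ := exists_horoball_subset hg (V := V) hV
    rw [Filter.mem_map]
    have hB : {p : I × ExtendedHalfPlane (realImage Γ) | p.2 ∈ horoball c g Y} ∈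
        𝓝 (t, ofCusp _ c) :=
      ((isOpen_horoball hg Y).preimage continuous_snd).mem_nhds (Or.inl rfl)
    filter_upwards [mem_nhdsWithin_of_mem_nhds hB]
    rintro ⟨t, _⟩ (rfl | ⟨z, hz, rfl⟩)
    · exact show ofCusp _ c ∈ V from mem_of_mem_nhds hV
    · refine hY (toCusp_mem_horoball c g Y t z fun ht1 ↦ ?_)
      have h1 : 0 ≤ (t : ℝ) / (1 - t) := div_nonneg t.2.1 (by linarith)
      have h2 : Y < (g⁻¹ • z).im := hz
      linarith
  · have ht1 : (t : ℝ) < 1 := lt_of_le_of_ne t.2.2 fun h ↦ ht (Subtype.ext h)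
    refine ContinuousAt.continuousWithinAt ?_
    have he := (Topology.IsOpenEmbedding.id (X := I)).prodMap
      (isOpenEmbedding_ofPoint (realImage Γ))
    refine (he.continuousAt_iff (x := (t, z))).1 ?_
    have hc : ContinuousAt (fun p : I × ℍ ↦ ofPoint (realImage Γ)
        (g • verticalShift ((p.1 : ℝ) / (1 - p.1)) (g⁻¹ • p.2))) (t, z) := by
      refine continuous_ofPoint.continuousAt.comp ?_
      refine (continuous_const_smul (SpecialLinearGroup.mapGL ℝ g)).continuousAt.comp
        (g := fun z : ℍ ↦ SpecialLinearGroup.mapGL ℝ g • z) ?_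
      refine continuousAt_verticalShift ?_ ?_
      · refine ContinuousAt.div (by fun_prop) (by fun_prop) ?_
        change 1 - (t : ℝ) ≠ 0
        linarith
      · exact ((continuous_const_smul (SpecialLinearGroup.mapGL ℝ g⁻¹)).comp
          continuous_snd).continuousAt
    refine hc.congr ?_
    have hB : {p : I × ℍ | (p.1 : ℝ) < 1} ∈ 𝓝 (t, z) :=
      (isOpen_lt (by fun_prop) (by fun_prop)).mem_nhds ht1
    filter_upwards [hB]
    rintro ⟨s, w⟩ hs
    exact (toCusp_ofPoint_of_lt c g s hs w).symm

lemma apply_one_zero_conj {c : cuspsSubMulAction (realImage Γ)} {g k : SL(2, ℤ)}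
    (hg : SpecialLinearGroup.mapGL ℝ g • (∞ : OnePoint ℝ) = c) :
    SpecialLinearGroup.mapGL ℝ k • (c : OnePoint ℝ) = c ↔ (g⁻¹ * k * g) 1 0 = 0 := by
  have h1 : SpecialLinearGroup.mapGL ℝ k • (c : OnePoint ℝ) = c ↔
      SpecialLinearGroup.mapGL ℝ (g⁻¹ * k * g) • (∞ : OnePoint ℝ) = ∞ := by
    rw [← hg, map_mul, map_mul, mul_smul, mul_smul, map_inv, inv_smul_eq_iff]
  rw [h1, smul_infty_eq_self_iff]
  simp only [SpecialLinearGroup.mapGL_coe_matrix, SpecialLinearGroup.map_apply_coe,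
    RingHom.mapMatrix_apply, Matrix.map_apply]
  simp

/-- The contraction to a cusp. -/
def cuspContraction (c : cuspsSubMulAction (realImage Γ)) :
    LocalContraction (realImage Γ) (ordinaryPoints (realImage Γ)) (ofCusp _ c) :=
  have hg := (exists_cusp_eq c).choose_spec
  { U := horoball c (exists_cusp_eq c).choose 1
    isOpen_U := isOpen_horoball hg 1
    mem_U := Or.inl rfl
    U_subset := Set.insert_subset_insert (Set.image_subset_range _ _)
    smul_eq_of_mem := by
      rintro γ _ (rfl | ⟨z, hz, rfl⟩) h
      · rcases h with h | ⟨w, -, h⟩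
        · exact h
        · exact absurd h (ofPoint_ne_ofCusp w (γ • c))
      · rcases h with h | ⟨w, hw, h⟩
        · exact absurd h (ofPoint_ne_ofCusp ((γ : GL (Fin 2) ℝ) • z) c)
        · obtain ⟨k, hk, hγ⟩ := exists_eq_mapGL γ
          have h1 : w = k • z := by
            have : w = (γ : GL (Fin 2) ℝ) • z := ofPoint_injective h
            rwa [hγ] at this
          refine congrArg (ofCusp _) (Subtype.ext ?_)
          change (γ : GL (Fin 2) ℝ) • (c : OnePoint ℝ) = c
          rw [hγ, apply_one_zero_conj hg]
          refine apply_one_zero_eq_zero_of_one_lt_im _ ((exists_cusp_eq c).choose⁻¹ • z) hz ?_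
          rw [mul_smul, smul_inv_smul, mul_smul, ← h1]
          exact hw
    h := toCusp c (exists_cusp_eq c).choose
    continuousOn_h := continuousOn_toCusp hg
    h_zero := by
      rintro _ (rfl | ⟨z, rfl⟩)
      · rfl
      · rw [toCusp_ofPoint_of_lt _ _ _ (by simp)]
        simp [verticalShift_zero]
    h_one := by
      rintro _ (rfl | ⟨z, rfl⟩)
      · rfl
      · exact toCusp_one _ _ _
    h_mem := by
      rintro t _ (rfl | ⟨z, rfl⟩)
      · exact Or.inl rfl
      · exact Set.insert_subset_insert (Set.image_subset_range _ _)
          (toCusp_mem_horoball c (exists_cusp_eq c).choose 0 t z fun ht ↦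
            add_pos_of_pos_of_nonneg (UpperHalfPlane.im_pos _)
              (div_nonneg t.2.1 (by linarith)))
    h_self := fun t ↦ rfl
    h_smul := by
      rintro γ t _ (rfl | ⟨z, hz, rfl⟩) hγ
      · rw [toCusp_ofCusp, hγ]
        rfl
      · obtain ⟨k, hk, hγk⟩ := exists_eq_mapGL γ
        set g := (exists_cusp_eq c).choose
        have h1 : SpecialLinearGroup.mapGL ℝ k • (c : OnePoint ℝ) = c := by
          rw [← hγk]
          exact congrArg Subtype.val (ofCusp_injective hγ)
        rw [apply_one_zero_conj hg] at h1
        rw [smul_ofPoint, hγk]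
        by_cases ht : (t : ℝ) < 1
        · rw [toCusp_ofPoint_of_lt _ _ _ ht, toCusp_ofPoint_of_lt _ _ _ ht, smul_ofPoint, hγk]
          congr 1
          change g • verticalShift _ (g⁻¹ • k • z) = k • g • verticalShift _ (g⁻¹ • z)
          have h2 : g⁻¹ • k • z = (g⁻¹ * k * g) • (g⁻¹ • z) := by
            rw [mul_smul, smul_inv_smul, mul_smul]
          rw [h2, verticalShift_smul _ _ h1, ← mul_smul, ← mul_smul]
          congr 1
          group
        · have : t = 1 := le_antisymm le_top (not_lt.1 ht)
          rw [this, toCusp_one, toCusp_one, hγ] }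

/-- The contractions to all points of the extended half-plane. -/
def contraction : ∀ y : ExtendedHalfPlane (realImage Γ),
    LocalContraction (realImage Γ) (ordinaryPoints (realImage Γ)) y
  | Sum.inl z => pointContraction z
  | Sum.inr c => cuspContraction c

/-- The genus, up to rounding, lies between half the dimension of the space of homomorphisms
`Γ → ℚ` that vanish on the elliptic and parabolic elements, and half of that of all of them. -/
theorem genus_bounds [FiniteDimensional ℚ (Additive (realImage Γ) →+ ℚ)] :
    Module.finrank ℚ (homsVanishingOnStabilizers (realImage Γ) (ExtendedHalfPlane (realImage Γ))) ≤
      2 * genus (realImage Γ) + 1 ∧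
    2 * genus (realImage Γ) ≤ Module.finrank ℚ (Additive (realImage Γ) →+ ℚ) := by
  have h := LocalContraction.finrank_bounds (G := realImage Γ) contraction
    (y₀ := ofPoint _ UpperHalfPlane.I) ⟨_, rfl⟩ smul_mem_ordinaryPoints
  have e : genus (realImage Γ) = Module.finrank ℤ (Additive (Abelianization
        (FundamentalGroup (MulAction.orbitRel.Quotient (realImage Γ)
          (ExtendedHalfPlane (realImage Γ)))
          (LocalContraction.proj (realImage Γ) (ExtendedHalfPlane (realImage Γ))
            (ofPoint _ UpperHalfPlane.I))))) / 2 := rfl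
  rw [e]
  omega

end cusp
end CuspScattering

end

noncomputable section
namespace CuspScattering
open Matrix OnePoint

/-! ### The modular group as a free product -/

/-- The homomorphism from the cyclic group of order `n` that sends the generator to `g`. -/
def cyclicHom {K : Type*} [Group K] (n : ℕ) (g : K) (hg : g ^ n = 1) :
    Multiplicative (ZMod n) →* K :=
  AddMonoidHom.toMultiplicativeLeft (ZMod.lift n ⟨zmultiplesHom (Additive K) (Additive.ofMul g), by
    simp only [zmultiplesHom_apply]
    rw [← ofMul_zpow]
    simp [hg]⟩)

lemma cyclicHom_intCast {K : Type*} [Group K] (n : ℕ) (g : K) (hg : g ^ n = 1) (k : ℤ) :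
    cyclicHom n g hg (Multiplicative.ofAdd (k : ZMod n)) = g ^ k := by
  change Additive.toMul (ZMod.lift n ⟨zmultiplesHom (Additive K) (Additive.ofMul g), _⟩
    (k : ZMod n)) = _
  rw [ZMod.lift_coe]
  simp

/-- The action of `SL(2, ℤ)` on the rational projective line. -/
def projectiveAction : SL(2, ℤ) →* Equiv.Perm (OnePoint ℚ) :=
  (MulAction.toPermHom (GL (Fin 2) ℚ) (OnePoint ℚ)).comp (SpecialLinearGroup.mapGL ℚ)

lemma projectiveAction_coe (g : SL(2, ℤ)) (q : ℚ) (h : (g 1 0 : ℚ) * q + (g 1 1 : ℚ) ≠ 0) :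
    projectiveAction g (q : OnePoint ℚ) =
      ((((g 0 0 : ℚ) * q + (g 0 1 : ℚ)) / ((g 1 0 : ℚ) * q + (g 1 1 : ℚ)) : ℚ) : OnePoint ℚ) := by
  change SpecialLinearGroup.mapGL ℚ g • (q : OnePoint ℚ) = _
  rw [smul_some_eq_ite]
  simp [h]

lemma projectiveAction_neg_one : projectiveAction (-1) = 1 := by
  ext x
  change SpecialLinearGroup.mapGL ℚ (-1 : SL(2, ℤ)) • x = x
  cases x with
  | infty => simp [smul_infty_eq_ite]
  | coe q => simp [smul_some_eq_ite]

lemma S_mul_S : ModularGroup.S * ModularGroup.S = -1 := by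
  decide

lemma ST_pow_three : (ModularGroup.S * ModularGroup.T) ^ 3 = -1 := by
  decide

lemma projectiveAction_S {q : ℚ} (hq : q ≠ 0) :
    projectiveAction ModularGroup.S (q : OnePoint ℚ) = ((-1 / q : ℚ) : OnePoint ℚ) := by
  rw [projectiveAction_coe ModularGroup.S q (by simpa [ModularGroup.S] using hq)]
  simp [ModularGroup.S]

lemma projectiveAction_ST {q : ℚ} (hq : 0 < q) :
    projectiveAction (ModularGroup.S * ModularGroup.T) (q : OnePoint ℚ) =
      ((-1 / (q + 1) : ℚ) : OnePoint ℚ) := by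
  rw [projectiveAction_coe (ModularGroup.S * ModularGroup.T) q
    (by simp; linarith)]
  simp

lemma projectiveAction_ST_sq {q : ℚ} (hq : 0 < q) :
    projectiveAction ((ModularGroup.S * ModularGroup.T) ^ 2) (q : OnePoint ℚ) =
      ((-(q + 1) / q : ℚ) : OnePoint ℚ) := by
  rw [projectiveAction_coe ((ModularGroup.S * ModularGroup.T) ^ 2) q
    (by simp [pow_two]; linarith)]
  simp [pow_two]
  ring_nf

lemma zmod_two_eq_one : ∀ h : ZMod 2, h ≠ 0 → h = ((1 : ℤ) : ZMod 2) := by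
  decide

lemma zmod_three_eq_one_or_two :
    ∀ h : ZMod 3, h ≠ 0 → h = ((1 : ℤ) : ZMod 3) ∨ h = ((2 : ℤ) : ZMod 3) := by
  decide

/-- The modular group is the free product of the groups of order `2` and `3` generated by `S` and
`S T`: this is the ping-pong lemma for the positive and the negative rational numbers. -/
theorem exists_hom_of_order_two_three {K : Type*} [Group K] (s u : K) (hs : s ^ 2 = 1)
    (hu : u ^ 3 = 1) : ∃ ρ : SL(2, ℤ) →* K, ρ ModularGroup.S = s ∧
      ρ (ModularGroup.S * ModularGroup.T) = u := by
  let n : Bool → ℕ := fun b ↦ if b then 3 else 2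
  let a : Bool → SL(2, ℤ) := fun b ↦ if b then ModularGroup.S * ModularGroup.T else ModularGroup.S
  let k : Bool → K := fun b ↦ if b then u else s
  have ha : ∀ b, projectiveAction (a b) ^ n b = 1 := by
    rintro (_ | _)
    · rw [← map_pow]
      change projectiveAction (ModularGroup.S ^ 2) = 1
      rw [pow_two, S_mul_S, projectiveAction_neg_one]
    · rw [← map_pow]
      change projectiveAction ((ModularGroup.S * ModularGroup.T) ^ 3) = 1
      rw [ST_pow_three, projectiveAction_neg_one]
  have hk : ∀ b, k b ^ n b = 1 := by
    rintro (_ | _)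
    · exact hs
    · exact hu
  let f : ∀ b, Multiplicative (ZMod (n b)) →* Equiv.Perm (OnePoint ℚ) :=
    fun b ↦ cyclicHom (n b) (projectiveAction (a b)) (ha b)
  let f' : ∀ b, Multiplicative (ZMod (n b)) →* K := fun b ↦ cyclicHom (n b) (k b) (hk b)
  let X : Bool → Set (OnePoint ℚ) := fun b ↦
    if b then (fun q : ℚ ↦ (q : OnePoint ℚ)) '' Set.Iio 0
    else (fun q : ℚ ↦ (q : OnePoint ℚ)) '' Set.Ioi 0
  have hinj : Function.Injective (Monoid.CoprodI.lift f) := by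
    refine Monoid.CoprodI.lift_injective_of_ping_pong f (Or.inr ⟨true, ?_⟩) X ?_ ?_ ?_
    · change 3 ≤ Cardinal.mk (ZMod 3)
      simp
    · rintro (_ | _)
      · exact ⟨_, 1, by simp, rfl⟩
      · exact ⟨_, -1, by simp, rfl⟩
    · rintro (_ | _) (_ | _) hne
      · exact absurd rfl hne
      · rw [Function.onFun, Set.disjoint_left]
        rintro _ ⟨q, hq, rfl⟩ ⟨r, hr, h⟩
        have : r = q := OnePoint.coe_injective h
        simp at hq hr
        linarith
      · rw [Function.onFun, Set.disjoint_left]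
        rintro _ ⟨q, hq, rfl⟩ ⟨r, hr, h⟩
        have : r = q := OnePoint.coe_injective h
        simp at hq hr
        linarith
      · exact absurd rfl hne
    · rintro (_ | _) (_ | _) hne
      · exact absurd rfl hne
      · rintro (h : ZMod 2) h1 _ ⟨_, ⟨q, hq, rfl⟩, rfl⟩
        obtain rfl := zmod_two_eq_one h h1
        simp only [Set.mem_Iio] at hq
        refine ⟨-1 / q, ?_, ?_⟩
        · simp only [Set.mem_Ioi]
          exact div_pos_of_neg_of_neg (by norm_num) hq
        · change _ = cyclicHom 2 (projectiveAction ModularGroup.S) _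
            (Multiplicative.ofAdd ((1 : ℤ) : ZMod 2)) (q : OnePoint ℚ)
          rw [cyclicHom_intCast, zpow_one, projectiveAction_S hq.ne]
      · rintro (h : ZMod 3) h1 _ ⟨_, ⟨q, hq, rfl⟩, rfl⟩
        simp only [Set.mem_Ioi] at hq
        rcases zmod_three_eq_one_or_two h h1 with rfl | rfl
        · refine ⟨-1 / (q + 1), ?_, ?_⟩
          · simp only [Set.mem_Iio]
            exact div_neg_of_neg_of_pos (by norm_num) (by linarith)
          · change _ = cyclicHom 3 (projectiveAction (ModularGroup.S * ModularGroup.T)) _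
              (Multiplicative.ofAdd ((1 : ℤ) : ZMod 3)) (q : OnePoint ℚ)
            rw [cyclicHom_intCast, zpow_one, projectiveAction_ST hq]
        · refine ⟨-(q + 1) / q, ?_, ?_⟩
          · simp only [Set.mem_Iio]
            exact div_neg_of_neg_of_pos (by linarith) hq
          · change _ = cyclicHom 3 (projectiveAction (ModularGroup.S * ModularGroup.T)) _
              (Multiplicative.ofAdd ((2 : ℤ) : ZMod 3)) (q : OnePoint ℚ)
            rw [cyclicHom_intCast, show (2 : ℤ) = (2 : ℕ) from rfl, zpow_natCast, ← map_pow,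
              projectiveAction_ST_sq hq]
      · exact absurd rfl hne
  have hS : Monoid.CoprodI.lift f (Monoid.CoprodI.of (i := false)
      (Multiplicative.ofAdd ((1 : ℤ) : ZMod 2))) = projectiveAction ModularGroup.S := by
    rw [Monoid.CoprodI.lift_of]
    exact (cyclicHom_intCast 2 _ (ha false) 1).trans (zpow_one _)
  have hU : Monoid.CoprodI.lift f (Monoid.CoprodI.of (i := true)
      (Multiplicative.ofAdd ((1 : ℤ) : ZMod 3))) =
      projectiveAction (ModularGroup.S * ModularGroup.T) := by
    rw [Monoid.CoprodI.lift_of]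
    exact (cyclicHom_intCast 3 _ (ha true) 1).trans (zpow_one _)
  have hrange : ∀ g, projectiveAction g ∈ (Monoid.CoprodI.lift f).range := by
    have h : Subgroup.closure {ModularGroup.S, ModularGroup.T} ≤
        (Monoid.CoprodI.lift f).range.comap projectiveAction := by
      rw [Subgroup.closure_le]
      rintro g (rfl | rfl)
      · exact ⟨_, hS⟩
      · have h1 : projectiveAction (ModularGroup.S) ∈ (Monoid.CoprodI.lift f).range := ⟨_, hS⟩
        have h2 : projectiveAction (ModularGroup.S * ModularGroup.T) ∈
          (Monoid.CoprodI.lift f).range := ⟨_, hU⟩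
        rw [map_mul] at h2
        exact (Subgroup.mul_mem_cancel_left _ h1).1 h2
    rw [SpecialLinearGroup.SL2Z_generators] at h
    exact fun g ↦ h (Subgroup.mem_top g)
  let ρ : SL(2, ℤ) →* K := ((Monoid.CoprodI.lift f').comp
    (MonoidHom.ofInjective hinj).symm.toMonoidHom).comp
    (projectiveAction.codRestrict _ hrange)
  have hρ : ∀ w g, Monoid.CoprodI.lift f w = projectiveAction g →
      ρ g = Monoid.CoprodI.lift f' w := by
    intro w g h
    change Monoid.CoprodI.lift f' ((MonoidHom.ofInjective hinj).symm
      (projectiveAction.codRestrict _ hrange g)) = _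
    congr 1
    rw [MulEquiv.symm_apply_eq]
    exact Subtype.ext h.symm
  refine ⟨ρ, ?_, ?_⟩
  · rw [hρ _ _ hS, Monoid.CoprodI.lift_of]
    exact (cyclicHom_intCast 2 _ (hk false) 1).trans (zpow_one _)
  · rw [hρ _ _ hU, Monoid.CoprodI.lift_of]
    exact (cyclicHom_intCast 3 _ (hk true) 1).trans (zpow_one _)

end CuspScattering

end

noncomputable section
namespace CuspScattering

/-! ### Functions on a finite set with an action of the modular group -/

/-- The trace of the operator `F ↦ F ∘ e` is the number of fixed points of `e`. -/
lemma trace_funLeft {P : Type*} [Finite P] (e : P → P) :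
    LinearMap.trace ℚ (P → ℚ) (LinearMap.funLeft ℚ ℚ e) = ({p | e p = p}.ncard : ℚ) := by
  classical
  have := Fintype.ofFinite P
  rw [LinearMap.trace_eq_matrix_trace ℚ (Pi.basisFun ℚ P), Matrix.trace]
  simp only [Matrix.diag_apply, LinearMap.toMatrix_apply, Pi.basisFun_apply, Pi.basisFun_repr,
    LinearMap.funLeft_apply, Pi.single_apply]
  rw [Finset.sum_boole, Set.ncard_eq_toFinset_card']
  simp

/-- The functions that are odd under `e`, for an involution `e`. -/
def oddFunctions {P : Type*} (e : P → P) : Submodule ℚ (P → ℚ) where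
  carrier := {m | ∀ p, m p + m (e p) = 0}
  add_mem' := by
    intro a b ha hb p
    have := ha p
    have := hb p
    simp only [Pi.add_apply]
    linarith
  zero_mem' := by simp
  smul_mem' := by
    intro c m hm p
    simp only [Pi.smul_apply, smul_eq_mul, ← mul_add, hm p, mul_zero]

/-- The functions whose sum over every orbit vanishes, for a permutation `e` of order `3`. -/
def orbitSumZero {P : Type*} (e : P → P) : Submodule ℚ (P → ℚ) where
  carrier := {m | ∀ p, m p + m (e p) + m (e (e p)) = 0}
  add_mem' := by
    intro a b ha hb p
    have := ha p
    have := hb p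
    simp only [Pi.add_apply]
    linarith
  zero_mem' := by simp
  smul_mem' := by
    intro c m hm p
    simp only [Pi.smul_apply, smul_eq_mul, ← mul_add, hm p, mul_zero]

/-- The functions that are invariant under `e`. -/
def invariantFunctions {P : Type*} (e : P → P) : Submodule ℚ (P → ℚ) where
  carrier := {m | ∀ p, m (e p) = m p}
  add_mem' := by
    intro a b ha hb p
    simp only [Pi.add_apply, ha p, hb p]
  zero_mem' := by simp
  smul_mem' := by
    intro c m hm p
    simp only [Pi.smul_apply, hm p]

lemma finrank_oddFunctions {P : Type*} [Finite P] (e : P → P) (he : ∀ p, e (e p) = p) :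
    (Module.finrank ℚ (oddFunctions e) : ℚ) = (Nat.card P - {p | e p = p}.ncard) / 2 := by
  have := Fintype.ofFinite P
  have hp : LinearMap.IsProj (oddFunctions e)
      ((1 / 2 : ℚ) • (LinearMap.id - LinearMap.funLeft ℚ ℚ e)) := by
    constructor
    · intro m p
      simp [LinearMap.funLeft_apply, he]
      ring
    · intro m hm
      ext p
      have := hm p
      simp [LinearMap.funLeft_apply]
      linarith
  rw [← hp.trace, map_smul, map_sub, trace_funLeft, LinearMap.trace_id]
  simp
  ring

lemma finrank_orbitSumZero {P : Type*} [Finite P] (e : P → P) (he : ∀ p, e (e (e p)) = p) :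
    (Module.finrank ℚ (orbitSumZero e) : ℚ) = 2 * (Nat.card P - {p | e p = p}.ncard) / 3 := by
  have := Fintype.ofFinite P
  have hp : LinearMap.IsProj (orbitSumZero e)
      (LinearMap.id - (1 / 3 : ℚ) • (LinearMap.id + LinearMap.funLeft ℚ ℚ e +
        LinearMap.funLeft ℚ ℚ (fun p ↦ e (e p)))) := by
    constructor
    · intro m p
      simp [LinearMap.funLeft_apply, he]
      ring
    · intro m hm
      ext p
      have := hm p
      simp [LinearMap.funLeft_apply]
      linarith
  have hfix : {p | e (e p) = p} = {p | e p = p} := by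
    ext p
    simp only [Set.mem_ofPred_eq]
    constructor
    · intro h
      have h' := he p
      rwa [h] at h'
    · intro h
      rw [h, h]
  rw [← hp.trace, map_sub, map_smul, map_add, map_add, trace_funLeft, trace_funLeft, hfix,
    LinearMap.trace_id]
  simp
  ring

/-- The number of orbits of a permutation is small if few points have a short orbit. -/
lemma finrank_invariantFunctions_le {P : Type*} [Finite P] (e : Equiv.Perm P) (m : ℕ)
    (hm : 0 < m) :
    (Module.finrank ℚ (invariantFunctions e) : ℚ) ≤
      Nat.card P / m + ∑ k ∈ Finset.Ico 1 m, ({p | (e ^ k) p = p}.ncard : ℚ) := by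
  classical
  have := Fintype.ofFinite P
  let Ω := Quotient (Equiv.Perm.SameCycle.setoid e)
  let π : P → Ω := Quotient.mk _
  have hle : Module.finrank ℚ (invariantFunctions e) ≤ Module.finrank ℚ (Ω → ℚ) := by
    let f : invariantFunctions e →ₗ[ℚ] (Ω → ℚ) :=
      (LinearMap.funLeft ℚ ℚ (Quotient.out : Ω → P)).comp (invariantFunctions e).subtype
    refine LinearMap.finrank_le_finrank_of_injective (f := f) ?_
    rw [injective_iff_map_eq_zero]
    rintro ⟨F, hF⟩ h
    ext p
    have hz : ∀ (k : ℤ) q, F ((e ^ k) q) = F q := by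
      intro k
      induction k using Int.induction_on with
      | zero => simp
      | succ n ih =>
        intro q
        rw [zpow_add, Equiv.Perm.mul_apply, ih, zpow_one, hF]
      | pred n ih =>
        intro q
        rw [zpow_sub, Equiv.Perm.mul_apply, ih, zpow_one, ← hF (e⁻¹ q)]
        simp
    obtain ⟨k, hk⟩ : e.SameCycle (Quotient.out (π p)) p := Quotient.exact (Quotient.out_eq (π p))
    change F p = 0
    rw [← hk, hz]
    exact congrFun h (π p)
  rw [Module.finrank_fintype_fun_eq_card] at hle
  -- every orbit has total weight at least `1`: it has at least `m` points, or one fixed by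
  -- a power `e ^ k` with `0 < k < m`
  have hΩ : (Fintype.card Ω : ℚ) ≤
      ∑ p : P, (1 / m + ∑ k ∈ Finset.Ico 1 m, if (e ^ k) p = p then 1 else 0 : ℚ) := by
    rw [← Finset.sum_fiberwise (s := Finset.univ) (g := π), ← Finset.card_univ, Finset.cast_card]
    refine Finset.sum_le_sum fun ω _ ↦ ?_
    obtain ⟨p, rfl⟩ := Quotient.exists_rep ω
    have hnonneg : ∀ q : P, (0 : ℚ) ≤ ∑ k ∈ Finset.Ico 1 m, if (e ^ k) q = q then 1 else 0 :=
      fun q ↦ Finset.sum_nonneg fun k _ ↦ by split_ifs <;> norm_num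
    have hm' : (0 : ℚ) < 1 / m := by positivity
    by_cases hB : ∃ k ∈ Finset.Ico 1 m, (e ^ k) p = p
    · obtain ⟨k, hk, hkp⟩ := hB
      have h1 : (1 : ℚ) ≤ ∑ k ∈ Finset.Ico 1 m, if (e ^ k) p = p then 1 else 0 := by
        refine le_trans (by simp [hkp]) (Finset.single_le_sum (f := fun k ↦
          if (e ^ k) p = p then (1 : ℚ) else 0) (fun k _ ↦ by split_ifs <;> norm_num) hk)
      refine le_trans ?_ (Finset.single_le_sum (f := fun q ↦ (1 / m +
        ∑ k ∈ Finset.Ico 1 m, if (e ^ k) q = q then 1 else 0 : ℚ)) (a := p) (fun q _ ↦ ?_) ?_)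
      · linarith
      · have := hnonneg q
        positivity
      · simp [π]
    · push Not at hB
      have hinj : Set.InjOn (fun k ↦ (e ^ k) p) (Finset.range m) := by
        have key : ∀ i j : ℕ, i < j → j < m → (e ^ i) p ≠ (e ^ j) p := by
          intro i j hij hj h
          refine hB (j - i) (by simp; omega) ?_
          rw [← Nat.add_sub_of_le hij.le, pow_add, Equiv.Perm.mul_apply] at h
          exact ((e ^ i).injective h).symm
        intro i hi j hj h
        simp only [Finset.coe_range, Set.mem_Iio] at hi hj
        rcases lt_trichotomy i j with hij | hij | hij
        · exact absurd h (key i j hij hj)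
        · exact hij
        · exact absurd h.symm (key j i hij hi)
      have hsub : (Finset.range m).image (fun k ↦ (e ^ k) p) ⊆
          Finset.univ.filter (fun q ↦ π q = Quotient.mk _ p) := by
        intro q hq
        simp only [Finset.mem_image] at hq
        obtain ⟨k, -, rfl⟩ := hq
        simp only [Finset.mem_filter, Finset.mem_univ, true_and]
        exact Quotient.sound ⟨-k, by simp⟩
      calc (1 : ℚ) = ∑ q ∈ (Finset.range m).image (fun k ↦ (e ^ k) p), (1 / m : ℚ) := by
            rw [Finset.sum_const, Finset.card_image_of_injOn hinj]
            simp
            field_simp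
        _ ≤ ∑ q ∈ Finset.univ.filter (fun q ↦ π q = Quotient.mk _ p), (1 / m : ℚ) :=
            Finset.sum_le_sum_of_subset_of_nonneg hsub fun _ _ _ ↦ hm'.le
        _ ≤ _ := Finset.sum_le_sum fun q _ ↦ by have := hnonneg q; linarith
  refine le_trans (by exact_mod_cast hle) (hΩ.trans (le_of_eq ?_))
  rw [Finset.sum_add_distrib, Finset.sum_comm]
  congr 1
  · simp [div_eq_mul_inv]
  · refine Finset.sum_congr rfl fun k _ ↦ ?_
    rw [Finset.sum_boole, Set.ncard_eq_toFinset_card']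
    simp

/-- A set that is disjoint from its first `K` translates has density at most `1 / (K + 1)`. -/
lemma ncard_mul_le_of_disjoint_translates {P : Type*} [Finite P] (e : Equiv.Perm P) (A : Set P)
    (K : ℕ) (h : ∀ j, 1 ≤ j → j ≤ K → ∀ p ∈ A, (e ^ j) p ∉ A) :
    A.ncard * (K + 1) ≤ Nat.card P := by
  have hinj : Function.Injective (fun x : A × Fin (K + 1) ↦ (e ^ (x.2 : ℕ)) x.1) := by
    have key : ∀ (i j : Fin (K + 1)) (p q : A), i < j → (e ^ (i : ℕ)) p ≠ (e ^ (j : ℕ)) q := by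
      intro i j p q hij hpq
      rw [← Nat.add_sub_of_le (Fin.lt_def.1 hij).le, pow_add, Equiv.Perm.mul_apply] at hpq
      refine h (j - i) (Nat.sub_pos_of_lt hij) (by omega) q q.2 ?_
      rw [← (e ^ (i : ℕ)).injective hpq]
      exact p.2
    rintro ⟨p, i⟩ ⟨q, j⟩ hpq
    rcases lt_trichotomy i j with hij | rfl | hij
    · exact absurd hpq (key i j p q hij)
    · exact Prod.ext (Subtype.ext ((e ^ (i : ℕ)).injective hpq)) rfl
    · exact absurd hpq.symm (key j i q p hij)
  have := Nat.card_le_card_of_injective _ hinj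
  rwa [Nat.card_prod, Nat.card_coe_set_eq, Nat.card_fin] at this

end CuspScattering

end

noncomputable section
namespace CuspScattering

/-! ### Homomorphisms from a subgroup of the modular group to the rational numbers -/

lemma S_mem_ST_mem_induction {H : Subgroup SL(2, ℤ)} (hS : ModularGroup.S ∈ H)
    (hU : ModularGroup.S * ModularGroup.T ∈ H) (g : SL(2, ℤ)) : g ∈ H := by
  have h : Subgroup.closure {ModularGroup.S, ModularGroup.T} ≤ H := by
    rw [Subgroup.closure_le]
    rintro g (rfl | rfl)
    · exact hS
    · exact (Subgroup.mul_mem_cancel_left _ hS).1 hU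
  rw [SpecialLinearGroup.SL2Z_generators] at h
  exact h (Subgroup.mem_top g)

lemma smul_quotient_mk {G : Type*} [Group G] {H : Subgroup G} (g h : G) :
    g • (QuotientGroup.mk h : G ⧸ H) = QuotientGroup.mk (g * h) :=
  rfl

lemma neg_one_smul_quotient {H : Subgroup SL(2, ℤ)} (hneg : -1 ∈ H) (p : SL(2, ℤ) ⧸ H) :
    (-1 : SL(2, ℤ)) • p = p := by
  induction p using QuotientGroup.induction_on with
  | H g =>
    rw [smul_quotient_mk, QuotientGroup.eq]
    simpa using hneg

lemma S_smul_S_smul {H : Subgroup SL(2, ℤ)} (hneg : -1 ∈ H) (p : SL(2, ℤ) ⧸ H) :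
    ModularGroup.S • ModularGroup.S • p = p := by
  rw [← mul_smul, S_mul_S, neg_one_smul_quotient hneg]

lemma ST_smul_ST_smul_ST_smul {H : Subgroup SL(2, ℤ)} (hneg : -1 ∈ H) (p : SL(2, ℤ) ⧸ H) :
    (ModularGroup.S * ModularGroup.T) • (ModularGroup.S * ModularGroup.T) •
      (ModularGroup.S * ModularGroup.T) • p = p := by
  rw [← mul_smul, ← mul_smul, ← pow_three', ST_pow_three,
    neg_one_smul_quotient hneg]

/-- The element `r(g p)⁻¹ g r(p)` of `H`, where `r` picks a representative of each coset. -/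
def transferElement {G : Type*} [Group G] (H : Subgroup G) (g : G) (p : G ⧸ H) : H :=
  ⟨(Quotient.out (g • p))⁻¹ * (g * Quotient.out p), by
    rw [← QuotientGroup.eq, QuotientGroup.out_eq', ← smul_quotient_mk, QuotientGroup.out_eq']⟩

lemma transferElement_mul {G : Type*} [Group G] (H : Subgroup G) (g h : G) (p : G ⧸ H) :
    transferElement H (g * h) p = transferElement H g (h • p) * transferElement H h p := by
  apply Subtype.ext
  simp only [transferElement, Subgroup.coe_mul, mul_smul]
  group

/-- The cocycle attached to a homomorphism on `H` and to a coboundary (Shapiro's lemma). -/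
def inducedCocycle {G : Type*} [Group G] (H : Subgroup G) (g : G) :
    ((Additive H →+ ℚ) × (G ⧸ H → ℚ)) →ₗ[ℚ] (G ⧸ H → ℚ) where
  toFun x p := x.1 (Additive.ofMul (transferElement H g p)) + x.2 (g • p) - x.2 p
  map_add' x y := by
    ext p
    simp
    ring
  map_smul' c x := by
    ext p
    simp
    ring

lemma inducedCocycle_mul {G : Type*} [Group G] (H : Subgroup G) (g h : G)
    (x : (Additive H →+ ℚ) × (G ⧸ H → ℚ)) (p : G ⧸ H) :
    inducedCocycle H (g * h) x p = inducedCocycle H g x (h • p) + inducedCocycle H h x p := by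
  simp only [inducedCocycle, LinearMap.coe_mk, AddHom.coe_mk, transferElement_mul, ofMul_mul,
    map_add, mul_smul]
  ring

lemma inducedCocycle_one {G : Type*} [Group G] (H : Subgroup G)
    (x : (Additive H →+ ℚ) × (G ⧸ H → ℚ)) (p : G ⧸ H) : inducedCocycle H 1 x p = 0 := by
  have := inducedCocycle_mul H 1 1 x p
  rw [mul_one, one_smul] at this
  linarith

lemma inducedCocycle_neg_one {H : Subgroup SL(2, ℤ)} (hneg : -1 ∈ H)
    (x : (Additive H →+ ℚ) × (SL(2, ℤ) ⧸ H → ℚ)) (p : SL(2, ℤ) ⧸ H) :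
    inducedCocycle H (-1) x p = 0 := by
  have := inducedCocycle_mul H (-1) (-1) x p
  rw [neg_mul_neg, mul_one, inducedCocycle_one, neg_one_smul_quotient hneg] at this
  linarith

/-- A cocycle is determined by its values at the elliptic generators of the modular group. -/
def inducedCocycleGenerators {H : Subgroup SL(2, ℤ)} (hneg : -1 ∈ H) :
    ((Additive H →+ ℚ) × (SL(2, ℤ) ⧸ H → ℚ)) →ₗ[ℚ]
      oddFunctions (fun p : SL(2, ℤ) ⧸ H ↦ ModularGroup.S • p) ×
        orbitSumZero (fun p : SL(2, ℤ) ⧸ H ↦ (ModularGroup.S * ModularGroup.T) • p) :=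
  LinearMap.prod
    (LinearMap.codRestrict _ (inducedCocycle H ModularGroup.S) (fun x p ↦ by
      have := inducedCocycle_mul H ModularGroup.S ModularGroup.S x p
      rw [S_mul_S, inducedCocycle_neg_one hneg] at this
      linarith))
    (LinearMap.codRestrict _ (inducedCocycle H (ModularGroup.S * ModularGroup.T)) (fun x p ↦ by
      have h := inducedCocycle_mul H ((ModularGroup.S * ModularGroup.T) ^ 2)
        (ModularGroup.S * ModularGroup.T) x p
      rw [← pow_succ, ST_pow_three, inducedCocycle_neg_one hneg, pow_two,
        inducedCocycle_mul] at h
      linarith))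

lemma inducedCocycle_eq_zero {H : Subgroup SL(2, ℤ)} (hneg : -1 ∈ H)
    {x : (Additive H →+ ℚ) × (SL(2, ℤ) ⧸ H → ℚ)} (hx : inducedCocycleGenerators hneg x = 0)
    (g : SL(2, ℤ)) (p : SL(2, ℤ) ⧸ H) : inducedCocycle H g x p = 0 := by
  let L : Subgroup SL(2, ℤ) :=
    { carrier := {g | ∀ p, inducedCocycle H g x p = 0}
      mul_mem' := by
        intro a b ha hb p
        rw [inducedCocycle_mul, ha, hb, add_zero]
      one_mem' := inducedCocycle_one H x
      inv_mem' := by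
        intro a ha p
        have := inducedCocycle_mul H a a⁻¹ x p
        rw [mul_inv_cancel, inducedCocycle_one, ha] at this
        linarith }
  refine (S_mem_ST_mem_induction (H := L) ?_ ?_ g) p
  · exact fun p ↦ congrFun (congrArg (fun y ↦ (y.1 : SL(2, ℤ) ⧸ H → ℚ)) hx) p
  · exact fun p ↦ congrFun (congrArg (fun y ↦ (y.2 : SL(2, ℤ) ⧸ H → ℚ)) hx) p

/-- The kernel of `inducedCocycleGenerators` consists of the constant functions on the
cosets. -/
lemma eq_zero_of_inducedCocycleGenerators {H : Subgroup SL(2, ℤ)} (hneg : -1 ∈ H)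
    {x : (Additive H →+ ℚ) × (SL(2, ℤ) ⧸ H → ℚ)} (hx : inducedCocycleGenerators hneg x = 0) :
    x.1 = 0 ∧ ∀ p, x.2 p = x.2 (QuotientGroup.mk 1) := by
  have h := inducedCocycle_eq_zero hneg hx
  have h1 : x.1 = 0 := by
    refine DFunLike.ext _ _ fun γ ↦ ?_
    obtain ⟨γ, rfl⟩ := Additive.ofMul.surjective γ
    let p : SL(2, ℤ) ⧸ H := QuotientGroup.mk 1
    let r : SL(2, ℤ) := Quotient.out p
    have hr : (QuotientGroup.mk r : SL(2, ℤ) ⧸ H) = p := QuotientGroup.out_eq' p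
    have hfix : (r * γ * r⁻¹) • p = p := by
      rw [← hr, smul_quotient_mk, QuotientGroup.eq]
      simp
    have h2 := h (r * γ * r⁻¹) p
    have h3 : transferElement H (r * γ * r⁻¹) p = γ := by
      apply Subtype.ext
      simp only [transferElement, hfix]
      change r⁻¹ * (r * γ * r⁻¹ * r) = γ
      group
    simpa [inducedCocycle, hfix, h3] using h2
  refine ⟨h1, fun p ↦ ?_⟩
  induction p using QuotientGroup.induction_on with
  | H g =>
    have h2 := h g (QuotientGroup.mk 1)
    rw [inducedCocycle, LinearMap.coe_mk, AddHom.coe_mk, h1, smul_quotient_mk,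
      mul_one] at h2
    simp only [AddMonoidHom.zero_apply] at h2
    linarith

/-- A homomorphism on `H` is determined by the values of the induced cocycle at `S` and `S T`. -/
theorem finiteDimensional_hom {H : Subgroup SL(2, ℤ)} [Finite (SL(2, ℤ) ⧸ H)] (hneg : -1 ∈ H) :
    FiniteDimensional ℚ (Additive H →+ ℚ) := by
  let f := (inducedCocycleGenerators hneg).comp
    (LinearMap.inl ℚ (Additive H →+ ℚ) (SL(2, ℤ) ⧸ H → ℚ))
  refine FiniteDimensional.of_injective f ?_
  rw [injective_iff_map_eq_zero]
  intro χ hχ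
  exact (eq_zero_of_inducedCocycleGenerators hneg (x := (χ, 0)) hχ).1

/-- The upper bound for the first Betti number of a subgroup of the modular group: cocycles are
determined by their values at `S` and `S T`, which lie in spaces of dimension at most `1 / 2` and
`2 / 3` of the index, and the coboundaries account for the index minus one. -/
theorem finrank_hom_le {H : Subgroup SL(2, ℤ)} [Finite (SL(2, ℤ) ⧸ H)] (hneg : -1 ∈ H) :
    (Module.finrank ℚ (Additive H →+ ℚ) : ℚ) ≤ Nat.card (SL(2, ℤ) ⧸ H) / 6 + 1 := by
  have := finiteDimensional_hom hneg
  have := Fintype.ofFinite (SL(2, ℤ) ⧸ H)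
  let f := inducedCocycleGenerators hneg
  have h1 := LinearMap.finrank_range_add_finrank_ker f
  have h2 := Submodule.finrank_le (LinearMap.range f)
  have h3 : Module.finrank ℚ (LinearMap.ker f) ≤ 1 := by
    let e : LinearMap.ker f →ₗ[ℚ] ℚ :=
      ((LinearMap.proj (QuotientGroup.mk 1 : SL(2, ℤ) ⧸ H)).comp
        (LinearMap.snd ℚ (Additive H →+ ℚ) (SL(2, ℤ) ⧸ H → ℚ))).comp (LinearMap.ker f).subtype
    rw [← Module.finrank_self ℚ]
    refine LinearMap.finrank_le_finrank_of_injective (f := e) ?_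
    rw [injective_iff_map_eq_zero]
    rintro ⟨x, hx⟩ h
    obtain ⟨hx1, hx2⟩ := eq_zero_of_inducedCocycleGenerators hneg hx
    refine Subtype.ext (Prod.ext hx1 (funext fun p ↦ (hx2 p).trans h))
  rw [Module.finrank_prod, Module.finrank_fintype_fun_eq_card] at h1
  rw [Module.finrank_prod] at h2
  have h4 := finrank_oddFunctions (fun p : SL(2, ℤ) ⧸ H ↦ ModularGroup.S • p) (S_smul_S_smul hneg)
  have h5 := finrank_orbitSumZero
    (fun p : SL(2, ℤ) ⧸ H ↦ (ModularGroup.S * ModularGroup.T) • p) (ST_smul_ST_smul_ST_smul hneg)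
  have h6 : (Module.finrank ℚ (Additive H →+ ℚ) : ℚ) + Nat.card (SL(2, ℤ) ⧸ H) ≤
      Module.finrank ℚ (oddFunctions (fun p : SL(2, ℤ) ⧸ H ↦ ModularGroup.S • p)) +
      Module.finrank ℚ (orbitSumZero
        (fun p : SL(2, ℤ) ⧸ H ↦ (ModularGroup.S * ModularGroup.T) • p)) + 1 := by
    rw [Nat.card_eq_fintype_card]
    exact_mod_cast (by omega)
  rw [h4, h5] at h6
  have h7 : (0 : ℚ) ≤ ({p : SL(2, ℤ) ⧸ H | ModularGroup.S • p = p}.ncard : ℚ) := by positivity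
  have h8 : (0 : ℚ) ≤ ({p : SL(2, ℤ) ⧸ H |
    (ModularGroup.S * ModularGroup.T) • p = p}.ncard : ℚ) := by positivity
  linarith

end CuspScattering

end

noncomputable section
namespace CuspScattering

/-! ### Parabolic cohomology -/

/-- The skew permutation `(p, a) ↦ (e p, a + f p)`. -/
def skewPerm {P A : Type*} [AddCommGroup A] (e : Equiv.Perm P) (f : P → A) :
    Equiv.Perm (P × A) where
  toFun x := (e x.1, x.2 + f x.1)
  invFun x := (e.symm x.1, x.2 - f (e.symm x.1))
  left_inv x := by simp
  right_inv x := by simp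

/-- The functions `m` that satisfy the conditions imposed by `S ^ 2 = -1` and `(S T) ^ 3 = -1` on
the value `m` at `S` of a cocycle that vanishes at `T`. -/
def parabolicCocycles (H : Subgroup SL(2, ℤ)) : Submodule ℚ (SL(2, ℤ) ⧸ H → ℚ) :=
  oddFunctions (fun p : SL(2, ℤ) ⧸ H ↦ ModularGroup.S • p) ⊓
    orbitSumZero (fun p : SL(2, ℤ) ⧸ H ↦ (ModularGroup.S * ModularGroup.T) • p)

/-- Since `PSL(2, ℤ)` is the free product of the groups generated by `S` and `S T`, the functions
in `parabolicCocycles H` extend to cocycles that vanish at `T`; all of them are treated at once, by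
taking the coefficients in the dual space. -/
theorem exists_parabolic_cocycle {H : Subgroup SL(2, ℤ)} (hneg : -1 ∈ H) :
    ∃ c : SL(2, ℤ) → SL(2, ℤ) ⧸ H → Module.Dual ℚ (parabolicCocycles H),
      (∀ g h p, c (g * h) p = c g (h • p) + c h p) ∧ (∀ p, c ModularGroup.T p = 0) ∧
      ∀ p (m : parabolicCocycles H), c ModularGroup.S p m = m.1 p := by
  let P := SL(2, ℤ) ⧸ H
  let A := Module.Dual ℚ (parabolicCocycles H)
  let ev : P → A := fun p ↦ (LinearMap.proj p).comp (parabolicCocycles H).subtype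
  let U : SL(2, ℤ) := ModularGroup.S * ModularGroup.T
  let s : Equiv.Perm (P × A) := skewPerm (MulAction.toPerm ModularGroup.S) ev
  let u : Equiv.Perm (P × A) :=
    skewPerm (MulAction.toPerm U) (fun p ↦ ev (ModularGroup.T • p))
  have hTS : ∀ p : P, ModularGroup.T • p = ModularGroup.S • U • p := by
    intro p
    change _ = ModularGroup.S • (ModularGroup.S * ModularGroup.T) • p
    rw [mul_smul, S_smul_S_smul hneg]
  have hodd : ∀ p, ev p + ev (ModularGroup.S • p) = 0 := by
    intro p
    ext m
    exact m.2.1 p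
  have hthree : ∀ p, ev p + ev (U • p) + ev (U • U • p) = 0 := by
    intro p
    ext m
    exact m.2.2 p
  have hU3 : ∀ p : P, U • U • U • p = p := ST_smul_ST_smul_ST_smul hneg
  have hs : s ^ 2 = 1 := by
    ext1 x
    rw [pow_two, Equiv.Perm.mul_apply]
    refine Prod.ext (S_smul_S_smul hneg x.1) ?_
    change x.2 + ev x.1 + ev (ModularGroup.S • x.1) = x.2
    rw [add_assoc, hodd, add_zero]
  have hu : u ^ 3 = 1 := by
    ext1 x
    rw [pow_three, Equiv.Perm.mul_apply, Equiv.Perm.mul_apply]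
    refine Prod.ext (hU3 x.1) ?_
    change x.2 + ev (ModularGroup.T • x.1) + ev (ModularGroup.T • U • x.1) +
      ev (ModularGroup.T • U • U • x.1) = x.2
    have h := fun p ↦ eq_neg_of_add_eq_zero_right (hodd p)
    rw [hTS, hTS, hTS, hU3, h, h, h]
    have h3 := hthree x.1
    have : x.2 + -ev (U • x.1) + -ev (U • U • x.1) + -ev x.1 =
      x.2 - (ev x.1 + ev (U • x.1) + ev (U • U • x.1)) := by abel
    rw [this, h3, sub_zero]
  obtain ⟨ρ, hρS, hρU⟩ := exists_hom_of_order_two_three s u hs hu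
  have hρ : ∀ g (p : P) (a : A), ρ g (p, a) = (g • p, a + (ρ g (p, 0)).2) := by
    let L : Subgroup SL(2, ℤ) :=
      { carrier := {g | ∀ (p : P) (a : A), ρ g (p, a) = (g • p, a + (ρ g (p, 0)).2)}
        mul_mem' := by
          intro g h hg hh p a
          rw [map_mul, Equiv.Perm.mul_apply, Equiv.Perm.mul_apply, hh p a, hh p 0, hg,
            hg (h • p) (0 + _), mul_smul]
          simp [add_assoc]
        one_mem' := by
          intro p a
          simp
        inv_mem' := by
          intro g hg p a
          have key : ∀ a : A, ρ g⁻¹ (p, a) = (g⁻¹ • p, a - (ρ g (g⁻¹ • p, 0)).2) := by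
            intro a
            rw [map_inv, Equiv.Perm.inv_eq_iff_eq, hg]
            simp
          rw [key, key]
          simp [sub_eq_add_neg] }
    refine S_mem_ST_mem_induction (H := L) ?_ ?_
    · intro p a
      rw [hρS]
      simp [s, skewPerm]
    · intro p a
      rw [hρU]
      simp [u, U, skewPerm]
  refine ⟨fun g p ↦ (ρ g (p, 0)).2, fun g h p ↦ ?_, fun p ↦ ?_, fun p m ↦ ?_⟩
  · change (ρ (g * h) (p, 0)).2 = _
    rw [map_mul, Equiv.Perm.mul_apply, hρ h, hρ g]
    simp [add_comm]
  · have h1 : ρ (ModularGroup.S * ModularGroup.T) (p, 0) =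
        (U • p, 0 + ev (ModularGroup.T • p)) := by
      rw [hρU]
      rfl
    rw [map_mul, Equiv.Perm.mul_apply, hρ ModularGroup.T, hρS] at h1
    have h2 : 0 + (ρ ModularGroup.T (p, 0)).2 + ev (ModularGroup.T • p) =
      0 + ev (ModularGroup.T • p) := congrArg Prod.snd h1
    simpa using h2
  · change (ρ ModularGroup.S (p, 0)).2 m = _
    rw [hρS]
    change (0 + ev p) m = _
    rw [zero_add]
    rfl

/-- A cocycle that vanishes at `T` vanishes at all integral matrices with lower left entry `0`. -/
lemma cocycle_eq_zero_of_apply_one_zero {H : Subgroup SL(2, ℤ)} (hneg : -1 ∈ H) {A : Type*}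
    [AddCommGroup A] [Module ℚ A] {c : SL(2, ℤ) → SL(2, ℤ) ⧸ H → A}
    (hc : ∀ g h p, c (g * h) p = c g (h • p) + c h p) (hT : ∀ p, c ModularGroup.T p = 0)
    {k : SL(2, ℤ)} (hk : k 1 0 = 0) (p : SL(2, ℤ) ⧸ H) : c k p = 0 := by
  have h1 : ∀ p, c 1 p = 0 := fun p ↦ by simpa using hc 1 1 p
  let L : Subgroup SL(2, ℤ) :=
    { carrier := {g | ∀ p, c g p = 0}
      mul_mem' := by
        intro a b ha hb p
        rw [hc, ha, hb, add_zero]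
      one_mem' := h1
      inv_mem' := by
        intro a ha p
        have := hc a a⁻¹ p
        rw [mul_inv_cancel, h1, ha, zero_add] at this
        exact this.symm }
  have hn : (-1 : SL(2, ℤ)) ∈ L := by
    intro p
    have := hc (-1) (-1) p
    rw [neg_mul_neg, mul_one, h1, neg_one_smul_quotient hneg, ← two_smul ℚ] at this
    exact (smul_eq_zero.1 this.symm).resolve_left two_ne_zero
  have hz : ∀ n : ℤ, ModularGroup.T ^ n ∈ L := fun n ↦ L.zpow_mem hT n
  have hdet := k.2
  rw [Matrix.det_fin_two] at hdet
  have hk' : k.1 1 0 = 0 := hk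
  rw [hk', mul_zero, sub_zero] at hdet
  have : k ∈ L := by
    rcases Int.mul_eq_one_iff_eq_one_or_neg_one.1 hdet with ⟨h00, h11⟩ | ⟨h00, h11⟩
    · have : k = ModularGroup.T ^ (k.1 0 1) := by
        ext i j
        rw [ModularGroup.coe_T_zpow]
        fin_cases i <;> fin_cases j <;> simp [h00, h11, hk']
      rw [this]
      exact hz _
    · have : k = -1 * ModularGroup.T ^ (-k.1 0 1) := by
        ext i j
        rw [neg_one_mul, Matrix.SpecialLinearGroup.coe_neg, ModularGroup.coe_T_zpow]
        fin_cases i <;> fin_cases j <;> simp [h00, h11, hk']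
      rw [this]
      exact L.mul_mem hn (hz _)
  exact this p

/-- The homomorphisms on `H` that vanish at the parabolic elements and at the elements of finite
order. -/
def parabolicHoms (H : Subgroup SL(2, ℤ)) : Submodule ℚ (Additive H →+ ℚ) where
  carrier := {χ | (∀ γ : H, ∀ g : SL(2, ℤ), (g⁻¹ * γ * g) 1 0 = 0 → χ (Additive.ofMul γ) = 0) ∧
    ∀ γ : H, IsOfFinOrder γ → χ (Additive.ofMul γ) = 0}
  add_mem' := by
    intro a b ha hb
    refine ⟨fun γ g h ↦ ?_, fun γ h ↦ ?_⟩
    · rw [AddMonoidHom.add_apply, ha.1 γ g h, hb.1 γ g h, add_zero]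
    · rw [AddMonoidHom.add_apply, ha.2 γ h, hb.2 γ h, add_zero]
  zero_mem' := ⟨fun _ _ _ ↦ rfl, fun _ _ ↦ rfl⟩
  smul_mem' := by
    intro r a ha
    refine ⟨fun γ g h ↦ ?_, fun γ h ↦ ?_⟩
    · rw [AddMonoidHom.smul_apply, ha.1 γ g h, smul_zero]
    · rw [AddMonoidHom.smul_apply, ha.2 γ h, smul_zero]

/-- The restriction of cocycles to `H` maps `parabolicCocycles H` to `parabolicHoms H`. Its kernel
consists of coboundaries `F ∘ S - F`, and since the cocycle vanishes at `T`, the function `F` is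
`T`-invariant. -/
theorem finrank_parabolicCocycles_le {H : Subgroup SL(2, ℤ)} [Finite (SL(2, ℤ) ⧸ H)]
    (hneg : -1 ∈ H) :
    Module.finrank ℚ (parabolicCocycles H) ≤ Module.finrank ℚ (parabolicHoms H) +
      Module.finrank ℚ (invariantFunctions (fun p : SL(2, ℤ) ⧸ H ↦ ModularGroup.T • p)) := by
  have := finiteDimensional_hom hneg
  obtain ⟨c, hc, hT, hS⟩ := exists_parabolic_cocycle hneg
  let p₀ : SL(2, ℤ) ⧸ H := QuotientGroup.mk 1
  have hp₀ : ∀ γ ∈ H, γ • p₀ = p₀ := by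
    intro γ hγ
    change QuotientGroup.mk (γ * 1) = QuotientGroup.mk 1
    rw [QuotientGroup.eq]
    simpa using hγ
  have h1 : ∀ p, c 1 p = 0 := fun p ↦ by simpa using hc 1 1 p
  let f : parabolicCocycles H →ₗ[ℚ] (Additive H →+ ℚ) :=
    { toFun := fun m ↦
        { toFun := fun γ ↦ c (γ.toMul : SL(2, ℤ)) p₀ m
          map_zero' := by
            change c 1 p₀ m = 0
            rw [h1]
            rfl
          map_add' := fun a b ↦ by
            change c ((a.toMul : SL(2, ℤ)) * (b.toMul : SL(2, ℤ))) p₀ m = _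
            rw [hc, hp₀ _ b.toMul.2]
            rfl }
      map_add' := fun a b ↦ DFunLike.ext _ _ fun γ ↦ map_add (c _ p₀) a b
      map_smul' := fun r a ↦ DFunLike.ext _ _ fun γ ↦ LinearMap.map_smul (c _ p₀) r a }
  have hf : ∀ m, f m ∈ parabolicHoms H := by
    intro m
    refine ⟨fun γ g hg ↦ ?_, fun γ hγ ↦ ?_⟩
    · change c γ p₀ m = 0
      have h2 : (γ : SL(2, ℤ)) = g * ((g⁻¹ * γ * g) * g⁻¹) := by group
      have h3 : (g⁻¹ * γ * g) • g⁻¹ • p₀ = g⁻¹ • p₀ := by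
        rw [← mul_smul]
        have : g⁻¹ * (γ : SL(2, ℤ)) * g * g⁻¹ = g⁻¹ * γ := by group
        rw [this, mul_smul, hp₀ _ γ.2]
      have h4 : c γ p₀ = 0 := by
        rw [h2, hc, hc, mul_smul, h3, cocycle_eq_zero_of_apply_one_zero hneg hc hT hg, zero_add,
          ← hc, mul_inv_cancel, h1]
      rw [h4]
      rfl
    · obtain ⟨n, hn, hγn⟩ := isOfFinOrder_iff_pow_eq_one.1 hγ
      have h2 : n • f m (Additive.ofMul γ) = 0 := by
        rw [← map_nsmul, ← ofMul_pow, hγn, ofMul_one, map_zero]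
      exact (smul_eq_zero.1 h2).resolve_left hn.ne'
  have hker : Module.finrank ℚ (LinearMap.ker f) ≤
      Module.finrank ℚ (invariantFunctions (fun p : SL(2, ℤ) ⧸ H ↦ ModularGroup.T • p)) := by
    let d : (SL(2, ℤ) ⧸ H → ℚ) →ₗ[ℚ] (SL(2, ℤ) ⧸ H → ℚ) :=
      LinearMap.funLeft ℚ ℚ (fun p ↦ ModularGroup.S • p) - LinearMap.id
    have hsub : (LinearMap.ker f).map (parabolicCocycles H).subtype ≤
        (invariantFunctions (fun p : SL(2, ℤ) ⧸ H ↦ ModularGroup.T • p)).map d := by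
      rintro _ ⟨m, hm, rfl⟩
      have hm' : ∀ γ ∈ H, c γ p₀ m = 0 := fun γ hγ ↦
        DFunLike.congr_fun hm (Additive.ofMul (⟨γ, hγ⟩ : H))
      let F : SL(2, ℤ) ⧸ H → ℚ := fun p ↦ c (Quotient.out p) p₀ m
      have hF : ∀ g : SL(2, ℤ), F (QuotientGroup.mk g) = c g p₀ m := by
        intro g
        have h2 : g⁻¹ * Quotient.out (QuotientGroup.mk g : SL(2, ℤ) ⧸ H) ∈ H := by
          rw [← QuotientGroup.eq, QuotientGroup.out_eq']
        have h3 := hc g (g⁻¹ * Quotient.out (QuotientGroup.mk g : SL(2, ℤ) ⧸ H)) p₀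
        rw [mul_inv_cancel_left, hp₀ _ h2] at h3
        change c _ p₀ m = _
        rw [h3, LinearMap.add_apply, hm' _ h2, add_zero]
      have hsm : ∀ g : SL(2, ℤ), g • p₀ = QuotientGroup.mk g := fun g ↦ by
        change QuotientGroup.mk (g * 1) = _
        rw [mul_one]
      refine ⟨F, fun p ↦ ?_, ?_⟩
      · induction p using QuotientGroup.induction_on with
        | H g =>
          change F (ModularGroup.T • QuotientGroup.mk g) = _
          rw [smul_quotient_mk, hF, hF, hc, hT, zero_add]
      · ext p
        induction p using QuotientGroup.induction_on with
        | H g =>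
          change F (ModularGroup.S • QuotientGroup.mk g) - F (QuotientGroup.mk g) = m.1 _
          rw [smul_quotient_mk, hF, hF, hc, hsm, LinearMap.add_apply, hS, add_sub_cancel_right]
    calc Module.finrank ℚ (LinearMap.ker f)
        = Module.finrank ℚ ((LinearMap.ker f).map (parabolicCocycles H).subtype) :=
          (LinearEquiv.finrank_eq (Submodule.equivMapOfInjective _
            (Submodule.subtype_injective _) _))
      _ ≤ _ := (Submodule.finrank_mono hsub).trans (Submodule.finrank_map_le _ _)
  have hrange : Module.finrank ℚ (LinearMap.range f) ≤ Module.finrank ℚ (parabolicHoms H) := by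
    refine Submodule.finrank_mono ?_
    rintro _ ⟨m, rfl⟩
    exact hf m
  have := LinearMap.finrank_range_add_finrank_ker f
  omega

/-- The lower bound for the parabolic cohomology of a subgroup of the modular group: the spaces cut
out by `S` and by `S T` have dimensions about `1 / 2` and `2 / 3` of the index, so their
intersection has dimension at least about `1 / 6` of it. -/
theorem le_finrank_parabolicHoms {H : Subgroup SL(2, ℤ)} [Finite (SL(2, ℤ) ⧸ H)]
    (hneg : -1 ∈ H) {m : ℕ} (hm : 0 < m) :
    (Nat.card (SL(2, ℤ) ⧸ H) : ℚ) / 6 -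
      ({p : SL(2, ℤ) ⧸ H | ModularGroup.S • p = p}.ncard : ℚ) -
      ({p : SL(2, ℤ) ⧸ H | (ModularGroup.S * ModularGroup.T) • p = p}.ncard : ℚ) -
      (Nat.card (SL(2, ℤ) ⧸ H) / m +
        ∑ k ∈ Finset.Ico 1 m, ({p : SL(2, ℤ) ⧸ H | ModularGroup.T ^ k • p = p}.ncard : ℚ)) ≤
      Module.finrank ℚ (parabolicHoms H) := by
  have := Fintype.ofFinite (SL(2, ℤ) ⧸ H)
  have h1 := finrank_parabolicCocycles_le hneg
  have h2 := finrank_invariantFunctions_le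
    (MulAction.toPerm ModularGroup.T : Equiv.Perm (SL(2, ℤ) ⧸ H)) m hm
  have h3 := Submodule.finrank_sup_add_finrank_inf_eq
    (oddFunctions (fun p : SL(2, ℤ) ⧸ H ↦ ModularGroup.S • p))
    (orbitSumZero (fun p : SL(2, ℤ) ⧸ H ↦ (ModularGroup.S * ModularGroup.T) • p))
  have h4 := finrank_oddFunctions (fun p : SL(2, ℤ) ⧸ H ↦ ModularGroup.S • p) (S_smul_S_smul hneg)
  have h5 := finrank_orbitSumZero
    (fun p : SL(2, ℤ) ⧸ H ↦ (ModularGroup.S * ModularGroup.T) • p) (ST_smul_ST_smul_ST_smul hneg)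
  have h6 := Submodule.finrank_le (oddFunctions (fun p : SL(2, ℤ) ⧸ H ↦ ModularGroup.S • p) ⊔
    orbitSumZero (fun p : SL(2, ℤ) ⧸ H ↦ (ModularGroup.S * ModularGroup.T) • p))
  rw [Module.finrank_fintype_fun_eq_card, ← Nat.card_eq_fintype_card] at h6
  have hpow : ∀ k : ℕ, {p : SL(2, ℤ) ⧸ H | ((MulAction.toPerm ModularGroup.T :
      Equiv.Perm (SL(2, ℤ) ⧸ H)) ^ k) p = p} =
      {p : SL(2, ℤ) ⧸ H | ModularGroup.T ^ k • p = p} := by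
    intro k
    have : (MulAction.toPerm ModularGroup.T : Equiv.Perm (SL(2, ℤ) ⧸ H)) ^ k =
      MulAction.toPerm (ModularGroup.T ^ k) := (map_pow (MulAction.toPermHom _ _) _ _).symm
    rw [this]
    rfl
  simp only [hpow] at h2
  have h7 : (0 : ℚ) ≤ ({p : SL(2, ℤ) ⧸ H | ModularGroup.S • p = p}.ncard : ℚ) := by positivity
  have h8 : (0 : ℚ) ≤ ({p : SL(2, ℤ) ⧸ H |
    (ModularGroup.S * ModularGroup.T) • p = p}.ncard : ℚ) := by positivity
  have h3' : (Module.finrank ℚ (oddFunctions (fun p : SL(2, ℤ) ⧸ H ↦ ModularGroup.S • p)) : ℚ) +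
      Module.finrank ℚ (orbitSumZero
        (fun p : SL(2, ℤ) ⧸ H ↦ (ModularGroup.S * ModularGroup.T) • p)) ≤
      Nat.card (SL(2, ℤ) ⧸ H) + Module.finrank ℚ (parabolicHoms H) +
      Module.finrank ℚ (invariantFunctions (fun p : SL(2, ℤ) ⧸ H ↦ ModularGroup.T • p)) := by
    have : parabolicCocycles H = oddFunctions (fun p : SL(2, ℤ) ⧸ H ↦ ModularGroup.S • p) ⊓
      orbitSumZero (fun p : SL(2, ℤ) ⧸ H ↦ (ModularGroup.S * ModularGroup.T) • p) := rfl
    rw [← this] at h3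
    exact_mod_cast (by omega)
  have h2' : (Module.finrank ℚ (invariantFunctions
      (fun p : SL(2, ℤ) ⧸ H ↦ ModularGroup.T • p)) : ℚ) ≤ _ := h2
  rw [h4, h5] at h3'
  linarith

end CuspScattering

end

noncomputable section
namespace CuspScattering
open Matrix CongruenceSubgroup

/-! ### Fixed points on the cosets of `Γ₀(N)` -/

lemma specialLinear_mul_apply (A B : SL(2, ℤ)) (i j : Fin 2) :
    (A * B) i j = A i 0 * B 0 j + A i 1 * B 1 j := by
  change (A.1 * B.1) i j = _
  rw [Matrix.mul_apply, Fin.sum_univ_two]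

/-- The fixed cosets of `k` are the primitive zeros modulo `N` of a binary quadratic form. -/
lemma smul_mk_eq_self_iff {N : ℕ} (k g : SL(2, ℤ)) :
    k • (QuotientGroup.mk g : SL(2, ℤ) ⧸ Gamma0 N) = QuotientGroup.mk g ↔
      (N : ℤ) ∣ k 1 0 * g 0 0 ^ 2 + (k 1 1 - k 0 0) * g 0 0 * g 1 0 - k 0 1 * g 1 0 ^ 2 := by
  rw [eq_comm, smul_quotient_mk, QuotientGroup.eq, Gamma0_mem, ZMod.intCast_zmod_eq_zero_iff_dvd]
  have : (g⁻¹ * (k * g)) 1 0 =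
      k 1 0 * g 0 0 ^ 2 + (k 1 1 - k 0 0) * g 0 0 * g 1 0 - k 0 1 * g 1 0 ^ 2 := by
    have h0 : g⁻¹ 1 0 = -g 1 0 := by rw [SpecialLinearGroup.SL2_inv_expl]; rfl
    have h1 : g⁻¹ 1 1 = g 0 0 := by rw [SpecialLinearGroup.SL2_inv_expl]; rfl
    rw [specialLinear_mul_apply, specialLinear_mul_apply, specialLinear_mul_apply, h0, h1]
    ring
  rw [this]

lemma isCoprime_column (g : SL(2, ℤ)) : IsCoprime (g 0 0) (g 1 0) := by
  refine ⟨g 1 1, -g 0 1, ?_⟩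
  have := g.2
  rw [Matrix.det_fin_two] at this
  linear_combination this

lemma isCoprime_of_dvd_form {N a c t : ℤ} (h : IsCoprime a c) (hN : N ∣ a ^ 2 + t * c) :
    IsCoprime N c := by
  obtain ⟨d, hd⟩ := hN
  have h1 : IsCoprime (a ^ 2 + t * c) c := IsCoprime.add_mul_right_left_iff.2 h.pow_left
  rw [hd] at h1
  exact h1.of_mul_left_left

/-- For the zeros modulo `N` of the form `a ^ 2 + c ^ 2`: if a primitive column and its translate by
`j` are both zeros, then `N` divides a small number. -/
lemma dvd_of_fixed_S {N a c j : ℤ} (h : IsCoprime a c) (h1 : N ∣ a ^ 2 + c ^ 2)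
    (h2 : N ∣ (a + j * c) ^ 2 + c ^ 2) : N ∣ j ^ 2 * (j ^ 2 + 4) := by
  have hc : IsCoprime N c := isCoprime_of_dvd_form (t := c) h (by rwa [← pow_two])
  have h3 : N ∣ c * (j * (2 * a + j * c)) := by
    have := dvd_sub h2 h1
    ring_nf at this ⊢
    exact this
  have h4 := hc.dvd_of_dvd_mul_left h3
  -- eliminate `a` from the difference and the first form; only a multiple of `c ^ 2` remains
  have h5 : N ∣ c ^ 2 * (j ^ 2 * (j ^ 2 + 4)) := by
    have := dvd_add (h4.mul_right (j * (j * c - 2 * a))) (h1.mul_right (4 * j ^ 2))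
    ring_nf at this ⊢
    exact this
  exact hc.pow_right.dvd_of_dvd_mul_left h5

/-- The analogue of `dvd_of_fixed_S` for the form `a ^ 2 + a c + c ^ 2`. -/
lemma dvd_of_fixed_ST {N a c j : ℤ} (h : IsCoprime a c) (h1 : N ∣ a ^ 2 + a * c + c ^ 2)
    (h2 : N ∣ (a + j * c) ^ 2 + (a + j * c) * c + c ^ 2) : N ∣ j ^ 2 * (j ^ 2 + 3) := by
  have hc : IsCoprime N c := isCoprime_of_dvd_form (t := a + c) h (by
    have : a ^ 2 + (a + c) * c = a ^ 2 + a * c + c ^ 2 := by ring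
    rwa [this])
  have h3 : N ∣ c * (j * (2 * a + (j + 1) * c)) := by
    have := dvd_sub h2 h1
    ring_nf at this ⊢
    exact this
  have h4 := hc.dvd_of_dvd_mul_left h3
  have h5 : N ∣ c ^ 2 * (j ^ 2 * (j ^ 2 + 3)) := by
    have := dvd_add (h4.mul_right (j * ((j - 1) * c - 2 * a))) (h1.mul_right (4 * j ^ 2))
    ring_nf at this ⊢
    exact this
  exact hc.pow_right.dvd_of_dvd_mul_left h5

/-- The analogue of `dvd_of_fixed_S` for the form `k c ^ 2`, with lower instead of upper
translates. -/
lemma dvd_of_fixed_T {N a c j k : ℤ} (h : IsCoprime a c) (h1 : N ∣ k * c ^ 2)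
    (h2 : N ∣ k * (c + j * a) ^ 2) : N ∣ k * j ^ 3 := by
  have h3 : N ∣ k * j ^ 3 * a ^ 3 := by
    have := dvd_add ((dvd_sub h2 h1).mul_right (j * a - 2 * c)) (h1.mul_right (4 * (j * a)))
    ring_nf at this ⊢
    exact this
  have h4 : N ∣ k * j ^ 3 * c ^ 2 := by
    have := h1.mul_right (j ^ 3)
    ring_nf at this ⊢
    exact this
  obtain ⟨u, v, huv⟩ := h.pow (m := 3) (n := 2)
  have := dvd_add (h3.mul_left u) (h4.mul_left v)
  have e : u * (k * j ^ 3 * a ^ 3) + v * (k * j ^ 3 * c ^ 2) =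
    k * j ^ 3 * (u * a ^ 3 + v * c ^ 2) := by ring
  rwa [e, huv, mul_one] at this

lemma toPerm_pow {N : ℕ} (g : SL(2, ℤ)) (j : ℕ) :
    (MulAction.toPerm g : Equiv.Perm (SL(2, ℤ) ⧸ Gamma0 N)) ^ j = MulAction.toPerm (g ^ j) :=
  (map_pow (MulAction.toPermHom _ _) _ _).symm

/-- The upper unipotent matrices. -/
def upperUnipotent (j : ℤ) : SL(2, ℤ) := ⟨!![1, j; 0, 1], by simp [det_fin_two]⟩

/-- The lower unipotent matrices. -/
def lowerUnipotent (j : ℤ) : SL(2, ℤ) := ⟨!![1, 0; j, 1], by simp [det_fin_two]⟩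

lemma T_pow_eq (j : ℕ) : ModularGroup.T ^ j = upperUnipotent j := by
  induction j with
  | zero =>
    ext i l
    fin_cases i <;> fin_cases l <;> rfl
  | succ j ih =>
    rw [pow_succ, ih]
    ext i l
    rw [specialLinear_mul_apply]
    fin_cases i <;> fin_cases l <;> simp [upperUnipotent, ModularGroup.T, add_comm]

lemma lowerUnipotent_one_pow (j : ℕ) : lowerUnipotent 1 ^ j = lowerUnipotent j := by
  induction j with
  | zero =>
    ext i l
    fin_cases i <;> fin_cases l <;> rfl
  | succ j ih =>
    rw [pow_succ, ih]
    ext i l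
    rw [specialLinear_mul_apply]
    fin_cases i <;> fin_cases l <;> simp [lowerUnipotent]

/-- The cosets fixed by `S` are disjoint from their translates by `T, …, T ^ K`. -/
lemma ncard_fixed_S_le {N K : ℕ} [NeZero N] (hN : K ^ 2 * (K ^ 2 + 4) < N) :
    {p : SL(2, ℤ) ⧸ Gamma0 N | ModularGroup.S • p = p}.ncard * (K + 1) ≤
      Nat.card (SL(2, ℤ) ⧸ Gamma0 N) := by
  refine ncard_mul_le_of_disjoint_translates (MulAction.toPerm ModularGroup.T) _ K ?_
  intro j hj hjK p hp hp'
  rw [toPerm_pow] at hp'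
  induction p using QuotientGroup.induction_on with
  | H g =>
    have h1 := (smul_mk_eq_self_iff _ _).1 hp
    have h2 := (smul_mk_eq_self_iff _ (ModularGroup.T ^ j * g)).1 hp'
    rw [T_pow_eq, specialLinear_mul_apply, specialLinear_mul_apply] at h2
    simp [ModularGroup.S, upperUnipotent] at h1 h2
    have h3 := dvd_of_fixed_S (isCoprime_column g) h1 h2
    have h4 : N ∣ j ^ 2 * (j ^ 2 + 4) := by exact_mod_cast h3
    have h5 := Nat.le_of_dvd (by positivity) h4
    have h6 : j ^ 2 * (j ^ 2 + 4) ≤ K ^ 2 * (K ^ 2 + 4) := by gcongr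
    omega

lemma ncard_fixed_ST_le {N K : ℕ} [NeZero N] (hN : K ^ 2 * (K ^ 2 + 4) < N) :
    {p : SL(2, ℤ) ⧸ Gamma0 N | (ModularGroup.S * ModularGroup.T) • p = p}.ncard * (K + 1) ≤
      Nat.card (SL(2, ℤ) ⧸ Gamma0 N) := by
  refine ncard_mul_le_of_disjoint_translates (MulAction.toPerm ModularGroup.T) _ K ?_
  intro j hj hjK p hp hp'
  rw [toPerm_pow] at hp'
  induction p using QuotientGroup.induction_on with
  | H g =>
    have h1 := (smul_mk_eq_self_iff _ _).1 hp
    have h2 := (smul_mk_eq_self_iff _ (ModularGroup.T ^ j * g)).1 hp'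
    simp only [T_pow_eq, specialLinear_mul_apply] at h1 h2
    simp [ModularGroup.S, ModularGroup.T, upperUnipotent] at h1 h2
    have h3 := dvd_of_fixed_ST (isCoprime_column g) h1 h2
    have h4 : N ∣ j ^ 2 * (j ^ 2 + 3) := by exact_mod_cast h3
    have h5 := Nat.le_of_dvd (by positivity) h4
    have h6 : j ^ 2 * (j ^ 2 + 3) ≤ K ^ 2 * (K ^ 2 + 4) := by gcongr; omega
    omega

/-- The cosets fixed by `T ^ k` are disjoint from their translates by the first `K` powers of the
lower unipotent generator. -/
lemma ncard_fixed_T_pow_le {N K k : ℕ} [NeZero N] (hk : 0 < k) (hN : k * K ^ 3 < N) :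
    {p : SL(2, ℤ) ⧸ Gamma0 N | ModularGroup.T ^ k • p = p}.ncard * (K + 1) ≤
      Nat.card (SL(2, ℤ) ⧸ Gamma0 N) := by
  refine ncard_mul_le_of_disjoint_translates (MulAction.toPerm (lowerUnipotent 1)) _ K ?_
  intro j hj hjK p hp hp'
  rw [toPerm_pow, lowerUnipotent_one_pow] at hp'
  induction p using QuotientGroup.induction_on with
  | H g =>
    have h1 := (smul_mk_eq_self_iff _ _).1 hp
    have h2 := (smul_mk_eq_self_iff _ (lowerUnipotent j * g)).1 hp'
    rw [T_pow_eq] at h1 h2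
    rw [specialLinear_mul_apply, specialLinear_mul_apply] at h2
    simp [lowerUnipotent, upperUnipotent] at h1 h2
    rw [add_comm] at h2
    have h3 := dvd_of_fixed_T (isCoprime_column g) h1 h2
    have h4 : N ∣ k * j ^ 3 := by exact_mod_cast h3
    have h5 := Nat.le_of_dvd (by positivity) h4
    have h6 : k * j ^ 3 ≤ k * K ^ 3 := by gcongr
    omega

/-! ### The genus -/

/-- The isomorphism of a subgroup of `SL(2, ℤ)` with its image in `GL(2, ℝ)`. -/
def equivRealImage (Γ : Subgroup SL(2, ℤ)) : Γ ≃* realImage Γ :=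
  Γ.equivMapOfInjective _ (SpecialLinearGroup.mapGL_injective)

/-- Composition with `equivRealImage`. -/
def homEquivRealImage (Γ : Subgroup SL(2, ℤ)) :
    (Additive (realImage Γ) →+ ℚ) ≃ₗ[ℚ] (Additive Γ →+ ℚ) where
  toFun χ := χ.comp (MulEquiv.toAdditive (equivRealImage Γ)).toAddMonoidHom
  invFun χ := χ.comp (MulEquiv.toAdditive (equivRealImage Γ).symm).toAddMonoidHom
  map_add' _ _ := rfl
  map_smul' _ _ := rfl
  left_inv χ := DFunLike.ext _ _ fun γ ↦
    congrArg (fun x ↦ χ (Additive.ofMul x)) ((equivRealImage Γ).apply_symm_apply γ.toMul)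
  right_inv χ := DFunLike.ext _ _ fun γ ↦
    congrArg (fun x ↦ χ (Additive.ofMul x)) ((equivRealImage Γ).symm_apply_apply γ.toMul)

/-- The stabilizers of points of `ℍ` are finite, and those of the cusps consist of elements with a
conjugate whose lower left entry vanishes. -/
lemma map_parabolicHoms_le (Γ : Subgroup SL(2, ℤ)) :
    (parabolicHoms Γ).map ((homEquivRealImage Γ).symm : (Additive Γ →+ ℚ) →ₗ[ℚ] _) ≤
      homsVanishingOnStabilizers (realImage Γ) (ExtendedHalfPlane (realImage Γ)) := by
  rintro _ ⟨χ, hχ, rfl⟩ γ y hγ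
  obtain ⟨k, rfl⟩ := (equivRealImage Γ).surjective γ
  have h1 : (homEquivRealImage Γ).symm χ (Additive.ofMul (equivRealImage Γ k)) =
      χ (Additive.ofMul k) :=
    congrArg (fun x ↦ χ (Additive.ofMul x)) ((equivRealImage Γ).symm_apply_apply k)
  refine h1.trans ?_
  rcases y with z | c
  · refine hχ.2 k ?_
    have hfin := ProperlyDiscontinuousSMul.finite_stabilizer' (realImage Γ) z
    have hz : equivRealImage Γ k ∈ MulAction.stabilizer (realImage Γ) z :=
      ofPoint_injective hγ
    have : Finite (MulAction.stabilizer (realImage Γ) z) := hfin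
    have h2 := isOfFinOrder_of_finite (⟨_, hz⟩ : MulAction.stabilizer (realImage Γ) z)
    obtain ⟨n, hn, h3⟩ := isOfFinOrder_iff_pow_eq_one.1 h2
    refine isOfFinOrder_iff_pow_eq_one.2 ⟨n, hn, (equivRealImage Γ).injective ?_⟩
    rw [map_pow, map_one]
    exact congrArg Subtype.val h3
  · obtain ⟨g, hg⟩ := exists_cusp_eq c
    refine hχ.1 k g ((apply_one_zero_conj hg).1 ?_)
    exact congrArg Subtype.val (ofCusp_injective hγ : equivRealImage Γ k • c = c)

/-- If `N` is large compared with `m`, then twice the genus of `Γ₀(N)` differs from a sixth of the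
index by at most the proportion `4 / m` of the index, up to a bounded error: the elements `S`, `S T`
and `T ^ k` with `0 < k < m` fix few cosets. -/
theorem genus_heckeGroup_bounds {N m : ℕ} (hm : 0 < m) (hN : m ^ 4 * (m ^ 4 + 4) < N) :
    (Nat.card (SL(2, ℤ) ⧸ Gamma0 N) : ℚ) / 6 - 4 * (Nat.card (SL(2, ℤ) ⧸ Gamma0 N) / m) ≤
        2 * genus (heckeGroup N) + 1 ∧
      2 * (genus (heckeGroup N) : ℚ) ≤ Nat.card (SL(2, ℤ) ⧸ Gamma0 N) / 6 + 1 := by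
  have : NeZero N := ⟨by omega⟩
  have hneg : -1 ∈ Gamma0 N := by simp [Gamma0_mem]
  have := finiteDimensional_hom hneg
  have := (homEquivRealImage (Gamma0 N)).symm.finiteDimensional
  obtain ⟨h1, h2⟩ := genus_bounds (Γ := Gamma0 N)
  have h3 := Submodule.finrank_mono (map_parabolicHoms_le (Gamma0 N))
  rw [LinearEquiv.finrank_map_eq] at h3
  rw [LinearEquiv.finrank_eq (homEquivRealImage (Gamma0 N))] at h2
  have h4 := le_finrank_parabolicHoms hneg hm
  have h5 := finrank_hom_le hneg
  have hK : (m ^ 2) ^ 2 * ((m ^ 2) ^ 2 + 4) < N := by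
    rwa [← pow_mul]
  have h6 := ncard_fixed_S_le hK
  have h7 := ncard_fixed_ST_le hK
  have h8 : ∀ k ∈ Finset.Ico 1 m,
      {p : SL(2, ℤ) ⧸ Gamma0 N | ModularGroup.T ^ k • p = p}.ncard * (m ^ 2 + 1) ≤
      Nat.card (SL(2, ℤ) ⧸ Gamma0 N) := by
    intro k hk
    rw [Finset.mem_Ico] at hk
    refine ncard_fixed_T_pow_le hk.1 (lt_of_le_of_lt ?_ hN)
    calc k * (m ^ 2) ^ 3 ≤ m * (m ^ 2) ^ 3 := by gcongr; omega
      _ = m ^ 4 * m ^ 3 := by ring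
      _ ≤ m ^ 4 * (m ^ 4 + 4) := by
        gcongr
        exact (Nat.pow_le_pow_right hm (by norm_num)).trans (Nat.le_add_right _ _)
  set ψ : ℚ := (Nat.card (SL(2, ℤ) ⧸ Gamma0 N) : ℚ) with hψ
  have hψ0 : 0 ≤ ψ := by positivity
  have hmq : (0 : ℚ) < m := by exact_mod_cast hm
  have hm1 : (1 : ℚ) ≤ m := by exact_mod_cast hm
  have hsmall : ∀ x : ℕ, x * (m ^ 2 + 1) ≤ Nat.card (SL(2, ℤ) ⧸ Gamma0 N) →
      (x : ℚ) ≤ ψ / m / m := by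
    intro x hx
    have hx' : (x : ℚ) * (m ^ 2 + 1) ≤ ψ := by
      rw [hψ]
      exact_mod_cast hx
    rw [div_div, le_div_iff₀ (by positivity)]
    have : (0 : ℚ) ≤ x := by positivity
    nlinarith
  have hdiv : ψ / m / m ≤ ψ / m := div_le_self (by positivity) hm1
  have h6' := (hsmall _ h6).trans hdiv
  have h7' := (hsmall _ h7).trans hdiv
  have h8' : ∑ k ∈ Finset.Ico 1 m,
      ({p : SL(2, ℤ) ⧸ Gamma0 N | ModularGroup.T ^ k • p = p}.ncard : ℚ) ≤ ψ / m := by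
    calc _ ≤ ∑ k ∈ Finset.Ico 1 m, ψ / m / m := Finset.sum_le_sum fun k hk ↦ hsmall _ (h8 k hk)
      _ ≤ m * (ψ / m / m) := by
        rw [Finset.sum_const, nsmul_eq_mul, Nat.card_Ico]
        gcongr
        exact_mod_cast Nat.sub_le _ _
      _ = ψ / m := by field_simp
  have h9 : (Module.finrank ℚ (parabolicHoms (Gamma0 N)) : ℚ) ≤ 2 * genus (heckeGroup N) + 1 := by
    exact_mod_cast h3.trans h1
  have h10 : 2 * (genus (heckeGroup N) : ℚ) ≤
      Module.finrank ℚ (Additive (Gamma0 N) →+ ℚ) := by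
    exact_mod_cast h2
  exact ⟨by linarith, by linarith⟩

end CuspScattering

end

noncomputable section
namespace CuspScattering
open Matrix MeasureTheory ModularGroup
open scoped Modular Real Pointwise

/-! ### The hyperbolic volume -/

lemma volume_eq_zero_of_image {s : Set ℍ} {t : Set ℂ} (h : ∀ z ∈ s, (z : ℂ) ∈ t)
    (ht : volume t = 0) : volume s = 0 := by
  rw [UpperHalfPlane.volume_eq_lintegral]
  refine setLIntegral_measure_zero _ _ (measure_mono_null ?_ ht)
  rintro _ ⟨z, hz, rfl⟩
  exact h z hz

lemma volume_re_eq (a : ℝ) : volume {z : ℂ | z.re = a} = 0 := by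
  have h : {z : ℂ | z.re = a} = Complex.measurableEquivRealProd ⁻¹' ({a} ×ˢ Set.univ) := by
    ext z
    simp
  rw [h, Complex.volume_preserving_equiv_real_prod.measure_preimage
    ((measurableSet_singleton a).prod MeasurableSet.univ).nullMeasurableSet,
    Measure.volume_eq_prod, Measure.prod_prod]
  simp

/-- The boundary of the standard fundamental domain is a null set. -/
lemma volume_fd_diff_fdo : volume (𝒟 \ 𝒟ᵒ) = 0 := by
  refine volume_eq_zero_of_image
    (t := {z : ℂ | z.re = 1 / 2} ∪ {z : ℂ | z.re = -(1 / 2)} ∪ Metric.sphere 0 1) ?_ ?_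
  · rintro z ⟨⟨h1, h2⟩, h3⟩
    by_cases h4 : 1 < Complex.normSq (z : ℂ)
    · have h5 : |z.re| = 1 / 2 := le_antisymm h2 (not_lt.1 fun h ↦ h3 ⟨h4, h⟩)
      left
      rcases abs_eq (by norm_num : (0 : ℝ) ≤ 1 / 2) |>.1 h5 with h | h
      · exact Or.inl h
      · exact Or.inr h
    · right
      have h5 : Complex.normSq (z : ℂ) = 1 := le_antisymm (not_lt.1 h4) h1
      rw [Complex.normSq_eq_norm_sq] at h5
      simpa [pow_eq_one_iff_of_nonneg] using h5
  · rw [measure_union_null_iff, measure_union_null_iff]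
    exact ⟨⟨volume_re_eq _, volume_re_eq _⟩, Measure.addHaar_sphere _ _ _⟩

lemma lintegral_Ici_one_div_sq {a : ℝ} (ha : 0 < a) :
    ∫⁻ y in Set.Ici a, (((1 / ‖y‖₊) ^ 2 : NNReal) : ENNReal) = ENNReal.ofReal (1 / a) := by
  rw [setLIntegral_congr Ioi_ae_eq_Ici.symm]
  have h1 : ∀ y ∈ Set.Ioi a, (((1 / ‖y‖₊) ^ 2 : NNReal) : ENNReal) =
      ENNReal.ofReal (y ^ (-2 : ℝ)) := by
    intro y hy
    have hy0 : 0 < y := ha.trans hy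
    rw [ENNReal.ofReal, ENNReal.coe_inj]
    ext
    rw [Real.coe_toNNReal _ (by positivity), Real.rpow_neg hy0.le]
    simp
  rw [setLIntegral_congr_fun measurableSet_Ioi h1, ← ofReal_integral_eq_lintegral_ofReal
    (integrableOn_Ioi_rpow_of_lt (by norm_num) ha), integral_Ioi_rpow_of_lt (by norm_num) ha]
  · congr 1
    norm_num
    rw [Real.rpow_neg_one]
  · refine (ae_restrict_iff' measurableSet_Ioi).2 (Filter.Eventually.of_forall fun y hy ↦ ?_)
    have hy0 : 0 < y := ha.trans hy
    positivity

lemma lintegral_one_div_sqrt :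
    ∫⁻ x in Set.Icc (-(1 / 2) : ℝ) (1 / 2), ENNReal.ofReal (1 / √(1 - x ^ 2)) =
      ENNReal.ofReal (π / 3) := by
  have hpos : ∀ x ∈ Set.Icc (-(1 / 2) : ℝ) (1 / 2), 0 < 1 - x ^ 2 := by
    intro x hx
    nlinarith [hx.1, hx.2]
  have hcont : ContinuousOn (fun x : ℝ ↦ 1 / √(1 - x ^ 2)) (Set.Icc (-(1 / 2) : ℝ) (1 / 2)) := by
    refine ContinuousOn.div continuousOn_const (by fun_prop) fun x hx ↦ ?_
    exact (Real.sqrt_pos.2 (hpos x hx)).ne'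
  have huIcc : Set.uIcc (-(1 / 2) : ℝ) (1 / 2) = Set.Icc (-(1 / 2) : ℝ) (1 / 2) :=
    Set.uIcc_of_le (by norm_num)
  rw [← ofReal_integral_eq_lintegral_ofReal (hcont.integrableOn_compact isCompact_Icc)]
  · rw [integral_Icc_eq_integral_Ioc, ← intervalIntegral.integral_of_le (by norm_num),
      intervalIntegral.integral_eq_sub_of_hasDerivAt (f := Real.arcsin)]
    · have h6 : Real.arcsin (1 / 2) = π / 6 := by
        rw [← Real.sin_pi_div_six, Real.arcsin_sin] <;> linarith [Real.pi_pos]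
      rw [Real.arcsin_neg, h6]
      congr 1
      ring
    · intro x hx
      rw [huIcc] at hx
      exact Real.hasDerivAt_arcsin (by linarith [hx.1]) (by linarith [hx.2])
    · exact (huIcc ▸ hcont).intervalIntegrable
  · exact Filter.Eventually.of_forall fun x ↦ by positivity

/-- The Gauss–Bonnet area of the standard fundamental domain. -/
lemma volume_fd : volume 𝒟 = ENNReal.ofReal (π / 3) := by
  rw [UpperHalfPlane.volume_eq_lintegral]
  have himage : UpperHalfPlane.coe '' 𝒟 = Complex.measurableEquivRealProd ⁻¹'
      {p | p.1 ∈ Set.Icc (-(1 / 2) : ℝ) (1 / 2) ∧ p.2 ∈ Set.Ici √(1 - p.1 ^ 2)} := by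
    ext z
    constructor
    · rintro ⟨w, ⟨h1, h2⟩, rfl⟩
      refine ⟨abs_le.1 h2, ?_⟩
      change √(1 - w.re ^ 2) ≤ w.im
      refine Real.sqrt_le_iff.2 ⟨w.im_pos.le, ?_⟩
      have : 1 ≤ w.re * w.re + w.im * w.im := by simpa [Complex.normSq_apply] using h1
      nlinarith
    · rintro ⟨h1, h2⟩
      change z.re ∈ _ at h1
      change √(1 - z.re ^ 2) ≤ z.im at h2
      have h3 : 0 < 1 - z.re ^ 2 := by nlinarith [h1.1, h1.2]
      have h4 : 0 < z.im := (Real.sqrt_pos.2 h3).trans_le h2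
      refine ⟨⟨z, h4⟩, ⟨?_, abs_le.2 h1⟩, rfl⟩
      have := (Real.sqrt_le_iff.1 h2).2
      change 1 ≤ Complex.normSq z
      rw [Complex.normSq_apply]
      nlinarith
  have hmeas : MeasurableSet {p : ℝ × ℝ |
      p.1 ∈ Set.Icc (-(1 / 2) : ℝ) (1 / 2) ∧ p.2 ∈ Set.Ici √(1 - p.1 ^ 2)} := by
    refine MeasurableSet.inter (measurable_fst measurableSet_Icc) ?_
    exact measurableSet_le (by fun_prop) measurable_snd
  rw [himage]
  change ∫⁻ z in _, (fun p : ℝ × ℝ ↦ (((1 / ‖p.2‖₊) ^ 2 : NNReal) : ENNReal))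
    (Complex.measurableEquivRealProd z) = _
  rw [Complex.volume_preserving_equiv_real_prod.setLIntegral_comp_preimage hmeas
    (f := fun p : ℝ × ℝ ↦ (((1 / ‖p.2‖₊) ^ 2 : NNReal) : ENNReal)) (by fun_prop),
    ← lintegral_indicator hmeas, Measure.volume_eq_prod, lintegral_prod _
      (Measurable.indicator (by fun_prop) hmeas).aemeasurable, ← lintegral_one_div_sqrt,
      ← lintegral_indicator measurableSet_Icc]
  refine lintegral_congr fun x ↦ ?_
  by_cases hx : x ∈ Set.Icc (-(1 / 2) : ℝ) (1 / 2)
  · rw [Set.indicator_of_mem hx, ← lintegral_Ici_one_div_sq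
      (Real.sqrt_pos.2 (by nlinarith [hx.1, hx.2])), ← lintegral_indicator measurableSet_Ici]
    refine lintegral_congr fun y ↦ ?_
    by_cases hy : y ∈ Set.Ici √(1 - x ^ 2)
    · rw [Set.indicator_of_mem hy, Set.indicator_of_mem (by exact ⟨hx, hy⟩)]
    · rw [Set.indicator_of_notMem hy, Set.indicator_of_notMem (fun h ↦ hy h.2)]
  · rw [Set.indicator_of_notMem hx]
    refine (lintegral_congr fun y ↦ ?_).trans lintegral_zero
    rw [Set.indicator_of_notMem (fun h ↦ hx h.1)]

lemma measurableSet_fd : MeasurableSet 𝒟 := by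
  refine MeasurableSet.inter ?_ ?_
  · exact measurableSet_le measurable_const
      (Complex.continuous_normSq.comp UpperHalfPlane.continuous_coe).measurable
  · exact measurableSet_le (UpperHalfPlane.continuous_re.abs).measurable measurable_const

lemma measurePreserving_smul_specialLinear (g : SL(2, ℤ)) :
    MeasurePreserving (fun z : ℍ ↦ g • z) :=
  measurePreserving_smul (SpecialLinearGroup.mapGL ℝ g) (volume : Measure ℍ)

/-- The union of the translates of the standard fundamental domain by the inverses of
representatives of the left cosets of `Γ`: a fundamental domain of `Γ`. -/
def cosetDomain (Γ : Subgroup SL(2, ℤ)) : Set ℍ :=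
  ⋃ p : SL(2, ℤ) ⧸ Γ, {z | (Quotient.out p : SL(2, ℤ)) • z ∈ 𝒟}

variable {Γ : Subgroup SL(2, ℤ)}

lemma measurableSet_out_smul_mem (g : SL(2, ℤ)) : MeasurableSet {z : ℍ | g • z ∈ 𝒟} :=
  (measurePreserving_smul_specialLinear g).measurable measurableSet_fd

/-- Two translates of the standard fundamental domain overlap in a null set, unless they agree. -/
lemma volume_smul_mem_fd_inter {g h : SL(2, ℤ)} (hne : h * g⁻¹ ≠ 1) (hne' : h * g⁻¹ ≠ -1) :
    volume ({z : ℍ | g • z ∈ 𝒟} ∩ {z : ℍ | h • z ∈ 𝒟}) = 0 := by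
  have h1 : volume {z : ℍ | g • z ∈ 𝒟 \ 𝒟ᵒ} = 0 :=
    (measurePreserving_smul_specialLinear g).quasiMeasurePreserving.preimage_null
      volume_fd_diff_fdo
  refine measure_mono_null ?_ h1
  rintro z ⟨hz1, hz2⟩
  refine ⟨hz1, fun hz3 ↦ ?_⟩
  have : (h * g⁻¹) • g • z ∈ 𝒟 := by
    rw [mul_smul, inv_smul_smul]
    exact hz2
  rcases eq_one_or_neg_one_of_mem_fdo_mem_fd hz3 this with h | h
  · exact hne h
  · exact hne' h

lemma out_mul_inv_ne {p q : SL(2, ℤ) ⧸ Γ} (hneg : -1 ∈ Γ) (hpq : p ≠ q) {k : SL(2, ℤ)}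
    (hk : k ∈ Γ) (ε : SL(2, ℤ)) (hε : ε = 1 ∨ ε = -1) :
    (Quotient.out q : SL(2, ℤ)) * (Quotient.out p * k)⁻¹ ≠ ε := by
  intro h
  apply hpq
  rw [← QuotientGroup.out_eq' p, ← QuotientGroup.out_eq' q, QuotientGroup.eq]
  have hq : (Quotient.out q : SL(2, ℤ)) = ε * (Quotient.out p * k) := by
    rw [← h]
    group
  have : (Quotient.out p : SL(2, ℤ))⁻¹ * Quotient.out q = ε * k := by
    rw [hq]
    rcases hε with rfl | rfl
    · group
    · simp
  rw [this]
  refine Γ.mul_mem ?_ hk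
  rcases hε with rfl | rfl
  · exact Γ.one_mem
  · exact hneg

lemma volume_cosetDomain [Finite (SL(2, ℤ) ⧸ Γ)] (hneg : -1 ∈ Γ) :
    volume (cosetDomain Γ) = Nat.card (SL(2, ℤ) ⧸ Γ) * ENNReal.ofReal (π / 3) := by
  have := Fintype.ofFinite (SL(2, ℤ) ⧸ Γ)
  rw [cosetDomain, measure_iUnion₀]
  · have h : ∀ p : SL(2, ℤ) ⧸ Γ, volume {z : ℍ | (Quotient.out p : SL(2, ℤ)) • z ∈ 𝒟} =
        ENNReal.ofReal (π / 3) := by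
      intro p
      rw [← volume_fd]
      exact (measurePreserving_smul_specialLinear _).measure_preimage
        measurableSet_fd.nullMeasurableSet
    simp only [h]
    simp
  · intro p q hpq
    have h := out_mul_inv_ne hneg hpq Γ.one_mem
    simp only [mul_one] at h
    exact volume_smul_mem_fd_inter (h 1 (Or.inl rfl)) (h (-1) (Or.inr rfl))
  · exact fun p ↦ (measurableSet_out_smul_mem _).nullMeasurableSet

lemma exists_eq_mk_mapGL (γ : (realImage Γ).map ProjGenLinGroup.mk) :
    ∃ k ∈ Γ, ∀ z : ℍ, γ • z = k • z := by
  obtain ⟨_, ⟨k, hk, rfl⟩, hγ⟩ := γ.2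
  refine ⟨k, hk, fun z ↦ ?_⟩
  change (γ : PGL(2, ℝ)) • z = _
  rw [← hγ, UpperHalfPlane.pglMk_smul]
  rfl

instance : Countable SL(2, ℤ) :=
  have : Countable (Matrix (Fin 2) (Fin 2) ℤ) := inferInstanceAs (Countable (Fin 2 → Fin 2 → ℤ))
  inferInstanceAs (Countable {A : Matrix (Fin 2) (Fin 2) ℤ // A.det = 1})

instance : Countable ((realImage Γ).map ProjGenLinGroup.mk) := by
  have : Function.Surjective (fun k : Γ ↦ (⟨ProjGenLinGroup.mk (SpecialLinearGroup.mapGL ℝ k.1),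
      _, ⟨_, k.2, rfl⟩, rfl⟩ : (realImage Γ).map ProjGenLinGroup.mk)) := by
    rintro ⟨-, -, ⟨k, hk, rfl⟩, rfl⟩
    exact ⟨⟨k, hk⟩, rfl⟩
  exact this.countable

lemma measurePreserving_smul_projective (γ : (realImage Γ).map ProjGenLinGroup.mk) :
    MeasurePreserving (fun z : ℍ ↦ γ • z) := by
  obtain ⟨k, -, hk⟩ := exists_eq_mk_mapGL γ
  rw [funext hk]
  exact measurePreserving_smul_specialLinear k

instance : MeasurableConstSMul ((realImage Γ).map ProjGenLinGroup.mk) ℍ where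
  measurable_const_smul γ := (measurePreserving_smul_projective γ).measurable

instance : SMulInvariantMeasure ((realImage Γ).map ProjGenLinGroup.mk) ℍ volume where
  measure_preimage_smul γ _ hs :=
    (measurePreserving_smul_projective γ).measure_preimage hs.nullMeasurableSet

lemma isFundamentalDomain_cosetDomain [Finite (SL(2, ℤ) ⧸ Γ)] (hneg : -1 ∈ Γ) :
    IsFundamentalDomain ((realImage Γ).map ProjGenLinGroup.mk) (cosetDomain Γ) := by
  refine .mk'' (MeasurableSet.iUnion fun p ↦ measurableSet_out_smul_mem _).nullMeasurableSet
    (Filter.Eventually.of_forall fun z ↦ ?_) ?_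
    fun γ ↦ (measurePreserving_smul_projective γ).quasiMeasurePreserving
  · obtain ⟨g, hg⟩ := exists_smul_mem_fd z
    have hk : (Quotient.out (QuotientGroup.mk g : SL(2, ℤ) ⧸ Γ))⁻¹ * g ∈ Γ := by
      rw [← QuotientGroup.eq, QuotientGroup.out_eq']
    refine ⟨⟨_, _, ⟨_, hk, rfl⟩, rfl⟩, Set.mem_iUnion.2 ⟨QuotientGroup.mk g, ?_⟩⟩
    change (Quotient.out (QuotientGroup.mk g : SL(2, ℤ) ⧸ Γ) : SL(2, ℤ)) •
      ((Quotient.out (QuotientGroup.mk g : SL(2, ℤ) ⧸ Γ))⁻¹ * g) • z ∈ 𝒟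
    rwa [← mul_smul, mul_inv_cancel_left]
  · intro γ hγ
    obtain ⟨k, hk, hkz⟩ := exists_eq_mk_mapGL γ
    have hk1 : k ≠ 1 ∧ k ≠ -1 := by
      constructor
      · rintro rfl
        refine hγ (Subtype.ext (FaithfulSMul.eq_of_smul_eq_smul (α := ℍ) fun z ↦ ?_))
        exact (hkz z).trans (by simp)
      · rintro rfl
        refine hγ (Subtype.ext (FaithfulSMul.eq_of_smul_eq_smul (α := ℍ) fun z ↦ ?_))
        exact (hkz z).trans (by simp)
    have hsmul : γ • cosetDomain Γ ⊆
        ⋃ p : SL(2, ℤ) ⧸ Γ, {z | ((Quotient.out p : SL(2, ℤ)) * k⁻¹) • z ∈ 𝒟} := by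
      rintro _ ⟨z, hz, rfl⟩
      obtain ⟨p, hp⟩ := Set.mem_iUnion.1 hz
      refine Set.mem_iUnion.2 ⟨p, ?_⟩
      change ((Quotient.out p : SL(2, ℤ)) * k⁻¹) • γ • z ∈ 𝒟
      rw [hkz, mul_smul, inv_smul_smul]
      exact hp
    refine measure_mono_null (Set.inter_subset_inter_left _ hsmul) ?_
    simp only [cosetDomain, Set.iUnion_inter, Set.inter_iUnion, measure_iUnion_null_iff]
    intro q p
    refine volume_smul_mem_fd_inter ?_ ?_
    · by_cases hpq : p = q
      · subst hpq
        intro h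
        apply hk1.1
        have h' : k = (Quotient.out p)⁻¹ * (Quotient.out p * (Quotient.out p * k⁻¹)⁻¹) *
          Quotient.out p := by group
        rw [h', h]
        simp
      · exact out_mul_inv_ne hneg hpq (Γ.inv_mem hk) 1 (Or.inl rfl)
    · by_cases hpq : p = q
      · subst hpq
        intro h
        apply hk1.2
        have h' : k = (Quotient.out p)⁻¹ * (Quotient.out p * (Quotient.out p * k⁻¹)⁻¹) *
          Quotient.out p := by group
        rw [h', h]
        simp
      · exact out_mul_inv_ne hneg hpq (Γ.inv_mem hk) (-1) (Or.inr rfl)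

/-- Since `-1 ∈ Γ`, the index in `SL(2, ℤ)` is that of the images in `PSL(2, ℝ)`. -/
theorem hyperbolicVolume_realImage [Finite (SL(2, ℤ) ⧸ Γ)] (hneg : -1 ∈ Γ) :
    hyperbolicVolume (realImage Γ) = π / 3 * Nat.card (SL(2, ℤ) ⧸ Γ) := by
  rw [hyperbolicVolume, (isFundamentalDomain_cosetDomain hneg).covolume_eq_volume,
    volume_cosetDomain hneg, ENNReal.toReal_mul, ENNReal.toReal_natCast,
    ENNReal.toReal_ofReal (by positivity), mul_comm]

end CuspScattering

end

noncomputable section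
namespace CuspScattering
open Matrix CongruenceSubgroup

/-! ### The index of `Γ₀(N)` -/

/-- Every primitive column modulo `N` is the reduction of a primitive integral column. -/
lemma exists_specialLinear_column {N : ℕ} [NeZero N] {a c : ZMod N} (h : IsCoprime a c) :
    ∃ g : SL(2, ℤ), (g 0 0 : ZMod N) = a ∧ (g 1 0 : ZMod N) = c := by
  -- a non-zero representative of `c`, so that a representative of `a` prime to it can be chosen
  let c' : ℕ := c.val + N
  have hNpos : 0 < N := Nat.pos_of_ne_zero (NeZero.ne N)
  have : NeZero c' := ⟨by omega⟩
  have hc' : (c' : ZMod N) = c := by simp [c']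
  let d := Nat.gcd N c'
  have hdN : d ∣ N := Nat.gcd_dvd_left _ _
  have hdc : d ∣ c' := Nat.gcd_dvd_right _ _
  have hunit : IsUnit ((a.val : ℕ) : ZMod d) := by
    obtain ⟨u, v, huv⟩ := h
    have h1 := congrArg (ZMod.castHom hdN (ZMod d)) huv
    rw [map_add, map_mul, map_mul, map_one, ← hc', map_natCast,
      (ZMod.natCast_eq_zero_iff _ _).2 hdc, mul_zero, add_zero] at h1
    have h2 : ZMod.castHom hdN (ZMod d) a = ((a.val : ℕ) : ZMod d) := by
      conv_lhs => rw [← ZMod.natCast_zmod_val a]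
      rw [map_natCast]
    rw [h2] at h1
    exact IsUnit.of_mul_eq_one_right _ h1
  obtain ⟨u, hu⟩ := ZMod.unitsMap_surjective hdc hunit.unit
  let a₁ : ℕ := (u : ZMod c').val
  have ha₁ : Nat.Coprime a₁ c' := ZMod.val_coe_unit_coprime u
  have hmod : a.val ≡ a₁ [MOD Nat.gcd N c'] := by
    have h1 := congrArg Units.val hu
    rw [IsUnit.unit_spec, ZMod.unitsMap_val] at h1
    rw [← ZMod.natCast_eq_natCast_iff]
    change _ = ((a₁ : ℕ) : ZMod d)
    rw [← h1, ← ZMod.natCast_val]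
  let k := Nat.chineseRemainder' hmod
  have hk : Nat.Coprime k.1 c' := by
    have := k.2.2
    rw [Nat.Coprime, this.gcd_eq]
    exact ha₁
  obtain ⟨x, y, hxy⟩ := Nat.isCoprime_iff_coprime.2 hk
  refine ⟨⟨!![(k.1 : ℤ), -y; (c' : ℤ), x], ?_⟩, ?_, ?_⟩
  · rw [det_fin_two_of]
    linear_combination hxy
  · change (((k.1 : ℕ) : ℤ) : ZMod N) = a
    rw [Int.cast_natCast, (ZMod.natCast_eq_natCast_iff _ _ _).2 k.2.1, ZMod.natCast_zmod_val]
  · change (((c' : ℕ) : ℤ) : ZMod N) = c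
    rw [Int.cast_natCast, hc']

/-- The number of primitive pairs of residue classes modulo `N`. -/
def primitivePairs (N : ℕ) : ℕ := Nat.card {x : ZMod N × ZMod N // IsCoprime x.1 x.2}

lemma isCoprime_column_zmod (N : ℕ) (g : SL(2, ℤ)) :
    IsCoprime (g 0 0 : ZMod N) (g 1 0 : ZMod N) :=
  (isCoprime_column g).map (Int.castRingHom (ZMod N))

/-- Up to a unit, a coset of `Γ₀(N)` is a primitive column modulo `N`. -/
theorem card_quotient_mul_totient (N : ℕ) [NeZero N] :
    Nat.card (SL(2, ℤ) ⧸ Gamma0 N) * N.totient = primitivePairs N := by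
  let f : (SL(2, ℤ) ⧸ Gamma0 N) × (ZMod N)ˣ → {x : ZMod N × ZMod N // IsCoprime x.1 x.2} :=
    fun x ↦ ⟨((x.2 : ZMod N) * ((Quotient.out x.1 : SL(2, ℤ)) 0 0 : ℤ),
      (x.2 : ZMod N) * ((Quotient.out x.1 : SL(2, ℤ)) 1 0 : ℤ)),
      (isCoprime_mul_unit_left x.2.isUnit _ _).2 (isCoprime_column_zmod N _)⟩
  have hinv : ∀ g h : SL(2, ℤ), (g⁻¹ * h) 1 0 = g 0 0 * h 1 0 - g 1 0 * h 0 0 := by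
    intro g h
    have h0 : g⁻¹ 1 0 = -g 1 0 := by rw [SpecialLinearGroup.SL2_inv_expl]; rfl
    have h1 : g⁻¹ 1 1 = g 0 0 := by rw [SpecialLinearGroup.SL2_inv_expl]; rfl
    rw [specialLinear_mul_apply, h0, h1]
    ring
  have hf : Function.Bijective f := by
    constructor
    · rintro ⟨p, u⟩ ⟨q, v⟩ h
      have h1 := congrArg (fun x ↦ x.1.1) h
      have h2 := congrArg (fun x ↦ x.1.2) h
      simp only [f] at h1 h2
      have hpq : p = q := by
        rw [← QuotientGroup.out_eq' p, ← QuotientGroup.out_eq' q, QuotientGroup.eq, Gamma0_mem,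
          hinv]
        push_cast
        refine (u.isUnit.mul_right_eq_zero).1 ((v.isUnit.mul_right_eq_zero).1 ?_)
        linear_combination (v : ZMod N) * ((Quotient.out q : SL(2, ℤ)) 1 0 : ℤ) * h1 -
          (v : ZMod N) * ((Quotient.out q : SL(2, ℤ)) 0 0 : ℤ) * h2
      subst hpq
      obtain ⟨x, y, hxy⟩ := isCoprime_column_zmod N (Quotient.out p)
      refine Prod.ext rfl (Units.ext ?_)
      change (u : ZMod N) = v
      linear_combination x * h1 + y * h2 - ((u : ZMod N) - v) * hxy
    · rintro ⟨⟨a, c⟩, hac⟩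
      change IsCoprime a c at hac
      obtain ⟨g, hg0, hg1⟩ := exists_specialLinear_column hac
      let p : SL(2, ℤ) ⧸ Gamma0 N := QuotientGroup.mk g
      let r : SL(2, ℤ) := Quotient.out p
      have hk : r⁻¹ * g ∈ Gamma0 N := by
        rw [← QuotientGroup.eq, QuotientGroup.out_eq']
      let k := r⁻¹ * g
      have hgk : g = r * k := (mul_inv_cancel_left r g).symm
      have hk0 : (k 1 0 : ZMod N) = 0 := Gamma0_mem.1 hk
      have hunit : IsUnit (k 0 0 : ZMod N) := by
        have hdet := k.2
        rw [det_fin_two] at hdet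
        have hdet' := congrArg (Int.cast : ℤ → ZMod N) hdet
        push_cast at hdet'
        change (k 0 0 : ZMod N) * (k 1 1 : ZMod N) - (k 0 1 : ZMod N) * (k 1 0 : ZMod N) = 1
          at hdet'
        rw [hk0, mul_zero, sub_zero] at hdet'
        exact IsUnit.of_mul_eq_one _ hdet'
      refine ⟨(p, hunit.unit), Subtype.ext (Prod.ext ?_ ?_)⟩
      · change (k 0 0 : ZMod N) * (r 0 0 : ZMod N) = a
        have e := specialLinear_mul_apply r k 0 0
        rw [← hgk] at e
        rw [← hg0, e]
        push_cast
        rw [hk0]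
        ring
      · change (k 0 0 : ZMod N) * (r 1 0 : ZMod N) = c
        have e := specialLinear_mul_apply r k 1 0
        rw [← hgk] at e
        rw [← hg1, e]
        push_cast
        rw [hk0]
        ring
  rw [primitivePairs, ← Nat.card_eq_of_bijective f hf, Nat.card_prod,
    Nat.card_eq_fintype_card (α := (ZMod N)ˣ), ZMod.card_units_eq_totient]

lemma primitivePairs_mul {m n : ℕ} (h : m.Coprime n) :
    primitivePairs (m * n) = primitivePairs m * primitivePairs n := by
  let e := ZMod.chineseRemainder h
  rw [primitivePairs, primitivePairs, primitivePairs, ← Nat.card_prod]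
  have he : ∀ x y : ZMod (m * n), IsCoprime x y ↔
      IsCoprime (e x).1 (e y).1 ∧ IsCoprime (e x).2 (e y).2 := by
    intro x y
    constructor
    · intro hxy
      exact ⟨hxy.map ((RingHom.fst _ _).comp e.toRingHom),
        hxy.map ((RingHom.snd _ _).comp e.toRingHom)⟩
    · rintro ⟨⟨a, b, hab⟩, ⟨c, d, hcd⟩⟩
      have : IsCoprime (e x) (e y) := ⟨(a, c), (b, d), Prod.ext hab hcd⟩
      simpa using this.map e.symm.toRingHom
  refine Nat.card_congr
    { toFun := fun x ↦ (⟨((e x.1.1).1, (e x.1.2).1), ((he _ _).1 x.2).1⟩,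
        ⟨((e x.1.1).2, (e x.1.2).2), ((he _ _).1 x.2).2⟩)
      invFun := fun y ↦ ⟨(e.symm (y.1.1.1, y.2.1.1), e.symm (y.1.1.2, y.2.1.2)),
        (he _ _).2 (by simpa using ⟨y.1.2, y.2.2⟩)⟩
      left_inv := fun x ↦ by simp
      right_inv := fun y ↦ by simp }

/-- A pair of residue classes modulo `p ^ k` is not primitive if and only if `p` divides both. -/
lemma primitivePairs_prime_pow {p k : ℕ} (hp : p.Prime) (hk : 0 < k) :
    (primitivePairs (p ^ k) : ℚ) = ((p : ℚ) ^ k) ^ 2 - ((p : ℚ) ^ (k - 1)) ^ 2 := by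
  classical
  have : NeZero (p ^ k) := ⟨(pow_pos hp.pos k).ne'⟩
  have : Fact p.Prime := ⟨hp⟩
  have hdvd : p ∣ p ^ k := dvd_pow_self p hk.ne'
  have hnon : ∀ a : ZMod (p ^ k), ¬ IsUnit a → ZMod.castHom hdvd (ZMod p) a = 0 := by
    intro a ha
    rw [← ZMod.natCast_zmod_val a] at ha ⊢
    rw [ZMod.isUnit_iff_coprime, Nat.coprime_pow_right_iff hk, Nat.coprime_comm,
      hp.coprime_iff_not_dvd, not_not] at ha
    rw [map_natCast, ZMod.natCast_eq_zero_iff]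
    exact ha
  have hcop : ∀ x : ZMod (p ^ k) × ZMod (p ^ k),
      IsCoprime x.1 x.2 ↔ ¬ (¬ IsUnit x.1 ∧ ¬ IsUnit x.2) := by
    rintro ⟨a, c⟩
    constructor
    · rintro ⟨u, v, huv⟩ ⟨ha, hc⟩
      change u * a + v * c = 1 at huv
      change ¬ IsUnit a at ha
      change ¬ IsUnit c at hc
      have h1 := congrArg (ZMod.castHom hdvd (ZMod p)) huv
      rw [map_add, map_mul, map_mul, map_one, hnon a ha, hnon c hc] at h1
      simp at h1
    · intro h
      rw [not_and_or, not_not, not_not] at h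
      change IsUnit a ∨ IsUnit c at h
      rcases h with h | h
      · obtain ⟨u, rfl⟩ := h
        exact ⟨↑u⁻¹, 0, by simp⟩
      · obtain ⟨u, rfl⟩ := h
        exact ⟨0, ↑u⁻¹, by simp⟩
  let A : Finset (ZMod (p ^ k)) := Finset.univ.filter fun a ↦ ¬ IsUnit a
  have hA : A.card + (p ^ k).totient = p ^ k := by
    have h1 : (Finset.univ.filter fun a : ZMod (p ^ k) ↦ IsUnit a).card = (p ^ k).totient := by
      have h3 : (Finset.univ.filter fun a : ZMod (p ^ k) ↦ IsUnit a) =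
          Finset.univ.map ⟨Units.val, Units.val_injective⟩ := by
        ext a
        simp only [Finset.mem_filter, Finset.mem_univ, true_and, Finset.mem_map,
          Function.Embedding.coeFn_mk]
        rfl
      rw [h3, Finset.card_map, Finset.card_univ, ZMod.card_units_eq_totient]
    have h2 := Finset.card_filter_add_card_filter_not (s := (Finset.univ : Finset (ZMod (p ^ k))))
      (fun a ↦ IsUnit a)
    rw [h1, Finset.card_univ, ZMod.card] at h2
    rw [add_comm]
    exact h2
  have hA' : A.card = p ^ (k - 1) := by
    obtain ⟨k, rfl⟩ := Nat.exists_eq_succ_of_ne_zero hk.ne'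
    rw [Nat.totient_prime_pow_succ hp] at hA
    obtain ⟨q, hq⟩ : ∃ q, p = q + 1 := ⟨p - 1, by have := hp.pos; omega⟩
    simp only [hq, Nat.succ_eq_add_one, pow_succ, Nat.add_sub_cancel] at hA ⊢
    nlinarith
  have h1 : primitivePairs (p ^ k) + A.card * A.card = p ^ k * p ^ k := by
    rw [primitivePairs, Nat.card_eq_fintype_card, Fintype.card_subtype, ← Finset.card_product]
    have h2 : A ×ˢ A = Finset.univ.filter fun x : ZMod (p ^ k) × ZMod (p ^ k) ↦
        ¬ IsCoprime x.1 x.2 := by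
      ext x
      simp [A, hcop]
    rw [h2, Finset.card_filter_add_card_filter_not, Finset.card_univ, Fintype.card_prod, ZMod.card]
  rw [hA'] at h1
  have h3 : (primitivePairs (p ^ k) : ℚ) + p ^ (k - 1) * p ^ (k - 1) = p ^ k * p ^ k := by
    exact_mod_cast h1
  linear_combination h3

lemma primitivePairs_eq {N : ℕ} (hN : 0 < N) :
    (primitivePairs N : ℚ) = N.totient * (N * ∏ p ∈ N.primeFactors, (1 + 1 / (p : ℚ))) := by
  induction N using Nat.recOnPosPrimePosCoprime with
  | prime_pow p k hp hk =>
    rw [primitivePairs_prime_pow hp hk, Nat.primeFactors_prime_pow hk.ne' hp,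
      Finset.prod_singleton, Nat.totient_prime_pow hp hk]
    obtain ⟨k, rfl⟩ := Nat.exists_eq_succ_of_ne_zero hk.ne'
    have : (p : ℚ) ≠ 0 := by exact_mod_cast hp.ne_zero
    rw [Nat.succ_eq_add_one, Nat.add_sub_cancel]
    push_cast [hp.one_le]
    field_simp
    ring
  | zero => omega
  | one =>
    have : IsCoprime (0 : ZMod 1) 0 := ⟨0, 0, Subsingleton.elim _ _⟩
    have h1 : primitivePairs 1 = 1 := by
      rw [primitivePairs, Nat.card_eq_one_iff_unique]
      exact ⟨⟨fun a b ↦ Subtype.ext (Subsingleton.elim _ _)⟩, ⟨⟨(0, 0), this⟩⟩⟩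
    simp [h1]
  | coprime m n hm hn h ihm ihn =>
    rw [primitivePairs_mul h, Nat.totient_mul h, h.primeFactors_mul,
      Finset.prod_union h.disjoint_primeFactors]
    push_cast
    rw [ihm (by omega), ihn (by omega)]
    ring

theorem card_quotient_Gamma0 (N : ℕ) [NeZero N] :
    (Nat.card (SL(2, ℤ) ⧸ Gamma0 N) : ℚ) = N * ∏ p ∈ N.primeFactors, (1 + 1 / (p : ℚ)) := by
  have hN : 0 < N := Nat.pos_of_ne_zero (NeZero.ne N)
  have h1 := primitivePairs_eq hN
  rw [← card_quotient_mul_totient N] at h1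
  have h2 : (N.totient : ℚ) ≠ 0 := by exact_mod_cast (Nat.totient_pos.2 hN).ne'
  push_cast at h1
  refine mul_left_cancel₀ h2 ?_
  rw [← h1, mul_comm]

end CuspScattering

end

noncomputable section
namespace CuspScattering
open Matrix OnePoint

/-! ### Scaling matrices -/

/-- The translation `z ↦ z + b`, as a homomorphism. -/
def translation : Multiplicative ℝ →* SL(2, ℝ) where
  toFun b := ⟨!![1, b.toAdd; 0, 1], by simp [det_fin_two]⟩
  map_one' := by
    ext i j
    fin_cases i <;> fin_cases j <;> rfl
  map_mul' a b := by
    apply Subtype.ext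
    change !![1, a.toAdd + b.toAdd; 0, 1] = !![1, a.toAdd; 0, 1] * !![1, b.toAdd; 0, 1]
    simp [add_comm]

lemma translation_eq (b : ℝ) :
    (translation (.ofAdd b)).1 = !![1, b; 0, 1] := rfl

lemma unitTranslation_zpow (k : ℤ) : unitTranslation ^ k = translation (.ofAdd (k : ℝ)) := by
  have : unitTranslation = translation (.ofAdd 1) := rfl
  rw [this, ← map_zpow, ← ofAdd_zsmul, zsmul_one]

lemma specialLinearReal_mul_apply (A B : SL(2, ℝ)) (i j : Fin 2) :
    (A * B) i j = A i 0 * B 0 j + A i 1 * B 1 j := by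
  change (A.1 * B.1) i j = _
  rw [Matrix.mul_apply, Fin.sum_univ_two]

lemma translation_mul_apply_zero (b : ℝ) (g : SL(2, ℝ)) (j : Fin 2) :
    (translation (.ofAdd b) * g) 0 j = g 0 j + b * g 1 j := by
  rw [specialLinearReal_mul_apply, translation_eq]
  simp

lemma mul_translation_apply_zero (b : ℝ) (g : SL(2, ℝ)) (i : Fin 2) :
    (g * translation (.ofAdd b)) i 0 = g i 0 := by
  rw [specialLinearReal_mul_apply, translation_eq]
  simp

lemma mul_translation_apply_one (b : ℝ) (g : SL(2, ℝ)) (i : Fin 2) :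
    (g * translation (.ofAdd b)) i 1 = g i 0 * b + g i 1 := by
  rw [specialLinearReal_mul_apply, translation_eq]
  simp

variable {𝒢 : Subgroup (GL (Fin 2) ℝ)} {p : OnePoint ℝ} {σ τ : SL(2, ℝ)}

/-- Conjugation by `σ⁻¹ τ`, which fixes `∞`, sends the unit translation to `± γ_∞ ^ k`. -/
lemma IsScalingMatrix.apply_inv_mul (hσ : IsScalingMatrix 𝒢 p σ) (hτ : IsScalingMatrix 𝒢 p τ) :
    (σ⁻¹ * τ) 1 0 = 0 ∧ ∃ k : ℤ, (σ⁻¹ * τ) 0 0 = k * (σ⁻¹ * τ) 1 1 := by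
  have h1 : ((σ⁻¹ * τ : SL(2, ℝ)) : GL (Fin 2) ℝ) • (∞ : OnePoint ℝ) = ∞ := by
    rw [map_mul, map_inv, mul_smul, hτ.1, inv_smul_eq_iff, hσ.1]
  have h2 : (σ⁻¹ * τ) 1 0 = 0 := by
    rwa [smul_infty_eq_self_iff] at h1
  refine ⟨h2, ?_⟩
  have hdet := (σ⁻¹ * τ).2
  rw [det_fin_two] at hdet
  change (σ⁻¹ * τ) 0 0 * (σ⁻¹ * τ) 1 1 - (σ⁻¹ * τ) 0 1 * (σ⁻¹ * τ) 1 0 = 1 at hdet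
  rw [h2, mul_zero, sub_zero] at hdet
  have ha : (σ⁻¹ * τ) 0 0 ≠ 0 := fun h ↦ by simp [h] at hdet
  let t : SL(2, ℝ) := unitTranslation
  have h3 := (hτ.2 (t : GL (Fin 2) ℝ)).2 ⟨1, Or.inl (by rw [zpow_one])⟩
  have e : (τ : GL (Fin 2) ℝ) * (t : GL (Fin 2) ℝ) * (τ : GL (Fin 2) ℝ)⁻¹ =
      (σ : GL (Fin 2) ℝ) * (((σ⁻¹ * τ) * t * (σ⁻¹ * τ)⁻¹ : SL(2, ℝ)) : GL (Fin 2) ℝ) *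
        (σ : GL (Fin 2) ℝ)⁻¹ := by
    simp only [map_mul, map_inv]
    group
  rw [e] at h3
  obtain ⟨k, hk⟩ := (hσ.2 _).1 h3
  generalize σ⁻¹ * τ = m at *
  have ht : t = translation (.ofAdd 1) := rfl
  have key : ∀ n : SL(2, ℝ), m * t * m⁻¹ = n → m * t = n * m := fun n h ↦ by rw [← h]; group
  refine ⟨k, ?_⟩
  rw [unitTranslation_zpow] at hk
  rcases hk with hk | hk
  · have h5 := congrArg (fun m : SL(2, ℝ) ↦ m 0 1) (key _ (SpecialLinearGroup.toGL_injective hk))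
    simp only [ht, mul_translation_apply_one, translation_mul_apply_zero] at h5
    linarith
  · exfalso
    have hk' : m * t * m⁻¹ = -(translation (.ofAdd (k : ℝ))) := by
      apply SpecialLinearGroup.toGL_injective
      rw [hk]
      ext i j
      simp
    have h5 := congrArg (fun m : SL(2, ℝ) ↦ m 0 0) (key _ hk')
    have h6 : (-(translation (.ofAdd (k : ℝ)) * m)) 0 0 =
      -((translation (.ofAdd (k : ℝ)) * m) 0 0) := rfl
    simp only [ht, neg_mul, mul_translation_apply_zero, h6, translation_mul_apply_zero, h2] at h5
    exact ha (by linarith)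

/-- Two scaling matrices of the same cusp differ by a translation and a sign. -/
theorem IsScalingMatrix.eq_or_eq_neg (hσ : IsScalingMatrix 𝒢 p σ) (hτ : IsScalingMatrix 𝒢 p τ) :
    ∃ b : ℝ, τ = σ * translation (.ofAdd b) ∨ τ = -(σ * translation (.ofAdd b)) := by
  obtain ⟨h0, k, hk⟩ := hσ.apply_inv_mul hτ
  obtain ⟨-, l, hl⟩ := hτ.apply_inv_mul hσ
  have hinv : τ⁻¹ * σ = (σ⁻¹ * τ)⁻¹ := by group
  rw [hinv, SpecialLinearGroup.SL2_inv_expl] at hl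
  change (σ⁻¹ * τ) 1 1 = l * (σ⁻¹ * τ) 0 0 at hl
  have hdet := (σ⁻¹ * τ).2
  rw [det_fin_two] at hdet
  change (σ⁻¹ * τ) 0 0 * (σ⁻¹ * τ) 1 1 - (σ⁻¹ * τ) 0 1 * (σ⁻¹ * τ) 1 0 = 1 at hdet
  rw [h0, mul_zero, sub_zero] at hdet
  generalize hm : σ⁻¹ * τ = m at *
  have hτ' : τ = σ * m := by rw [← hm]; group
  have hne : m 1 1 ≠ 0 := fun h ↦ by simp [h] at hdet
  have hkl : k * l = 1 := by
    have : ((k * l : ℤ) : ℝ) * m 1 1 = 1 * m 1 1 := by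
      push_cast
      linear_combination -hl - (l : ℝ) * hk
    exact_mod_cast mul_right_cancel₀ hne this
  have hkpos : (0 : ℝ) < k := by
    have : (k : ℝ) * (m 1 1) ^ 2 = 1 := by linear_combination hdet - m 1 1 * hk
    by_contra h
    nlinarith [sq_nonneg (m 1 1)]
  have hk1 : k = 1 := Int.eq_one_of_mul_eq_one_right (by exact_mod_cast hkpos.le) hkl
  rw [hk1, Int.cast_one, one_mul] at hk
  rw [hk] at hdet
  rcases mul_self_eq_one_iff.1 hdet with h1 | h1
  · refine ⟨m 0 1, Or.inl ?_⟩
    rw [hτ']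
    congr 1
    apply Subtype.ext
    rw [translation_eq]
    ext i j
    fin_cases i <;> fin_cases j
    exacts [hk.trans h1, rfl, h0, h1]
  · refine ⟨-m 0 1, Or.inr ?_⟩
    rw [hτ', ← mul_neg]
    congr 1
    apply Subtype.ext
    rw [SpecialLinearGroup.coe_neg, translation_eq]
    ext i j
    fin_cases i <;> fin_cases j
    exacts [hk.trans h1, (neg_neg _).symm, h0.trans neg_zero.symm, h1]

/-! ### Kloosterman sums do not depend on the scaling matrices -/

/-- Multiplication by translations, which commute with the integral translations, permutes the
double cosets. -/
lemma kloostermanZero_congr {σ' τ' : SL(2, ℝ)} (hneg : -1 ∈ 𝒢) {b b' : ℝ}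
    (hσ : σ' = σ * translation (.ofAdd b) ∨ σ' = -(σ * translation (.ofAdd b)))
    (hτ : τ' = τ * translation (.ofAdd b') ∨ τ' = -(τ * translation (.ofAdd b'))) (c : ℝ) :
    kloostermanZero 𝒢 σ' τ' c = kloostermanZero 𝒢 σ τ c := by
  let B : Subgroup SL(2, ℝ) := Subgroup.zpowers unitTranslation
  let u : SL(2, ℝ) := translation (.ofAdd b)
  let v : SL(2, ℝ) := translation (.ofAdd b')
  have hcomm : ∀ (a : ℝ), ∀ x ∈ B, translation (.ofAdd a) * x = x * translation (.ofAdd a) := by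
    rintro a - ⟨k, rfl⟩
    change _ * unitTranslation ^ k = unitTranslation ^ k * _
    rw [unitTranslation_zpow, ← map_mul translation, ← map_mul translation, mul_comm]
  let e : SL(2, ℝ) ≃ SL(2, ℝ) :=
    { toFun := fun g ↦ u * g * v⁻¹
      invFun := fun g ↦ u⁻¹ * g * v
      left_inv := fun g ↦ by group
      right_inv := fun g ↦ by group }
  have hmem : ∀ g : SL(2, ℝ), ((σ' * g * τ'⁻¹ : SL(2, ℝ)) : GL (Fin 2) ℝ) ∈ 𝒢 ↔
      ((σ * e g * τ⁻¹ : SL(2, ℝ)) : GL (Fin 2) ℝ) ∈ 𝒢 := by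
    intro g
    have h1 : σ * e g * τ⁻¹ = (σ * u) * g * (τ * v)⁻¹ := by
      change σ * (u * g * v⁻¹) * τ⁻¹ = _
      group
    rw [h1]
    have hsgn : ∀ x : SL(2, ℝ), ((-x : SL(2, ℝ)) : GL (Fin 2) ℝ) ∈ 𝒢 ↔
        (x : GL (Fin 2) ℝ) ∈ 𝒢 := by
      intro x
      have : ((-x : SL(2, ℝ)) : GL (Fin 2) ℝ) = -1 * (x : GL (Fin 2) ℝ) := by
        ext i j
        simp
      rw [this, Subgroup.mul_mem_cancel_left _ hneg]
    have hinvneg : ∀ x : SL(2, ℝ), (-x)⁻¹ = -x⁻¹ := by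
      intro x
      rw [inv_eq_iff_mul_eq_one]
      simp
    rcases hσ with rfl | rfl <;> rcases hτ with rfl | rfl
    · rfl
    · rw [hinvneg, mul_neg, hsgn]
    · rw [neg_mul, neg_mul, hsgn]
    · rw [hinvneg, neg_mul, neg_mul, mul_neg, neg_neg]
  have hentry : ∀ g : SL(2, ℝ), (e g) 1 0 = g 1 0 := by
    intro g
    have hv : v⁻¹ = translation (.ofAdd (-b')) := by
      rw [ofAdd_neg, map_inv]
    change (u * g * v⁻¹) 1 0 = _
    rw [hv, specialLinearReal_mul_apply, specialLinearReal_mul_apply, translation_eq,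
      translation_eq]
    simp
  have hdc : ∀ g : SL(2, ℝ), DoubleCoset.doubleCoset (e g) (B : Set SL(2, ℝ)) B =
      e '' DoubleCoset.doubleCoset g (B : Set SL(2, ℝ)) B := by
    intro g
    ext x
    rw [Set.mem_image, DoubleCoset.mem_doubleCoset]
    constructor
    · rintro ⟨y, hy, z, hz, rfl⟩
      refine ⟨y * g * z, DoubleCoset.mem_doubleCoset.2 ⟨y, hy, z, hz, rfl⟩, ?_⟩
      change u * (y * g * z) * v⁻¹ = y * (u * g * v⁻¹) * z
      have h2 : v⁻¹ * z = z * v⁻¹ := by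
        rw [inv_mul_eq_iff_eq_mul, ← mul_assoc, hcomm b' z hz, mul_inv_cancel_right]
      rw [← mul_assoc, ← mul_assoc, hcomm b y hy, mul_assoc _ z, ← h2]
      simp only [mul_assoc]
      rfl
    · rintro ⟨w, hw, rfl⟩
      obtain ⟨y, hy, z, hz, rfl⟩ := DoubleCoset.mem_doubleCoset.1 hw
      refine ⟨y, hy, z, hz, ?_⟩
      change u * (y * g * z) * v⁻¹ = y * (u * g * v⁻¹) * z
      have h2 : v⁻¹ * z = z * v⁻¹ := by
        rw [inv_mul_eq_iff_eq_mul, ← mul_assoc, hcomm b' z hz, mul_inv_cancel_right]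
      rw [← mul_assoc, ← mul_assoc, hcomm b y hy, mul_assoc _ z, ← h2]
      simp only [mul_assoc]
      rfl
  rw [kloostermanZero, kloostermanZero]
  have hset : {g : SL(2, ℝ) | ((σ * g * τ⁻¹ : SL(2, ℝ)) : GL (Fin 2) ℝ) ∈ 𝒢 ∧ g 1 0 = c} =
      e '' {g : SL(2, ℝ) | ((σ' * g * τ'⁻¹ : SL(2, ℝ)) : GL (Fin 2) ℝ) ∈ 𝒢 ∧ g 1 0 = c} := by
    ext g
    constructor
    · rintro ⟨h1, h2⟩
      refine ⟨e.symm g, ⟨?_, ?_⟩, e.apply_symm_apply g⟩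
      · rw [hmem, e.apply_symm_apply]
        exact h1
      · rw [← hentry, e.apply_symm_apply]
        exact h2
    · rintro ⟨h, ⟨h1, h2⟩, rfl⟩
      exact ⟨(hmem h).1 h1, (hentry h).trans h2⟩
  rw [hset, Set.image_image]
  have := fun g ↦ hdc g
  simp only [B] at this
  simp only [this]
  rw [← Set.image_image (fun D : Set SL(2, ℝ) ↦ e '' D)]
  exact (Set.ncard_image_of_injective _ (Set.image_injective.2 e.injective)).symm

end CuspScattering

end

noncomputable section
namespace CuspScattering
open Matrix OnePoint CongruenceSubgroup

/-! ### The Kloosterman sums of `Γ₀(N)` at the cusps `0` and `∞` -/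

/-- The scaling matrix `z ↦ -1 / (N z)` of the cusp `0` of `Γ₀(N)`. -/
def frickeMatrix (N : ℕ) [NeZero N] : SL(2, ℝ) :=
  ⟨!![0, -1 / √N; √N, 0], by
    have : √(N : ℝ) ≠ 0 := by
      rw [Real.sqrt_ne_zero']
      exact_mod_cast Nat.pos_of_ne_zero (NeZero.ne N)
    rw [det_fin_two_of]
    field_simp
    ring⟩

section
variable {N : ℕ} [NeZero N]

lemma sqrt_level_pos (N : ℕ) [NeZero N] : 0 < √(N : ℝ) :=
  Real.sqrt_pos.2 (by exact_mod_cast Nat.pos_of_ne_zero (NeZero.ne N))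

lemma mapR_apply (k : SL(2, ℤ)) (i j : Fin 2) : (mapR k) i j = (k i j : ℝ) := rfl

lemma frickeMatrix_mul_apply_zero (g : SL(2, ℝ)) (j : Fin 2) :
    (frickeMatrix N * g) 0 j = -g 1 j / √N := by
  rw [specialLinearReal_mul_apply]
  change 0 * g 0 j + -1 / √N * g 1 j = _
  ring

lemma frickeMatrix_mul_apply_one (g : SL(2, ℝ)) (j : Fin 2) :
    (frickeMatrix N * g) 1 j = √N * g 0 j := by
  rw [specialLinearReal_mul_apply]
  change √N * g 0 j + 0 * g 1 j = _
  ring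

lemma frickeMatrix_inv_mul_apply_zero (g : SL(2, ℝ)) (j : Fin 2) :
    ((frickeMatrix N)⁻¹ * g) 0 j = g 1 j / √N := by
  have h := frickeMatrix_mul_apply_one (N := N) ((frickeMatrix N)⁻¹ * g) j
  rw [mul_inv_cancel_left] at h
  rw [h]
  field_simp [(sqrt_level_pos N).ne']

lemma frickeMatrix_inv_mul_apply_one (g : SL(2, ℝ)) (j : Fin 2) :
    ((frickeMatrix N)⁻¹ * g) 1 j = -(√N * g 0 j) := by
  have h := frickeMatrix_mul_apply_zero (N := N) ((frickeMatrix N)⁻¹ * g) j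
  rw [mul_inv_cancel_left] at h
  rw [h]
  field_simp [(sqrt_level_pos N).ne']

lemma mapR_upperUnipotent (j : ℤ) : mapR (upperUnipotent j) = translation (.ofAdd (j : ℝ)) := by
  ext i l
  rw [mapR_apply, translation_eq]
  fin_cases i <;> fin_cases l <;> simp [upperUnipotent]

lemma frickeMatrix_conj (j : ℤ) : frickeMatrix N * translation (.ofAdd (j : ℝ)) =
    mapR (lowerUnipotent (-(N * j))) * frickeMatrix N := by
  have hN : √(N : ℝ) * √N = N := Real.mul_self_sqrt (Nat.cast_nonneg N)
  have h0 := (sqrt_level_pos N).ne'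
  ext i l
  rw [specialLinearReal_mul_apply, specialLinearReal_mul_apply]
  simp only [mapR_apply, translation_eq]
  fin_cases i <;> fin_cases l <;> simp [frickeMatrix, lowerUnipotent]
  field_simp
  linear_combination (j : ℝ) * hN

lemma neg_one_mem_Gamma0 (N : ℕ) : (-1 : SL(2, ℤ)) ∈ Gamma0 N := by
  simp [Gamma0_mem]

lemma neg_one_mem_realImage {Γ : Subgroup SL(2, ℤ)} (h : -1 ∈ Γ) :
    (-1 : GL (Fin 2) ℝ) ∈ realImage Γ := by
  refine ⟨-1, h, ?_⟩
  ext i j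
  simp

lemma upperUnipotent_mem {N : ℕ} (j : ℤ) : upperUnipotent j ∈ Gamma0 N := by
  rw [Gamma0_mem]
  simp [upperUnipotent]

lemma lowerUnipotent_mem {N : ℕ} (j : ℤ) : lowerUnipotent (-(N * j)) ∈ Gamma0 N := by
  rw [Gamma0_mem]
  simp [lowerUnipotent]

lemma coe_neg_toGL (x : SL(2, ℝ)) : ((-x : SL(2, ℝ)) : GL (Fin 2) ℝ) = -(x : GL (Fin 2) ℝ) := by
  ext i j
  simp

lemma neg_mem_iff_of_neg_one_mem {𝒢 : Subgroup (GL (Fin 2) ℝ)} (h : -1 ∈ 𝒢) {x : GL (Fin 2) ℝ} :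
    -x ∈ 𝒢 ↔ x ∈ 𝒢 := by
  rw [← neg_one_mul, Subgroup.mul_mem_cancel_left _ h]

/-- A criterion in terms of elements of `SL(2, ℝ)`, with the sign normalized by `g 0 0 = 1`. -/
lemma isScalingMatrix_of_forall {𝒢 : Subgroup (GL (Fin 2) ℝ)} (hneg : -1 ∈ 𝒢) {p : OnePoint ℝ}
    {τ : SL(2, ℝ)} (hp : (τ : GL (Fin 2) ℝ) • (∞ : OnePoint ℝ) = p)
    (hT : ∀ j : ℤ, ((τ * translation (.ofAdd (j : ℝ)) * τ⁻¹ : SL(2, ℝ)) : GL (Fin 2) ℝ) ∈ 𝒢)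
    (hG : ∀ x ∈ 𝒢, ∃ m : SL(2, ℝ), (m : GL (Fin 2) ℝ) = x)
    (h : ∀ g : SL(2, ℝ), ((τ * g * τ⁻¹ : SL(2, ℝ)) : GL (Fin 2) ℝ) ∈ 𝒢 → g 1 0 = 0 →
      g 0 0 = 1 → ∃ j : ℤ, g 0 1 = j)
    (h1 : ∀ g : SL(2, ℝ), ((τ * g * τ⁻¹ : SL(2, ℝ)) : GL (Fin 2) ℝ) ∈ 𝒢 → g 1 0 = 0 →
      g 0 0 = 1 ∨ g 0 0 = -1) :
    IsScalingMatrix 𝒢 p τ := by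
  refine ⟨hp, fun x ↦ ⟨?_, ?_⟩⟩
  · rintro ⟨hx, hfix⟩
    obtain ⟨m, hm⟩ := hG _ hx
    let g : SL(2, ℝ) := τ⁻¹ * m * τ
    have hg : x = (g : GL (Fin 2) ℝ) := by
      simp only [g, map_mul, map_inv, hm]
      group
    have hgm : τ * g * τ⁻¹ = m := by
      simp only [g]
      group
    rw [← hm, ← hgm] at hx
    have hg0 : g 1 0 = 0 := by
      rw [mul_smul, mul_smul, ← eq_inv_smul_iff, ← hp, inv_smul_smul, hg,
        smul_infty_eq_self_iff] at hfix
      exact hfix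
    have hdet := g.2
    rw [det_fin_two] at hdet
    change g 0 0 * g 1 1 - g 0 1 * g 1 0 = 1 at hdet
    rw [hg0, mul_zero, sub_zero] at hdet
    rcases h1 g hx hg0 with h00 | h00
    · obtain ⟨j, hj⟩ := h g hx hg0 h00
      refine ⟨j, Or.inl ?_⟩
      rw [hg, unitTranslation_zpow]
      congr 1
      rw [h00, one_mul] at hdet
      apply Subtype.ext
      rw [translation_eq]
      ext i l
      fin_cases i <;> fin_cases l
      exacts [h00, hj, hg0, hdet]
    · have hx' : ((τ * -g * τ⁻¹ : SL(2, ℝ)) : GL (Fin 2) ℝ) ∈ 𝒢 := by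
        rw [mul_neg, neg_mul, coe_neg_toGL, neg_mem_iff_of_neg_one_mem hneg]
        exact hx
      obtain ⟨j, hj⟩ := h (-g) hx' (by simpa using hg0) (by
        change -(g 0 0) = 1
        rw [h00, neg_neg])
      refine ⟨j, Or.inr ?_⟩
      rw [hg, unitTranslation_zpow, ← coe_neg_toGL]
      congr 1
      rw [h00] at hdet
      apply Subtype.ext
      rw [SpecialLinearGroup.coe_neg, translation_eq]
      change -(g 0 1) = j at hj
      ext i l
      fin_cases i <;> fin_cases l
      · exact h00
      · change g 0 1 = -(j : ℝ)
        linarith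
      · exact hg0.trans neg_zero.symm
      · change g 1 1 = -1
        linarith
  · rintro ⟨k, hk⟩
    rw [unitTranslation_zpow] at hk
    have hfix : ((translation (.ofAdd (k : ℝ)) : SL(2, ℝ)) : GL (Fin 2) ℝ) • (∞ : OnePoint ℝ) =
        ∞ := by
      rw [smul_infty_eq_self_iff]
      rfl
    have hT' := hT k
    rw [map_mul, map_mul, map_inv] at hT'
    rcases hk with rfl | rfl
    · refine ⟨hT', ?_⟩
      rw [mul_smul, mul_smul, ← hp, inv_smul_smul, hfix]
    · refine ⟨?_, ?_⟩
      · rw [mul_neg, neg_mul, neg_mem_iff_of_neg_one_mem hneg]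
        exact hT'
      · rw [mul_smul, mul_smul, ← hp, inv_smul_smul, ← coe_neg_toGL]
        congr 1
        rw [smul_infty_eq_self_iff]
        exact neg_zero

lemma exists_coe_eq_of_mem_realImage {Γ : Subgroup SL(2, ℤ)} {x : GL (Fin 2) ℝ}
    (hx : x ∈ realImage Γ) : ∃ k ∈ Γ, ((mapR k : SL(2, ℝ)) : GL (Fin 2) ℝ) = x := by
  obtain ⟨k, hk, rfl⟩ := hx
  exact ⟨k, hk, rfl⟩

lemma mapR_mem_realImage_iff {Γ : Subgroup SL(2, ℤ)} {g : SL(2, ℝ)} :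
    (g : GL (Fin 2) ℝ) ∈ realImage Γ ↔ ∃ k ∈ Γ, mapR k = g := by
  constructor
  · intro hg
    obtain ⟨k, hk, h⟩ := exists_coe_eq_of_mem_realImage hg
    exact ⟨k, hk, SpecialLinearGroup.toGL_injective h⟩
  · rintro ⟨k, hk, rfl⟩
    exact ⟨k, hk, rfl⟩

lemma eq_one_or_eq_neg_one_of_mul_eq_one {a b : ℤ} (h : (a : ℝ) * b = 1) :
    (a : ℝ) = 1 ∨ (a : ℝ) = -1 := by
  have h' : a * b = 1 := by exact_mod_cast h
  rcases Int.mul_eq_one_iff_eq_one_or_neg_one.1 h' with ⟨h, -⟩ | ⟨h, -⟩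
  · exact Or.inl (by exact_mod_cast h)
  · exact Or.inr (by exact_mod_cast h)

theorem isScalingMatrix_one {N : ℕ} : IsScalingMatrix (heckeGroup N) ∞ 1 := by
  refine isScalingMatrix_of_forall (neg_one_mem_realImage (neg_one_mem_Gamma0 N)) ?_ ?_ ?_ ?_ ?_
  · rw [map_one, one_smul]
  · intro j
    rw [one_mul, inv_one, mul_one]
    exact mapR_mem_realImage_iff.2 ⟨_, upperUnipotent_mem j, mapR_upperUnipotent j⟩
  · intro x hx
    obtain ⟨k, -, h⟩ := exists_coe_eq_of_mem_realImage hx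
    exact ⟨_, h⟩
  · intro g hg _ _
    rw [one_mul, inv_one, mul_one] at hg
    obtain ⟨k, -, rfl⟩ := mapR_mem_realImage_iff.1 hg
    exact ⟨k 0 1, rfl⟩
  · intro g hg h0
    rw [one_mul, inv_one, mul_one] at hg
    obtain ⟨k, -, rfl⟩ := mapR_mem_realImage_iff.1 hg
    have hdet := (mapR k).2
    rw [det_fin_two] at hdet
    change mapR k 0 0 * mapR k 1 1 - mapR k 0 1 * mapR k 1 0 = 1 at hdet
    rw [h0, mul_zero, sub_zero] at hdet
    exact eq_one_or_eq_neg_one_of_mul_eq_one hdet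

theorem isScalingMatrix_frickeMatrix :
    IsScalingMatrix (heckeGroup N) ((0 : ℝ) : OnePoint ℝ) (frickeMatrix N) := by
  have hs := sqrt_level_pos N
  have hN : √(N : ℝ) * √N = N := Real.mul_self_sqrt (Nat.cast_nonneg N)
  have key : ∀ g : SL(2, ℝ), ((frickeMatrix N * g * (frickeMatrix N)⁻¹ : SL(2, ℝ)) :
      GL (Fin 2) ℝ) ∈ heckeGroup N → ∃ k ∈ Gamma0 N, g 0 0 = k 1 1 ∧ g 0 1 * N = -k 1 0 ∧
        g 1 1 = k 0 0 := by
    intro g hg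
    obtain ⟨k, hk, h⟩ := mapR_mem_realImage_iff.1 hg
    have h' : frickeMatrix N * g = mapR k * frickeMatrix N := by
      rw [h]
      group
    have e := fun i j ↦ congrArg (fun m : SL(2, ℝ) ↦ m i j) h'
    have e00 := e 1 0
    have e01 := e 1 1
    have e11 := e 0 1
    simp only [frickeMatrix_mul_apply_zero, frickeMatrix_mul_apply_one,
      specialLinearReal_mul_apply (mapR k), mapR_apply] at e00 e01 e11
    simp [frickeMatrix] at e00 e01 e11
    refine ⟨k, hk, ?_, ?_, ?_⟩
    · apply mul_left_cancel₀ hs.ne'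
      linarith
    · field_simp at e01
      linear_combination e01 - g 0 1 * hN
    · field_simp at e11
      linarith
  refine isScalingMatrix_of_forall (neg_one_mem_realImage (neg_one_mem_Gamma0 N)) ?_ ?_ ?_ ?_ ?_
  · rw [smul_infty_eq_ite, if_neg]
    · change ((0 / √N : ℝ) : OnePoint ℝ) = _
      rw [zero_div]
    · exact hs.ne'
  · intro j
    rw [frickeMatrix_conj, mul_inv_cancel_right]
    exact mapR_mem_realImage_iff.2 ⟨_, lowerUnipotent_mem j, rfl⟩
  · intro x hx
    obtain ⟨k, -, h⟩ := exists_coe_eq_of_mem_realImage hx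
    exact ⟨_, h⟩
  · intro g hg _ _
    obtain ⟨k, hk, -, h01, -⟩ := key g hg
    rw [Gamma0_mem, ZMod.intCast_zmod_eq_zero_iff_dvd] at hk
    obtain ⟨j, hj⟩ := hk
    refine ⟨-j, ?_⟩
    have hN0 : (N : ℝ) ≠ 0 := by exact_mod_cast NeZero.ne N
    apply mul_right_cancel₀ hN0
    rw [h01, hj]
    push_cast
    ring
  · intro g hg h0
    obtain ⟨k, -, h00, -, h11⟩ := key g hg
    have hdet := g.2
    rw [det_fin_two] at hdet
    change g 0 0 * g 1 1 - g 0 1 * g 1 0 = 1 at hdet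
    rw [h0, mul_zero, sub_zero, h11] at hdet
    rw [h00] at hdet ⊢
    exact eq_one_or_eq_neg_one_of_mul_eq_one hdet

lemma mem_integral_translations {x : SL(2, ℝ)} :
    x ∈ Subgroup.zpowers unitTranslation ↔ ∃ j : ℤ, translation (.ofAdd (j : ℝ)) = x := by
  simp only [Subgroup.mem_zpowers_iff, unitTranslation_zpow]

lemma exists_eq_mul_upperUnipotent {g h : SL(2, ℤ)} (h0 : g 0 0 = h 0 0) (h1 : g 1 0 = h 1 0) :
    ∃ i : ℤ, h = g * upperUnipotent i := by
  have hg0 : g⁻¹ 0 0 = g 1 1 := by rw [SpecialLinearGroup.SL2_inv_expl]; rfl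
  have hg1 : g⁻¹ 0 1 = -g 0 1 := by rw [SpecialLinearGroup.SL2_inv_expl]; rfl
  have hg2 : g⁻¹ 1 0 = -g 1 0 := by rw [SpecialLinearGroup.SL2_inv_expl]; rfl
  have hg3 : g⁻¹ 1 1 = g 0 0 := by rw [SpecialLinearGroup.SL2_inv_expl]; rfl
  have hdet := g.2
  rw [det_fin_two] at hdet
  change g 0 0 * g 1 1 - g 0 1 * g 1 0 = 1 at hdet
  have hdet' := h.2
  rw [det_fin_two] at hdet'
  change h 0 0 * h 1 1 - h 0 1 * h 1 0 = 1 at hdet'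
  refine ⟨(g⁻¹ * h) 0 1, ?_⟩
  rw [← inv_mul_eq_iff_eq_mul]
  ext i j
  rw [specialLinear_mul_apply]
  fin_cases i <;> fin_cases j
  · change g⁻¹ 0 0 * h 0 0 + g⁻¹ 0 1 * h 1 0 = 1
    rw [hg0, hg1, ← h0, ← h1]
    linarith
  · exact (specialLinear_mul_apply _ _ _ _).symm
  · change g⁻¹ 1 0 * h 0 0 + g⁻¹ 1 1 * h 1 0 = 0
    rw [hg2, hg3, ← h0, ← h1]
    ring
  · change g⁻¹ 1 0 * h 0 1 + g⁻¹ 1 1 * h 1 1 = 1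
    rw [hg2, hg3, h0, h1]
    linarith

lemma exists_column {a c : ℤ} (h : IsCoprime a c) : ∃ g : SL(2, ℤ), g 0 0 = a ∧ g 1 0 = c := by
  obtain ⟨x, y, hxy⟩ := h
  refine ⟨⟨!![a, -y; c, x], ?_⟩, rfl, rfl⟩
  rw [det_fin_two_of]
  linear_combination hxy

/-- The elements that are counted by the Kloosterman sum come from elements of `Γ₀(N)` whose upper
left entry is given. -/
lemma mem_kloosterman_iff {g : SL(2, ℝ)} {c : ℝ} :
    ((frickeMatrix N * g * (1 : SL(2, ℝ))⁻¹ : SL(2, ℝ)) : GL (Fin 2) ℝ) ∈ heckeGroup N ∧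
        g 1 0 = c ↔
      ∃ k ∈ Gamma0 N, (frickeMatrix N)⁻¹ * mapR k = g ∧ -(√N * k 0 0) = c := by
  rw [inv_one, mul_one]
  constructor
  · rintro ⟨hg, hc⟩
    obtain ⟨k, hk, h⟩ := mapR_mem_realImage_iff.1 hg
    have h' : (frickeMatrix N)⁻¹ * mapR k = g := by rw [h, inv_mul_cancel_left]
    refine ⟨k, hk, h', ?_⟩
    rw [← hc, ← h', frickeMatrix_inv_mul_apply_one]
    rfl
  · rintro ⟨k, hk, rfl, rfl⟩
    refine ⟨mapR_mem_realImage_iff.2 ⟨k, hk, (mul_inv_cancel_left _ _).symm⟩, ?_⟩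
    rw [frickeMatrix_inv_mul_apply_one]
    rfl

lemma isCoprime_of_mem_Gamma0 {N : ℕ} {k : SL(2, ℤ)} (hk : k ∈ Gamma0 N) :
    IsCoprime (k 0 0) (N : ℤ) := by
  rw [Gamma0_mem, ZMod.intCast_zmod_eq_zero_iff_dvd] at hk
  exact (isCoprime_column k).of_isCoprime_of_dvd_right hk

/-- The Kloosterman sums vanish outside of `√N ℕ`, and at `√N n` if `n` is not coprime to `N`. -/
theorem kloostermanZero_eq_zero {c : ℝ} (hc : 0 < c)
    (h : ∀ n : ℕ, 0 < n → n.Coprime N → √N * n ≠ c) :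
    kloostermanZero (heckeGroup N) (frickeMatrix N) 1 c = 0 := by
  have hempty : {g : SL(2, ℝ) | ((frickeMatrix N * g * (1 : SL(2, ℝ))⁻¹ : SL(2, ℝ)) :
      GL (Fin 2) ℝ) ∈ heckeGroup N ∧ g 1 0 = c} = ∅ := by
    refine Set.eq_empty_of_forall_notMem fun g hg ↦ ?_
    obtain ⟨k, hk, -, hkc⟩ := mem_kloosterman_iff.1 hg
    have hneg : (k 0 0 : ℝ) < 0 := by
      by_contra hk0
      have := mul_nonneg (sqrt_level_pos N).le (not_lt.1 hk0)
      linarith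
    have hneg' : k 0 0 < 0 := by exact_mod_cast hneg
    obtain ⟨n, hn⟩ := Int.eq_ofNat_of_zero_le (by omega : 0 ≤ -k 0 0)
    refine h n (by omega) ?_ ?_
    · have := isCoprime_of_mem_Gamma0 hk
      rw [← Nat.isCoprime_iff_coprime, ← hn]
      exact this.neg_left
    · have : (n : ℝ) = -(k 0 0 : ℝ) := by exact_mod_cast hn.symm
      rw [this, ← hkc]
      ring
  rw [kloostermanZero, hempty, Set.image_empty, Set.ncard_empty]

/-- The double cosets with lower left entry `√N n` correspond to the units modulo `n`. -/
theorem kloostermanZero_sqrt_mul {n : ℕ} (hn : 0 < n) (hnN : n.Coprime N) :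
    kloostermanZero (heckeGroup N) (frickeMatrix N) 1 (√N * n) = n.totient := by
  have : NeZero n := ⟨hn.ne'⟩
  have hs := sqrt_level_pos N
  have hN0 : (N : ℤ) ≠ 0 := by exact_mod_cast NeZero.ne N
  have hcol : ∀ u : (ZMod n)ˣ, ∃ k : SL(2, ℤ), k 0 0 = -(n : ℤ) ∧
      k 1 0 = N * ((u : ZMod n).val : ℤ) := by
    intro u
    refine exists_column (IsCoprime.neg_left (IsCoprime.mul_right ?_ ?_))
    · exact Nat.isCoprime_iff_coprime.2 hnN
    · exact Nat.isCoprime_iff_coprime.2 (ZMod.val_coe_unit_coprime u).symm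
  choose K hK0 hK1 using hcol
  let B : Subgroup SL(2, ℝ) := Subgroup.zpowers unitTranslation
  let D : SL(2, ℝ) → Set SL(2, ℝ) := fun g ↦ DoubleCoset.doubleCoset g (B : Set SL(2, ℝ)) B
  have hset : D '' {g : SL(2, ℝ) | ((frickeMatrix N * g * (1 : SL(2, ℝ))⁻¹ : SL(2, ℝ)) :
      GL (Fin 2) ℝ) ∈ heckeGroup N ∧ g 1 0 = √N * n} =
      (fun u ↦ D ((frickeMatrix N)⁻¹ * mapR (K u))) '' Set.univ := by
    ext E
    constructor
    · rintro ⟨g, hg, rfl⟩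
      obtain ⟨k, hk, rfl, hkc⟩ := mem_kloosterman_iff.1 hg
      have hk0 : k 0 0 = -(n : ℤ) := by
        have : √(N : ℝ) * (-(k 0 0 : ℝ)) = √N * n := by linarith
        have h2 := mul_left_cancel₀ hs.ne' this
        have h3 : -k 0 0 = (n : ℤ) := by exact_mod_cast h2
        omega
      have hk1 := hk
      rw [Gamma0_mem, ZMod.intCast_zmod_eq_zero_iff_dvd] at hk1
      obtain ⟨γ, hγ⟩ := hk1
      have hcop : IsCoprime (n : ℤ) γ := by
        have := isCoprime_column k
        rw [hk0, hγ] at this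
        exact (IsCoprime.neg_left_iff _ _).1 this.of_mul_right_right
      have hunit : IsUnit (γ : ZMod n) := (ZMod.coe_int_isUnit_iff_isCoprime γ n).2 hcop
      let u := hunit.unit
      have hu : (((u : ZMod n).val : ℤ) : ZMod n) = (γ : ZMod n) := by
        rw [Int.cast_natCast, ZMod.natCast_zmod_val]
        rfl
      obtain ⟨j, hj⟩ := (ZMod.intCast_eq_intCast_iff_dvd_sub _ _ _).1 hu.symm
      have h0 : (lowerUnipotent (-(N * j)) * k) 0 0 = (K u) 0 0 := by
        rw [specialLinear_mul_apply, hK0, hk0]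
        simp [lowerUnipotent]
      have h1 : (lowerUnipotent (-(N * j)) * k) 1 0 = (K u) 1 0 := by
        rw [specialLinear_mul_apply, hK1, hk0, hγ]
        change -(N * j) * -(n : ℤ) + 1 * (N * γ) = _
        linear_combination -(N : ℤ) * hj
      obtain ⟨i, hi⟩ := exists_eq_mul_upperUnipotent h0 h1
      refine ⟨u, Set.mem_univ _, DoubleCoset.doubleCoset_eq_of_mem
        (DoubleCoset.mem_doubleCoset.2 ⟨_, mem_integral_translations.2 ⟨j, rfl⟩, _,
          mem_integral_translations.2 ⟨i, rfl⟩, ?_⟩)⟩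
      have e : (frickeMatrix N)⁻¹ * mapR (lowerUnipotent (-(N * j))) =
          translation (.ofAdd (j : ℝ)) * (frickeMatrix N)⁻¹ := by
        rw [inv_mul_eq_iff_eq_mul, ← mul_assoc, frickeMatrix_conj, mul_inv_cancel_right]
      rw [hi, map_mul, map_mul, mapR_upperUnipotent, ← mul_assoc, ← mul_assoc, e]
      simp only [mul_assoc]
    · rintro ⟨u, -, rfl⟩
      refine ⟨_, mem_kloosterman_iff.2 ⟨K u, ?_, rfl, ?_⟩, rfl⟩
      · rw [Gamma0_mem, hK1]
        simp
      · rw [hK0]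
        push_cast
        ring
  have hinj : Function.Injective (fun u ↦ D ((frickeMatrix N)⁻¹ * mapR (K u))) := by
    intro u v huv
    have hmem : (frickeMatrix N)⁻¹ * mapR (K v) ∈ D ((frickeMatrix N)⁻¹ * mapR (K u)) := by
      change D _ = D _ at huv
      rw [huv]
      exact DoubleCoset.mem_doubleCoset.2 ⟨1, B.one_mem, 1, B.one_mem, by group⟩
    obtain ⟨x, hx, y, hy, h⟩ := DoubleCoset.mem_doubleCoset.1 hmem
    obtain ⟨j, rfl⟩ := mem_integral_translations.1 hx
    obtain ⟨i, rfl⟩ := mem_integral_translations.1 hy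
    have e := congrArg (fun m : SL(2, ℝ) ↦ m 0 0) h
    simp only [mul_translation_apply_zero, translation_mul_apply_zero,
      frickeMatrix_inv_mul_apply_zero, frickeMatrix_inv_mul_apply_one, mapR_apply, hK0, hK1] at e
    have hNs : √(N : ℝ) * √N = N := Real.mul_self_sqrt (Nat.cast_nonneg N)
    field_simp at e
    push_cast at e
    have e2 : (N : ℝ) * ((v : ZMod n).val : ℝ) = N * ((u : ZMod n).val + j * n) := by
      linear_combination e + (j : ℝ) * n * hNs
    have hN0' : (N : ℝ) ≠ 0 := by exact_mod_cast NeZero.ne N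
    have e3 := mul_left_cancel₀ hN0' e2
    have e4 : ((v : ZMod n).val : ℤ) = (u : ZMod n).val + j * n := by exact_mod_cast e3
    have e5 := congrArg (Int.cast : ℤ → ZMod n) e4
    push_cast at e5
    rw [ZMod.natCast_zmod_val, ZMod.natCast_zmod_val, ZMod.natCast_self, mul_zero, add_zero] at e5
    exact Units.ext e5.symm
  rw [kloostermanZero]
  change (D '' _).ncard = _
  rw [hset, Set.ncard_image_of_injective _ hinj, Set.ncard_univ, Nat.card_eq_fintype_card,
    ZMod.card_units_eq_totient]

end
end CuspScattering

end

noncomputable section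
namespace CuspScattering
open Complex
open scoped LSeries.notation

/-! ### The Dirichlet series of the Kloosterman sums -/

/-- The product of the Euler factors of `ζ(w)⁻¹` at the primes dividing `N`. -/
def eulerProduct (N : ℕ) (w : ℂ) : ℂ := ∏ p ∈ N.primeFactors, (1 - (p : ℂ) ^ (-w))

lemma LSeries_trivial_character {N : ℕ} [NeZero N] {w : ℂ} (hw : 1 < w.re) :
    LSeries (fun n ↦ (1 : DirichletCharacter ℂ N) n) w = riemannZeta w * eulerProduct N w := by
  rw [← DirichletCharacter.LFunction_eq_LSeries _ hw]
  have h1 : w ≠ 1 := by rintro rfl; simp at hw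
  have := DirichletCharacter.LFunctionTrivChar_eq_mul_riemannZeta (N := N) h1
  rw [mul_comm]
  exact this

lemma term_mul_natCast (f : ℕ → ℂ) (w : ℂ) (n : ℕ) :
    LSeries.term (fun n ↦ f n * n) w n = LSeries.term f (w - 1) n := by
  rcases eq_or_ne n 0 with rfl | hn
  · simp
  · have : (n : ℂ) ≠ 0 := by exact_mod_cast hn
    rw [LSeries.term_of_ne_zero hn, LSeries.term_of_ne_zero hn, cpow_sub _ _ this, cpow_one]
    field_simp

lemma trivial_character_mul_convolution (N : ℕ) :
    (fun n : ℕ ↦ (1 : DirichletCharacter ℂ N) n * (n.totient : ℂ)) ⍟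
      (fun n : ℕ ↦ (1 : DirichletCharacter ℂ N) n) =
    fun n : ℕ ↦ (1 : DirichletCharacter ℂ N) n * (n : ℂ) := by
  have h := DirichletCharacter.mul_convolution_distrib (1 : DirichletCharacter ℂ N)
    (fun n : ℕ ↦ (n.totient : ℂ)) 1
  rw [mul_one] at h
  have h2 : (fun n : ℕ ↦ (n.totient : ℂ)) ⍟ 1 = fun n : ℕ ↦ (n : ℂ) := by
    ext n
    simp only [LSeries.convolution_def, Pi.one_apply, mul_one]
    rw [Nat.sum_divisorsAntidiagonal (fun i _ ↦ (i.totient : ℂ)), ← Nat.cast_sum, Nat.sum_totient]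
  rw [h2] at h
  exact h

lemma LSeriesSummable_character_mul_totient {N : ℕ} {w : ℂ} (hw : 2 < w.re) :
    LSeriesSummable (fun n : ℕ ↦ (1 : DirichletCharacter ℂ N) n * (n.totient : ℂ)) w := by
  refine LSeriesSummable_of_le_const_mul_rpow hw ⟨1, fun n hn ↦ ?_⟩
  have h1 : ‖(1 : DirichletCharacter ℂ N) n‖ ≤ 1 := DirichletCharacter.norm_le_one _ _
  have h2 : (n.totient : ℝ) ≤ n := by exact_mod_cast n.totient_le
  rw [norm_mul, Complex.norm_natCast]
  norm_num
  calc _ ≤ 1 * (n : ℝ) := by gcongr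
    _ = n := one_mul _

/-- The identity `∑ d ∣ n, φ d = n`, twisted by the trivial character modulo `N`. -/
theorem LSeries_character_mul_totient {N : ℕ} [NeZero N] {w : ℂ} (hw : 2 < w.re) :
    LSeries (fun n : ℕ ↦ (1 : DirichletCharacter ℂ N) n * (n.totient : ℂ)) w =
      riemannZeta (w - 1) * eulerProduct N (w - 1) / (riemannZeta w * eulerProduct N w) := by
  have hw1 : 1 < w.re := by linarith
  have hw2 : 1 < (w - 1).re := by simp; linarith
  have hχ := DirichletCharacter.LSeriesSummable_of_one_lt_re (1 : DirichletCharacter ℂ N) hw1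
  have h := LSeries_convolution' (LSeriesSummable_character_mul_totient (N := N) hw) hχ
  rw [trivial_character_mul_convolution] at h
  have h0 := DirichletCharacter.LSeries_ne_zero_of_one_lt_re (1 : DirichletCharacter ℂ N) hw1
  rw [← LSeries_trivial_character hw1, ← LSeries_trivial_character hw2, eq_div_iff h0, ← h]
  exact tsum_congr fun n ↦ term_mul_natCast _ _ _

theorem hasSum_kloostermanZero (N : ℕ) [NeZero N] {s : ℂ} (hs : 1 < s.re) :
    HasSum (fun c : {c : ℝ // 0 < c} ↦ ((c : ℝ) : ℂ) ^ (-2 * s) *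
        (kloostermanZero (heckeGroup N) (frickeMatrix N) 1 (c : ℝ) : ℂ))
      ((N : ℂ) ^ (-s) * (riemannZeta (2 * s - 1) * eulerProduct N (2 * s - 1) /
        (riemannZeta (2 * s) * eulerProduct N (2 * s)))) := by
  have hN : 0 < (N : ℝ) := by exact_mod_cast Nat.pos_of_ne_zero (NeZero.ne N)
  have h2 : 2 < (2 * s).re := by simp; linarith
  have hsum := (LSeriesSummable_character_mul_totient (N := N) h2).LSeriesHasSum
  rw [LSeries_character_mul_totient h2] at hsum
  replace hsum := HasSum.mul_left ((N : ℂ) ^ (-s)) hsum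
  -- the moduli `c` that occur are `√N * n`, with `n` prime to `N`
  let e : ℕ+ → {c : ℝ // 0 < c} := fun n ↦
    ⟨√(N : ℝ) * (n : ℕ), mul_pos (sqrt_level_pos N) (by exact_mod_cast n.pos)⟩
  have he : Function.Injective e := by
    intro m n h
    have := mul_left_cancel₀ (sqrt_level_pos N).ne' (congrArg Subtype.val h)
    exact PNat.eq (by exact_mod_cast this)
  have hcoe : Function.Injective ((↑) : ℕ+ → ℕ) := PNat.coe_injective
  rw [← hcoe.hasSum_iff] at hsum
  · rw [← he.hasSum_iff]
    · rw [show (_ ∘ e : ℕ+ → ℂ) = _ from funext fun n ↦ ?_]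
      · exact hsum
      have hn : (n : ℕ) ≠ 0 := n.ne_zero
      have hn' : ((n : ℕ) : ℂ) ≠ 0 := by exact_mod_cast hn
      have hval : ((e n : ℝ) : ℂ) ^ (-2 * s) = (N : ℂ) ^ (-s) * ((n : ℕ) : ℂ) ^ (-(2 * s)) := by
        change ((√(N : ℝ) * (n : ℕ) : ℝ) : ℂ) ^ (-2 * s) = _
        have hsq : ((√(N : ℝ) : ℝ) : ℂ) ^ (-2 * s) = (N : ℂ) ^ (-s) := by
          have harg : ((√(N : ℝ) : ℝ) : ℂ).arg = 0 := arg_ofReal_of_nonneg (Real.sqrt_nonneg _)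
          rw [show -2 * s = ((2 : ℕ) : ℂ) * -s by push_cast; ring,
            cpow_nat_mul' (by simp [harg, Real.pi_pos]) (by simp [harg, Real.pi_pos.le]),
            ← ofReal_pow, Real.sq_sqrt hN.le, ofReal_natCast]
        rw [ofReal_mul, mul_cpow_ofReal_nonneg (Real.sqrt_nonneg _) (by positivity), hsq,
          ofReal_natCast, neg_mul]
      change ((e n : ℝ) : ℂ) ^ (-2 * s) * _ = _ * LSeries.term _ _ (n : ℕ)
      rw [hval, LSeries.term_of_ne_zero hn]
      change _ * ((kloostermanZero (heckeGroup N) (frickeMatrix N) 1 (√(N : ℝ) * (n : ℕ)) : ℕ) : ℂ)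
        = _
      by_cases hc : (n : ℕ).Coprime N
      · rw [kloostermanZero_sqrt_mul n.pos hc, MulChar.one_apply
          ((ZMod.isUnit_iff_coprime _ _).mpr hc), one_mul, cpow_neg ((n : ℕ) : ℂ)]
        ring
      · rw [kloostermanZero_eq_zero (e n).2, MulChar.map_nonunit _
          (by rwa [ZMod.isUnit_iff_coprime])]
        · simp
        · intro m hm hmN h
          have := he (a₁ := ⟨m, hm⟩) (a₂ := n) (Subtype.ext h)
          rw [← this] at hc
          exact hc hmN
    · intro c hc
      rw [kloostermanZero_eq_zero c.2]
      · simp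
      · intro n hn _ h
        exact hc ⟨⟨n, hn⟩, Subtype.ext h⟩
  · intro n hn
    have : n = 0 := by
      by_contra h
      exact hn ⟨⟨n, Nat.pos_of_ne_zero h⟩, rfl⟩
    simp [this]

end CuspScattering

end

noncomputable section
namespace CuspScattering
open Complex Filter Topology
open Real (eulerMascheroniConstant)

/-! ### The scattering function of `Γ₀(N)` near `s = 1` -/

/-- `(s - 1)` times the scattering function of `Γ₀(N)` at the cusps `0` and `∞`. The entire function
`riemannZeta₁` stands for `(w - 1) ζ(w)`. -/
def scatteringNumerator (N : ℕ) (s : ℂ) : ℂ :=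
  (√Real.pi : ℂ) * (Gamma (s - 1 / 2) / Gamma s) * ((N : ℂ) ^ (-s) *
    ((2 * s - 1) * (riemannZeta₁ (2 * s - 1) * eulerProduct N (2 * s - 1)) /
      (2 * (riemannZeta₁ (2 * s) * eulerProduct N (2 * s)))))

/-- The scattering function of `Γ₀(N)` at the cusps `0` and `∞`. -/
def scatteringFunction (N : ℕ) (s : ℂ) : ℂ := (s - 1)⁻¹ * scatteringNumerator N s

lemma differentiable_eulerProduct (N : ℕ) : Differentiable ℂ (eulerProduct N) := by
  unfold eulerProduct
  refine Differentiable.fun_finsetProd fun p hp ↦ ?_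
  have : (p : ℂ) ≠ 0 := by exact_mod_cast (Nat.prime_of_mem_primeFactors hp).ne_zero
  exact (differentiable_const _).sub (differentiable_neg.const_cpow (.inl this))

lemma differentiable_level_cpow (N : ℕ) [NeZero N] : Differentiable ℂ fun s : ℂ ↦ (N : ℂ) ^ (-s) :=
  differentiable_neg.const_cpow (.inl (by exact_mod_cast NeZero.ne N))

lemma meromorphic_of_differentiable {f : ℂ → ℂ} (hf : Differentiable ℂ f) : Meromorphic f :=
  fun x ↦ (hf.analyticAt x).meromorphicAt

lemma meromorphic_scatteringFunction (N : ℕ) [NeZero N] : Meromorphic (scatteringFunction N) := by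
  have hP := differentiable_eulerProduct N
  have hζ := differentiable_riemannZeta₁
  have hΓ : Meromorphic fun s : ℂ ↦ Gamma (s - 1 / 2) := fun x ↦
    MeromorphicAt.comp_analyticAt (Meromorphic.Gamma _) (by fun_prop)
  have h1 : Meromorphic fun s : ℂ ↦ (s - 1)⁻¹ :=
    (meromorphic_of_differentiable (by fun_prop)).inv
  exact h1.mul ((((Meromorphic.const _).mul (hΓ.div Meromorphic.Gamma))).mul
    ((meromorphic_of_differentiable (differentiable_level_cpow N)).mul
      ((meromorphic_of_differentiable (by fun_prop)).div
        (meromorphic_of_differentiable (by fun_prop)))))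

lemma scatteringFunction_eq (N : ℕ) {s : ℂ} (hs : 1 < s.re) :
    scatteringFunction N s = (√Real.pi : ℂ) * (Gamma (s - 1 / 2) / Gamma s) * ((N : ℂ) ^ (-s) *
      (riemannZeta (2 * s - 1) * eulerProduct N (2 * s - 1) /
        (riemannZeta (2 * s) * eulerProduct N (2 * s)))) := by
  have h1 : s - 1 ≠ 0 := fun h ↦ by
    rw [sub_eq_zero.1 h, one_re] at hs
    exact lt_irrefl _ hs
  have h2 : 2 * s - 1 ≠ 1 := fun h ↦ h1 (by linear_combination h / 2)
  have h3 : 2 * s - 1 ≠ 0 := fun h ↦ by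
    have := congrArg re h
    simp at this
    linarith
  have h4 : 2 * s ≠ 1 := fun h ↦ h3 (by linear_combination h)
  have h5 : 2 * s - 1 - 1 ≠ 0 := sub_ne_zero.2 h2
  rw [scatteringFunction, scatteringNumerator, riemannZeta_eq_inv_sub_mul h2,
    riemannZeta_eq_inv_sub_mul h4]
  have h6 : 2 * s - 1 - 1 = 2 * (s - 1) := by ring
  rw [h6]
  simp only [div_eq_mul_inv, mul_inv, inv_inv]
  ring

lemma riemannZeta₁_two : riemannZeta₁ 2 = (Real.pi : ℂ) ^ 2 / 6 := by
  have := riemannZeta_eq_inv_sub_mul (s := 2) (by norm_num)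
  rw [riemannZeta_two] at this
  rw [this]
  norm_num

lemma logDeriv_riemannZeta₁_two :
    logDeriv riemannZeta₁ 2 = 1 + deriv riemannZeta 2 / riemannZeta 2 := by
  have h := deriv_riemannZeta_eq_neg_inv_sub_sq_mul_add (s := 2) (by norm_num)
  have h2 := riemannZeta_eq_inv_sub_mul (s := 2) (by norm_num)
  have h0 : riemannZeta₁ 2 ≠ 0 := by
    rw [riemannZeta₁_two]
    simp [Real.pi_ne_zero]
  norm_num at h h2
  rw [logDeriv_apply, h2, h]
  field_simp
  ring

lemma eulerFactor_ne_zero {p : ℕ} (hp : p.Prime) {w : ℂ} (hw : 0 < w.re) :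
    1 - (p : ℂ) ^ (-w) ≠ 0 := by
  intro h
  have h1 : ‖(p : ℂ) ^ (-w)‖ = 1 := by rw [← sub_eq_zero.1 h, norm_one]
  rw [norm_natCast_cpow_of_pos hp.pos, neg_re] at h1
  have : (p : ℝ) ^ (-w.re) < 1 :=
    Real.rpow_lt_one_of_one_lt_of_neg (by exact_mod_cast hp.one_lt) (by linarith)
  linarith

lemma logDeriv_eulerProduct (N : ℕ) {w : ℂ} (hw : 0 < w.re) :
    logDeriv (eulerProduct N) w =
      ∑ p ∈ N.primeFactors, log p * (p : ℂ) ^ (-w) / (1 - (p : ℂ) ^ (-w)) := by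
  have hd : ∀ p ∈ N.primeFactors,
      HasDerivAt (fun w : ℂ ↦ 1 - (p : ℂ) ^ (-w)) (log p * (p : ℂ) ^ (-w)) w := by
    intro p hp
    have h0 : (p : ℂ) ≠ 0 := by exact_mod_cast (Nat.prime_of_mem_primeFactors hp).ne_zero
    have := ((hasDerivAt_neg w).const_cpow (c := (p : ℂ)) (.inl h0)).const_sub 1
    convert! this using 1
    ring
  have h := logDeriv_prod (s := N.primeFactors) (f := fun p (w : ℂ) ↦ 1 - (p : ℂ) ^ (-w)) (x := w)
    (fun p hp ↦ eulerFactor_ne_zero (Nat.prime_of_mem_primeFactors hp) hw)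
    (fun p hp ↦ (hd p hp).differentiableAt)
  refine h.trans (Finset.sum_congr rfl fun p hp ↦ ?_)
  rw [logDeriv_apply, (hd p hp).deriv]

lemma eulerProduct_ne_zero (N : ℕ) {w : ℂ} (hw : 0 < w.re) : eulerProduct N w ≠ 0 :=
  Finset.prod_ne_zero_iff.2 fun _ hp ↦ eulerFactor_ne_zero (Nat.prime_of_mem_primeFactors hp) hw

/-- `f` is differentiable and non-zero at `x`, with logarithmic derivative `l`. -/
def HasLogDerivAt (f : ℂ → ℂ) (l x : ℂ) : Prop :=
  DifferentiableAt ℂ f x ∧ f x ≠ 0 ∧ logDeriv f x = l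

namespace HasLogDerivAt
variable {f g : ℂ → ℂ} {l m x : ℂ}

lemma mul (hf : HasLogDerivAt f l x) (hg : HasLogDerivAt g m x) :
    HasLogDerivAt (fun s ↦ f s * g s) (l + m) x :=
  ⟨hf.1.fun_mul hg.1, mul_ne_zero hf.2.1 hg.2.1, by
    rw [logDeriv_mul x hf.2.1 hg.2.1 hf.1 hg.1, hf.2.2, hg.2.2]⟩

lemma div (hf : HasLogDerivAt f l x) (hg : HasLogDerivAt g m x) :
    HasLogDerivAt (fun s ↦ f s / g s) (l - m) x :=
  ⟨hf.1.fun_div hg.1 hg.2.1, div_ne_zero hf.2.1 hg.2.1, by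
    rw [logDeriv_div x hf.2.1 hg.2.1 hf.1 hg.1, hf.2.2, hg.2.2]⟩

lemma const {a : ℂ} (ha : a ≠ 0) : HasLogDerivAt (fun _ ↦ a) 0 x :=
  ⟨differentiableAt_const _, ha, by rw [logDeriv_const, Pi.zero_apply]⟩

lemma comp_affine {a b c : ℂ} (hf : HasLogDerivAt f l c) (h : a * x + b = c) :
    HasLogDerivAt (fun s ↦ f (a * s + b)) (a * l) x := by
  subst h
  have hd : HasDerivAt (fun s : ℂ ↦ a * s + b) a x := by
    simpa using ((hasDerivAt_id x).const_mul a).add_const b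
  have := logDeriv_comp (f := f) (g := fun s ↦ a * s + b) hf.1 hd.differentiableAt
  rw [hd.deriv, hf.2.2, mul_comm] at this
  exact ⟨hf.1.comp x hd.differentiableAt, hf.2.1, this⟩

end HasLogDerivAt

lemma scatteringNumerator_one (N : ℕ) [NeZero N] :
    scatteringNumerator N 1 =
      3 / (Real.pi * N) * (eulerProduct N 1 / eulerProduct N 2) := by
  have hπ : (Real.pi : ℂ) ≠ 0 := by exact_mod_cast Real.pi_ne_zero
  have hsq : (√Real.pi : ℂ) * √Real.pi = Real.pi := by
    rw [← ofReal_mul, Real.mul_self_sqrt Real.pi_nonneg]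
  have hΓ : Gamma (1 - 1 / 2) = (√Real.pi : ℂ) := by
    rw [show (1 - 1 / 2 : ℂ) = ((1 / 2 : ℝ) : ℂ) by push_cast; norm_num, Gamma_ofReal,
      Real.Gamma_one_half_eq]
  rw [scatteringNumerator, hΓ, Gamma_one, div_one, hsq, mul_one,
    show (2 - 1 : ℂ) = 1 by norm_num, riemannZeta₁_one, riemannZeta₁_two, cpow_neg_one]
  field_simp
  ring

lemma differentiableAt_Gamma_of_re_pos {s : ℂ} (hs : 0 < s.re) : DifferentiableAt ℂ Gamma s := by
  refine differentiableAt_Gamma s fun m h ↦ ?_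
  rw [h, neg_re, natCast_re] at hs
  have : (0 : ℝ) ≤ m := Nat.cast_nonneg m
  linarith

lemma logDeriv_Gamma_one_half :
    logDeriv Gamma (1 / 2) = -(eulerMascheroniConstant + 2 * Real.log 2) := by
  have hΓ : Gamma (1 / 2) = (√Real.pi : ℂ) := by
    rw [show (1 / 2 : ℂ) = ((1 / 2 : ℝ) : ℂ) by push_cast; norm_num, Gamma_ofReal,
      Real.Gamma_one_half_eq]
  have h0 : (√Real.pi : ℂ) ≠ 0 := by
    exact_mod_cast (Real.sqrt_pos.2 Real.pi_pos).ne'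
  rw [logDeriv_apply, hasDerivAt_Gamma_one_half.deriv, hΓ,
    show log 2 = (Real.log 2 : ℂ) by exact_mod_cast (natCast_log (n := 2)).symm]
  field_simp

lemma logDeriv_level_cpow (N : ℕ) [NeZero N] (s : ℂ) :
    logDeriv (fun s : ℂ ↦ (N : ℂ) ^ (-s)) s = -Real.log N := by
  have h0 : (N : ℂ) ≠ 0 := by exact_mod_cast NeZero.ne N
  have := (hasDerivAt_neg s).const_cpow (c := (N : ℂ)) (.inl h0)
  rw [logDeriv_apply, this.deriv, natCast_log]
  have h1 : (N : ℂ) ^ (-s) ≠ 0 := by simp [cpow_eq_zero_iff, h0]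
  field_simp

/-- The logarithmic derivatives of the factors at `s = 1`: the gamma factors give `-2 log 2`, the
zeta factors and the factor `2 s - 1` give `2 γ - 2 ζ'(2) / ζ(2)` with Euler's constant `γ`, the
power of `N` gives `-log N`, and the Euler factors give the sum over the primes. -/
lemma hasLogDerivAt_scatteringNumerator (N : ℕ) [NeZero N] :
    HasLogDerivAt (scatteringNumerator N)
      (2 * eulerMascheroniConstant - 2 * Real.log 2 - 2 * (deriv riemannZeta 2 / riemannZeta 2)
        - Real.log N + ∑ p ∈ N.primeFactors,
          ((2 * (p : ℝ) * Real.log p / ((p : ℝ) ^ 2 - 1) : ℝ) : ℂ)) 1 := by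
  have h1 : HasLogDerivAt (fun _ ↦ (√Real.pi : ℂ)) 0 1 :=
    .const (by exact_mod_cast (Real.sqrt_pos.2 Real.pi_pos).ne')
  have h2 : HasLogDerivAt (fun s ↦ Gamma (1 * s + -(1 / 2))) _ 1 :=
    HasLogDerivAt.comp_affine (c := 1 / 2)
      ⟨differentiableAt_Gamma_of_re_pos (by norm_num), Gamma_ne_zero_of_re_pos (by norm_num),
        logDeriv_Gamma_one_half⟩ (by norm_num)
  have h3 : HasLogDerivAt Gamma (-eulerMascheroniConstant) 1 :=
    ⟨hasDerivAt_Gamma_one.differentiableAt, by simp, by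
      rw [logDeriv_apply, hasDerivAt_Gamma_one.deriv, Gamma_one, div_one]⟩
  have h4 : HasLogDerivAt (fun s ↦ (N : ℂ) ^ (-s)) _ 1 :=
    ⟨differentiable_level_cpow N 1, by simp [cpow_eq_zero_iff, NeZero.ne N],
      logDeriv_level_cpow N 1⟩
  have h5 : HasLogDerivAt (fun s : ℂ ↦ 2 * s + -1) _ 1 :=
    HasLogDerivAt.comp_affine (f := fun s ↦ s) (c := 1)
      ⟨differentiableAt_id, one_ne_zero, logDeriv_id' 1⟩ (by norm_num)
  have h6 : HasLogDerivAt (fun s : ℂ ↦ riemannZeta₁ (2 * s + -1)) _ 1 :=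
    HasLogDerivAt.comp_affine (f := riemannZeta₁) (c := 1) (l := eulerMascheroniConstant)
      ⟨differentiable_riemannZeta₁ 1, by simp, by simp [logDeriv_apply]⟩ (by norm_num)
  have h7 : HasLogDerivAt (fun s : ℂ ↦ eulerProduct N (2 * s + -1)) _ 1 :=
    HasLogDerivAt.comp_affine (c := 1)
      ⟨differentiable_eulerProduct N 1, eulerProduct_ne_zero N (by norm_num),
        logDeriv_eulerProduct N (by norm_num)⟩ (by norm_num)
  have h8 : HasLogDerivAt (fun s : ℂ ↦ riemannZeta₁ (2 * s + 0)) _ 1 :=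
    HasLogDerivAt.comp_affine (f := riemannZeta₁) (c := 2)
      ⟨differentiable_riemannZeta₁ 2, by simp [riemannZeta₁_two, Real.pi_ne_zero],
        logDeriv_riemannZeta₁_two⟩ (by norm_num)
  have h9 : HasLogDerivAt (fun s : ℂ ↦ eulerProduct N (2 * s + 0)) _ 1 :=
    HasLogDerivAt.comp_affine (c := 2)
      ⟨differentiable_eulerProduct N 2, eulerProduct_ne_zero N (by norm_num),
        logDeriv_eulerProduct N (by norm_num)⟩ (by norm_num)
  have H := (h1.mul (h2.div h3)).mul (h4.mul ((h5.mul (h6.mul h7)).div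
    ((HasLogDerivAt.const two_ne_zero).mul (h8.mul h9))))
  simp only [one_mul, add_zero, ← sub_eq_add_neg] at H
  convert! H using 1
  have hp : ∀ p ∈ N.primeFactors, ((2 * (p : ℝ) * Real.log p / ((p : ℝ) ^ 2 - 1) : ℝ) : ℂ) =
      2 * (log p * (p : ℂ) ^ (-1 : ℂ) / (1 - (p : ℂ) ^ (-1 : ℂ))) -
        2 * (log p * (p : ℂ) ^ (-2 : ℂ) / (1 - (p : ℂ) ^ (-2 : ℂ))) := by
    intro p hp
    have h1 : (1 : ℝ) < p := by exact_mod_cast (Nat.prime_of_mem_primeFactors hp).one_lt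
    have h0 : (p : ℂ) ≠ 0 := by exact_mod_cast (by linarith : (p : ℝ) ≠ 0)
    have h2 : (p : ℂ) - 1 ≠ 0 := by exact_mod_cast (by linarith : (p : ℝ) - 1 ≠ 0)
    have h3 : (p : ℂ) ^ 2 - 1 ≠ 0 := by exact_mod_cast (by nlinarith : (p : ℝ) ^ 2 - 1 ≠ 0)
    rw [cpow_neg_one, cpow_neg, cpow_ofNat, ← natCast_log,
      show 1 - (p : ℂ)⁻¹ = (p - 1) / p by field_simp,
      show 1 - ((p : ℂ) ^ 2)⁻¹ = (p ^ 2 - 1) / p ^ 2 by field_simp]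
    push_cast
    field_simp
    ring
  rw [Finset.sum_congr rfl hp, Finset.sum_sub_distrib, ← Finset.mul_sum, ← Finset.mul_sum]
  ring

end CuspScattering

end

noncomputable section
namespace CuspScattering
open Complex Filter Topology CongruenceSubgroup
open Real (eulerMascheroniConstant)

/-! ### Scattering constants -/

section
variable {𝒢 : Subgroup (GL (Fin 2) ℝ)} {p q : OnePoint ℝ} {σ τ : SL(2, ℝ)} {Φ : ℂ → ℂ} {C₀ : ℂ}

/-- Two meromorphic continuations agree on `Re s > 1`, which is enough to compare their limits, and
the series does not depend on the scaling matrices. -/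
theorem isScatteringConstant_iff_eq (hneg : -1 ∈ 𝒢) (hσ : IsScalingMatrix 𝒢 p σ)
    (hτ : IsScalingMatrix 𝒢 q τ) (hΦ : IsScatteringFunction 𝒢 σ τ Φ)
    (hlim : Tendsto (fun s : ℂ ↦ Φ s - 1 / ((s - 1) * (hyperbolicVolume 𝒢 : ℂ)))
      (𝓝[≠] 1) (𝓝 C₀)) (C : ℂ) : IsScatteringConstant 𝒢 p q C ↔ C = C₀ := by
  constructor
  · rintro ⟨-, -, h⟩
    obtain ⟨Φ', hΦ', hlim'⟩ := h σ τ hσ hτ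
    have hle : 𝓝[{s : ℂ | 1 < s.re}] 1 ≤ 𝓝[≠] 1 := by
      refine nhdsWithin_mono _ fun s hs h ↦ ?_
      rw [Set.mem_singleton_iff] at h
      simp [h] at hs
    have : (𝓝[{s : ℂ | 1 < s.re}] (1 : ℂ)).NeBot := by
      rw [← mem_closure_iff_nhdsWithin_neBot, closure_setOfPred_lt_re]
      exact le_refl (1 : ℝ)
    refine tendsto_nhds_unique ((hlim'.mono_left hle).congr' ?_) (hlim.mono_left hle)
    filter_upwards [self_mem_nhdsWithin] with s hs
    obtain ⟨L, hL, h1⟩ := hΦ.2 s hs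
    obtain ⟨L', hL', h2⟩ := hΦ'.2 s hs
    rw [h1, h2, hL.unique hL']
  · rintro rfl
    refine ⟨⟨σ, hσ⟩, ⟨τ, hτ⟩, fun σ' τ' hσ' hτ' ↦ ⟨Φ, ?_, hlim⟩⟩
    obtain ⟨b, hb⟩ := hσ.eq_or_eq_neg hσ'
    obtain ⟨b', hb'⟩ := hτ.eq_or_eq_neg hτ'
    refine ⟨hΦ.1, fun s hs ↦ ?_⟩
    simp only [kloostermanZero_congr hneg hb hb']
    exact hΦ.2 s hs

lemma kloostermanZero_mul_left {γ : SL(2, ℝ)} (hγ : (γ : GL (Fin 2) ℝ) ∈ 𝒢) (c : ℝ) :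
    kloostermanZero 𝒢 (γ * σ) τ c = kloostermanZero 𝒢 σ τ c := by
  have h : ∀ g : SL(2, ℝ), ((γ * σ * g * τ⁻¹ : SL(2, ℝ)) : GL (Fin 2) ℝ) ∈ 𝒢 ↔
      ((σ * g * τ⁻¹ : SL(2, ℝ)) : GL (Fin 2) ℝ) ∈ 𝒢 := fun g ↦ by
    rw [show γ * σ * g * τ⁻¹ = γ * (σ * g * τ⁻¹) by group, map_mul,
      Subgroup.mul_mem_cancel_left _ hγ]
  simp only [kloostermanZero, h]

end

lemma isScatteringFunction_scatteringFunction (N : ℕ) [NeZero N] :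
    IsScatteringFunction (heckeGroup N) (frickeMatrix N) 1 (scatteringFunction N) :=
  ⟨meromorphic_scatteringFunction N, fun _ hs ↦ ⟨_, hasSum_kloostermanZero N hs,
    scatteringFunction_eq N hs⟩⟩

lemma scatteringNumerator_one_eq_inv_volume (N : ℕ) [NeZero N] :
    scatteringNumerator N 1 = 1 / (hyperbolicVolume (heckeGroup N) : ℂ) := by
  have hfin : Finite (SL(2, ℤ) ⧸ Gamma0 N) := inferInstance
  have hv : hyperbolicVolume (heckeGroup N) = _ := hyperbolicVolume_realImage (neg_one_mem_Gamma0 N)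
  have hcard : (Nat.card (SL(2, ℤ) ⧸ Gamma0 N) : ℂ) =
      N * ∏ p ∈ N.primeFactors, (1 + 1 / (p : ℂ)) := by
    have := congrArg (Rat.cast : ℚ → ℂ) (card_quotient_Gamma0 N)
    push_cast at this
    exact this
  have hP : eulerProduct N 1 / eulerProduct N 2 = (∏ p ∈ N.primeFactors, (1 + 1 / (p : ℂ)))⁻¹ := by
    rw [eulerProduct, eulerProduct, ← Finset.prod_div_distrib, ← Finset.prod_inv_distrib]
    refine Finset.prod_congr rfl fun p hp ↦ ?_
    have h1 : (1 : ℝ) < p := by exact_mod_cast (Nat.prime_of_mem_primeFactors hp).one_lt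
    have h0 : (p : ℂ) ≠ 0 := by exact_mod_cast (by linarith : (p : ℝ) ≠ 0)
    have h2 : (p : ℂ) - 1 ≠ 0 := by exact_mod_cast (by linarith : (p : ℝ) - 1 ≠ 0)
    have h3 : (p : ℂ) + 1 ≠ 0 := by exact_mod_cast (by linarith : (p : ℝ) + 1 ≠ 0)
    rw [cpow_neg_one, cpow_neg, cpow_ofNat, show 1 - (p : ℂ)⁻¹ = (p - 1) / p by field_simp,
      show 1 - ((p : ℂ) ^ 2)⁻¹ = (p - 1) * (p + 1) / p ^ 2 by field_simp; ring,
      show 1 + 1 / (p : ℂ) = (p + 1) / p by field_simp]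
    field_simp
  rw [scatteringNumerator_one, hP, hv]
  push_cast
  rw [hcard]
  have hπ : (Real.pi : ℂ) ≠ 0 := by exact_mod_cast Real.pi_ne_zero
  simp only [mul_inv, div_eq_mul_inv, inv_inv]
  ring

/-- The constant term of `Φ` at a simple pole at `1` is the residue times the logarithmic derivative
of `(s - 1) Φ(s)`. -/
lemma tendsto_scatteringFunction (N : ℕ) [NeZero N] :
    Tendsto (fun s : ℂ ↦ scatteringFunction N s -
        1 / ((s - 1) * (hyperbolicVolume (heckeGroup N) : ℂ))) (𝓝[≠] 1)
      (𝓝 (1 / (hyperbolicVolume (heckeGroup N) : ℂ) *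
        (2 * eulerMascheroniConstant - 2 * Real.log 2 - 2 * (deriv riemannZeta 2 / riemannZeta 2)
        - Real.log N + ∑ p ∈ N.primeFactors,
          ((2 * (p : ℝ) * Real.log p / ((p : ℝ) ^ 2 - 1) : ℝ) : ℂ)))) := by
  obtain ⟨hd, h0, hl⟩ := hasLogDerivAt_scatteringNumerator N
  have h := hasDerivAt_iff_tendsto_slope.1 hd.hasDerivAt
  rw [logDeriv_apply, div_eq_iff h0, scatteringNumerator_one_eq_inv_volume] at hl
  rw [hl, mul_comm] at h
  refine h.congr fun s ↦ ?_
  rw [slope_def_field, scatteringFunction, scatteringNumerator_one_eq_inv_volume]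
  simp only [mul_inv, div_eq_mul_inv]
  ring

/-- The logarithmic derivative at `s = 2` of the functional equation for `ζ(1 - s)`. -/
lemma deriv_riemannZeta_neg_one : deriv riemannZeta (-1) =
    1 / 12 * (1 - eulerMascheroniConstant - Real.log (2 * Real.pi) +
      deriv riemannZeta 2 / riemannZeta 2) := by
  have hπ : (Real.pi : ℂ) ≠ 0 := by exact_mod_cast Real.pi_ne_zero
  have h2π : (2 * Real.pi : ℂ) ≠ 0 := mul_ne_zero two_ne_zero hπ
  have h1 : HasLogDerivAt (fun s ↦ (2 * Real.pi : ℂ) ^ (-s)) (-Real.log (2 * Real.pi)) 2 := by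
    have := (hasDerivAt_neg (2 : ℂ)).const_cpow (c := (2 * Real.pi : ℂ)) (.inl h2π)
    have h0 : (2 * Real.pi : ℂ) ^ (-2 : ℂ) ≠ 0 := by simp [cpow_eq_zero_iff, hπ]
    refine ⟨this.differentiableAt, h0, ?_⟩
    rw [logDeriv_apply, this.deriv, ofReal_log (by positivity)]
    push_cast
    field_simp
  have h2 : HasLogDerivAt Gamma (1 - eulerMascheroniConstant) 2 := by
    have := hasDerivAt_Gamma_nat 1
    norm_num [harmonic_succ] at this
    refine ⟨this.differentiableAt, Gamma_ne_zero_of_re_pos (by norm_num), ?_⟩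
    rw [logDeriv_apply, this.deriv, show Complex.Gamma 2 = 1 by simp]
    ring
  have h3 : HasLogDerivAt (fun s : ℂ ↦ cos (Real.pi / 2 * s + 0)) (Real.pi / 2 * 0) 2 := by
    refine HasLogDerivAt.comp_affine (f := cos) (c := Real.pi)
      ⟨differentiable_cos _, by simp, ?_⟩ (by ring)
    rw [logDeriv_apply, Complex.deriv_cos]
    simp
  have h4 : HasLogDerivAt riemannZeta (deriv riemannZeta 2 / riemannZeta 2) 2 :=
    ⟨differentiableAt_riemannZeta (by norm_num),
      riemannZeta_ne_zero_of_one_lt_re (by norm_num), rfl⟩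
  have H := (((HasLogDerivAt.const two_ne_zero).mul h1).mul h2).mul h3 |>.mul h4
  have hev : (fun s : ℂ ↦ riemannZeta (1 - s)) =ᶠ[𝓝 2] fun s ↦
      2 * (2 * Real.pi : ℂ) ^ (-s) * Gamma s * cos (Real.pi / 2 * s + 0) * riemannZeta s := by
    have hopen : {s : ℂ | 1 < s.re} ∈ 𝓝 (2 : ℂ) :=
      (isOpen_lt continuous_const continuous_re).mem_nhds (by simp)
    filter_upwards [hopen] with s hs
    change 1 < s.re at hs
    rw [riemannZeta_one_sub]
    · congr 3
      ring
    · rintro n rfl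
      simp at hs
      have : (0 : ℝ) ≤ n := Nat.cast_nonneg n
      linarith
    · rintro rfl
      simp at hs
  have hval : riemannZeta (-1) = -1 / 12 := by
    have := riemannZeta_neg_nat_eq_bernoulli 1
    norm_num at this ⊢
    exact this
  have hd := hev.deriv_eq
  rw [deriv_comp_const_sub, show (1 - 2 : ℂ) = -1 by norm_num] at hd
  have h5 := H.2.2
  have hval' := hev.eq_of_nhds
  rw [logDeriv_apply, ← hd, div_eq_iff H.2.1] at h5
  beta_reduce at h5 hval'
  rw [← hval',
    show (1 - 2 : ℂ) = -1 by norm_num, hval] at h5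
  linear_combination -h5

/-- The scattering constant of `PSL(2, ℤ)`. -/
def modularScatteringConstant : ℂ :=
  6 / (Real.pi : ℂ) * (1 - (Real.log (4 * Real.pi) : ℂ) - 12 * deriv riemannZeta (-1))

lemma modularScatteringConstant_eq : (Real.pi : ℂ) / 3 * modularScatteringConstant =
    2 * eulerMascheroniConstant - 2 * Real.log 2 - 2 * (deriv riemannZeta 2 / riemannZeta 2) := by
  have hπ : (Real.pi : ℂ) ≠ 0 := by exact_mod_cast Real.pi_ne_zero
  have h4 : Real.log (4 * Real.pi) = Real.log 2 + Real.log (2 * Real.pi) := by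
    rw [← Real.log_mul two_ne_zero (by positivity)]
    ring_nf
  rw [modularScatteringConstant, deriv_riemannZeta_neg_one, h4]
  push_cast
  field_simp
  ring

theorem isScatteringConstant_heckeGroup_iff (N : ℕ) [NeZero N] (C : ℂ) :
    IsScatteringConstant (heckeGroup N) ((0 : ℝ) : OnePoint ℝ) OnePoint.infty C ↔
      C = 1 / (hyperbolicVolume (heckeGroup N) : ℂ) *
        ((Real.pi : ℂ) / 3 * modularScatteringConstant - (Real.log (N : ℝ) : ℂ) +
          ∑ p ∈ N.primeFactors,
            ((2 * (p : ℝ) * Real.log (p : ℝ) / ((p : ℝ) ^ 2 - 1) : ℝ) : ℂ)) := by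
  rw [modularScatteringConstant_eq]
  exact isScatteringConstant_iff_eq (neg_one_mem_realImage (neg_one_mem_Gamma0 N))
    isScalingMatrix_frickeMatrix isScalingMatrix_one (isScatteringFunction_scatteringFunction N)
    (tendsto_scatteringFunction N) C

lemma modularGroup_eq : modularGroup = heckeGroup 1 := by
  have : Gamma0 1 = ⊤ := by
    ext g
    simp only [Gamma0_mem, Subgroup.mem_top, iff_true]
    exact Subsingleton.elim _ _
  rw [modularGroup, heckeGroup, this]

/-- For `N = 1` the cusps `0` and `∞` are equivalent: `frickeMatrix 1` is the element `S` of the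
group, so that it may be replaced by the scaling matrix `1`. -/
theorem isScatteringConstant_modularGroup_iff (C : ℂ) :
    IsScatteringConstant modularGroup OnePoint.infty OnePoint.infty C ↔
      C = modularScatteringConstant := by
  have hF : ((frickeMatrix 1 : SL(2, ℝ)) : GL (Fin 2) ℝ) ∈ heckeGroup 1 := by
    refine mapR_mem_realImage_iff.2 ⟨ModularGroup.S, ?_, ?_⟩
    · rw [Gamma0_mem]
      exact Subsingleton.elim _ _
    · ext i j
      rw [mapR_apply]
      fin_cases i <;> fin_cases j <;> simp [frickeMatrix, ModularGroup.S]
  have hΦ : IsScatteringFunction (heckeGroup 1) 1 1 (scatteringFunction 1) := by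
    have := isScatteringFunction_scatteringFunction 1
    refine ⟨this.1, fun s hs ↦ ?_⟩
    have h := this.2 s hs
    rw [← mul_one (frickeMatrix 1)] at h
    simp only [kloostermanZero_mul_left hF] at h
    exact h
  have hlim := tendsto_scatteringFunction 1
  have hv : hyperbolicVolume (heckeGroup 1) = Real.pi / 3 := by
    have hc : (Nat.card (SL(2, ℤ) ⧸ Gamma0 1) : ℝ) = 1 := by
      exact_mod_cast (by simpa using card_quotient_Gamma0 1 :
        (Nat.card (SL(2, ℤ) ⧸ Gamma0 1) : ℚ) = 1)
    have h : hyperbolicVolume (heckeGroup 1) = _ :=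
      hyperbolicVolume_realImage (neg_one_mem_Gamma0 1)
    rw [h, hc, mul_one]
  rw [modularGroup_eq, isScatteringConstant_iff_eq (𝒢 := heckeGroup 1)
    (neg_one_mem_realImage (neg_one_mem_Gamma0 1)) isScalingMatrix_one isScalingMatrix_one hΦ
    hlim C, ← modularScatteringConstant_eq, hv]
  have hπ : (Real.pi : ℂ) ≠ 0 := by exact_mod_cast Real.pi_ne_zero
  push_cast
  simp
  field_simp

end CuspScattering

end

noncomputable section
namespace CuspScattering
open Filter Topology CongruenceSubgroup Asymptotics

/-! ### The asymptotics as `N → ∞` -/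

/-- The summand of the sum over the primes dividing `N` in the scattering constant of `Γ₀(N)`. -/
def primeTerm (p : ℕ) : ℝ := 2 * (p : ℝ) * Real.log (p : ℝ) / ((p : ℝ) ^ 2 - 1)

lemma primeTerm_nonneg (p : ℕ) : 0 ≤ primeTerm p := by
  rcases lt_or_ge p 2 with h | h
  · interval_cases p <;> simp [primeTerm]
  · have h1 : (2 : ℝ) ≤ p := by exact_mod_cast h
    have h2 : 0 ≤ Real.log (p : ℝ) := Real.log_natCast_nonneg p
    have h3 : 0 ≤ (p : ℝ) ^ 2 - 1 := by nlinarith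
    exact div_nonneg (by positivity) h3

lemma primeTerm_le {p M : ℕ} (hM : 0 < M) (hMp : M ≤ p) :
    primeTerm p ≤ 4 / M * Real.log (p : ℝ) := by
  rcases eq_or_ne p 1 with rfl | h
  · simp [primeTerm]
  · have h1 : (2 : ℝ) ≤ p := by exact_mod_cast (by omega : 2 ≤ p)
    have h2 : 0 ≤ Real.log (p : ℝ) := Real.log_natCast_nonneg p
    have h3 : 0 < (p : ℝ) ^ 2 - 1 := by nlinarith
    have hM' : (0 : ℝ) < M := by exact_mod_cast hM
    have hMp' : (M : ℝ) ≤ p := by exact_mod_cast hMp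
    rw [primeTerm, mul_div_right_comm]
    refine mul_le_mul_of_nonneg_right ?_ h2
    rw [div_le_div_iff₀ h3 hM']
    nlinarith

lemma sum_log_primeFactors_le {N : ℕ} (hN : 0 < N) :
    ∑ p ∈ N.primeFactors, Real.log (p : ℝ) ≤ Real.log N := by
  rw [← Real.log_prod fun p hp ↦ by
    exact_mod_cast (Nat.prime_of_mem_primeFactors hp).ne_zero, ← Nat.cast_prod]
  refine Real.log_le_log ?_ ?_
  · exact_mod_cast Finset.prod_pos fun p hp ↦ (Nat.prime_of_mem_primeFactors hp).pos
  · exact_mod_cast Nat.le_of_dvd hN (Nat.prod_primeFactors_dvd N)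

/-- Small primes contribute a bounded amount, and large primes a small multiple of `log N`. -/
lemma sum_primeTerm_le {N M : ℕ} (hN : 0 < N) (hM : 0 < M) :
    ∑ p ∈ N.primeFactors, primeTerm p ≤
      ∑ p ∈ Finset.range M, primeTerm p + 4 / M * Real.log N := by
  have h1 : ∀ p ∈ N.primeFactors,
      primeTerm p ≤ (if p ∈ Finset.range M then primeTerm p else 0) + 4 / M * Real.log p := by
    intro p hp
    split_ifs with h
    · have := Real.log_natCast_nonneg p
      exact le_add_of_nonneg_right (by positivity)
    · rw [zero_add]
      exact primeTerm_le hM (by simpa using h)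
  refine (Finset.sum_le_sum h1).trans ?_
  rw [Finset.sum_add_distrib, ← Finset.mul_sum, ← Finset.sum_filter]
  refine add_le_add ?_ (mul_le_mul_of_nonneg_left (sum_log_primeFactors_le hN) (by positivity))
  refine Finset.sum_le_sum_of_subset_of_nonneg (fun p hp ↦ (Finset.mem_filter.1 hp).2)
    fun p _ _ ↦ primeTerm_nonneg p

lemma tendsto_log_natCast_atTop : Tendsto (fun N : ℕ ↦ Real.log (N : ℝ)) atTop atTop :=
  Real.tendsto_log_atTop.comp tendsto_natCast_atTop_atTop

lemma tendsto_sum_primeTerm_div_log :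
    Tendsto (fun N : ℕ ↦ (∑ p ∈ N.primeFactors, primeTerm p) / Real.log N) atTop (𝓝 0) := by
  rw [Metric.tendsto_atTop']
  intro ε hε
  obtain ⟨M, hM⟩ := exists_nat_gt (8 / ε)
  have hM0 : (0 : ℝ) < M := (by positivity : 0 < 8 / ε).trans hM
  have hM1 : 0 < M := by exact_mod_cast hM0
  have hM2 : 4 / (M : ℝ) < ε / 2 := by
    rw [div_lt_iff₀ hε] at hM
    rw [div_lt_iff₀ hM0]
    linarith
  obtain ⟨K, hK⟩ := eventually_atTop.1 (tendsto_log_natCast_atTop.eventually_gt_atTop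
    (max 0 ((∑ p ∈ Finset.range M, primeTerm p) / (ε / 2))))
  refine ⟨K, fun N hN ↦ ?_⟩
  have h := hK N hN.le
  have hL : 0 < Real.log N := (le_max_left _ _).trans_lt h
  have hA := (le_max_right _ _).trans_lt h
  rw [div_lt_iff₀ (by positivity)] at hA
  have hS := sum_primeTerm_le (N := N) (by omega) hM1
  have h0 : 0 ≤ ∑ p ∈ N.primeFactors, primeTerm p := Finset.sum_nonneg fun p _ ↦ primeTerm_nonneg p
  rw [Real.dist_eq, sub_zero, abs_of_nonneg (div_nonneg h0 hL.le), div_lt_iff₀ hL]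
  have := mul_lt_mul_of_pos_right hM2 hL
  linarith

lemma le_card_quotient_Gamma0 (N : ℕ) [NeZero N] : (N : ℝ) ≤ Nat.card (SL(2, ℤ) ⧸ Gamma0 N) := by
  have h := card_quotient_Gamma0 N
  have h1 : (1 : ℚ) ≤ ∏ p ∈ N.primeFactors, (1 + 1 / (p : ℚ)) :=
    Finset.one_le_prod fun p _ ↦ le_add_of_nonneg_right (by positivity)
  have h2 : (N : ℚ) ≤ Nat.card (SL(2, ℤ) ⧸ Gamma0 N) := by
    rw [h]
    exact le_mul_of_one_le_right (by positivity) h1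
  exact_mod_cast h2

lemma tendsto_card_quotient_Gamma0 :
    Tendsto (fun N : ℕ ↦ (Nat.card (SL(2, ℤ) ⧸ Gamma0 N) : ℝ)) atTop atTop := by
  refine tendsto_atTop_mono' _ ?_ tendsto_natCast_atTop_atTop
  filter_upwards [eventually_gt_atTop 0] with N hN
  have : NeZero N := ⟨hN.ne'⟩
  exact le_card_quotient_Gamma0 N

/-- The genus of `Γ₀(N)` is asymptotic to a twelfth of the index. -/
theorem tendsto_genus_div_card :
    Tendsto (fun N : ℕ ↦ (genus (heckeGroup N) : ℝ) / Nat.card (SL(2, ℤ) ⧸ Gamma0 N)) atTop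
      (𝓝 (1 / 12)) := by
  rw [Metric.tendsto_atTop']
  intro ε hε
  obtain ⟨m, hm⟩ := exists_nat_gt (4 / ε)
  have hm0 : (0 : ℝ) < m := (by positivity : 0 < 4 / ε).trans hm
  have hm1 : 0 < m := by exact_mod_cast hm0
  have hm2 : 4 / (m : ℝ) < ε := by
    rw [div_lt_iff₀ hε] at hm
    rw [div_lt_iff₀ hm0]
    linarith
  obtain ⟨K, hK⟩ := eventually_atTop.1 (tendsto_card_quotient_Gamma0.eventually_gt_atTop (1 / ε))
  refine ⟨max K (m ^ 4 * (m ^ 4 + 4)), fun N hN ↦ ?_⟩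
  obtain ⟨hN1, hN2⟩ := max_lt_iff.1 hN
  obtain ⟨h1, h2⟩ := genus_heckeGroup_bounds hm1 hN2
  have h1' := (Rat.cast_le (K := ℝ)).2 h1
  have h2' := (Rat.cast_le (K := ℝ)).2 h2
  push_cast at h1' h2'
  have hc := hK N hN1.le
  generalize (Nat.card (SL(2, ℤ) ⧸ Gamma0 N) : ℝ) = c at *
  have hc0 : 0 < c := (by positivity : 0 < 1 / ε).trans hc
  rw [div_lt_iff₀ hε] at hc
  have h3 : 4 * (c / m) < ε * c := by
    calc 4 * (c / m) = 4 / m * c := by ring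
      _ < ε * c := mul_lt_mul_of_pos_right hm2 hc0
  rw [Real.dist_eq, abs_lt, lt_sub_iff_add_lt, sub_lt_iff_lt_add, lt_div_iff₀ hc0,
    div_lt_iff₀ hc0]
  constructor <;> linarith

/-- With `c` the index of `Γ₀(N)`, the coefficient of `-log N` in `8 π g (1 - g) C` is
`24 g (1 - g) / c`, and `24 (g - 1) / c` tends to `2`; the other terms of `C` are `o(log N)`. -/
theorem isLittleO_scatteringConstant {C : ℕ → ℂ}
    (hC : ∀ N : ℕ, 1 ≤ N → IsScatteringConstant (heckeGroup N)
      ((0 : ℝ) : OnePoint ℝ) OnePoint.infty (C N)) :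
    (fun N : ℕ ↦ 8 * (Real.pi : ℂ) * (genus (heckeGroup N) : ℂ) *
        (1 - (genus (heckeGroup N) : ℂ)) * C N -
          2 * (genus (heckeGroup N) : ℂ) * (Real.log (N : ℝ) : ℂ)) =o[atTop]
      (fun N : ℕ ↦ (genus (heckeGroup N) : ℝ) * Real.log (N : ℝ)) := by
  let K : ℂ := (Real.pi : ℂ) / 3 * modularScatteringConstant
  let c : ℕ → ℝ := fun N ↦ Nat.card (SL(2, ℤ) ⧸ Gamma0 N)
  let g : ℕ → ℝ := fun N ↦ genus (heckeGroup N)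
  let r : ℕ → ℝ := fun N ↦ 24 * (g N / c N - 1 / c N)
  have hr : Tendsto r atTop (𝓝 2) := by
    have := (tendsto_genus_div_card.sub
      (tendsto_const_nhds.div_atTop tendsto_card_quotient_Gamma0 (a := (1 : ℝ)))).const_mul 24
    convert! this using 2
    norm_num
  let δ : ℕ → ℂ := fun N ↦ ((r N - 2 : ℝ) : ℂ) - (r N : ℂ) *
    (K / (Real.log (N : ℝ) : ℝ) +
      (((∑ p ∈ N.primeFactors, primeTerm p) / Real.log N : ℝ) : ℂ))
  have hδ : Tendsto δ atTop (𝓝 0) := by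
    have h1 : Tendsto (fun N ↦ ((r N : ℝ) : ℂ)) atTop (𝓝 ((2 : ℝ) : ℂ)) :=
      (Complex.continuous_ofReal.tendsto _).comp hr
    have h2 : Tendsto (fun N ↦ ((r N - 2 : ℝ) : ℂ)) atTop (𝓝 ((2 - 2 : ℝ) : ℂ)) :=
      (Complex.continuous_ofReal.tendsto _).comp (hr.sub_const 2)
    have h3 : Tendsto (fun N : ℕ ↦ (((Real.log (N : ℝ))⁻¹ : ℝ) : ℂ)) atTop (𝓝 ((0 : ℝ) : ℂ)) :=
      (Complex.continuous_ofReal.tendsto _).comp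
        (tendsto_inv_atTop_zero.comp tendsto_log_natCast_atTop)
    have h4 : Tendsto (fun N : ℕ ↦
        (((∑ p ∈ N.primeFactors, primeTerm p) / Real.log N : ℝ) : ℂ)) atTop (𝓝 ((0 : ℝ) : ℂ)) :=
      (Complex.continuous_ofReal.tendsto _).comp tendsto_sum_primeTerm_div_log
    have := h2.sub (h1.mul ((h3.const_mul K).add h4))
    convert! this using 2
    · simp [δ, div_eq_mul_inv]
    · simp
  have hmain : (fun N : ℕ ↦ (((g N * Real.log N : ℝ) : ℂ)) * δ N) =o[atTop]
      (fun N : ℕ ↦ (g N * Real.log N) * (1 : ℝ)) := by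
    refine IsBigO.mul_isLittleO (IsBigO.of_norm_right ?_) ((isLittleO_one_iff ℝ).2 hδ)
    exact isBigO_of_le _ fun N ↦ by rw [Complex.norm_real, norm_norm]
  simp only [mul_one] at hmain
  refine hmain.congr' ?_ EventuallyEq.rfl
  filter_upwards [eventually_gt_atTop 1] with N hN
  have : NeZero N := ⟨by omega⟩
  have hL : (Real.log (N : ℝ) : ℂ) ≠ 0 := by
    exact_mod_cast (Real.log_pos (by exact_mod_cast hN)).ne'
  have hfin : Finite (SL(2, ℤ) ⧸ Gamma0 N) := inferInstance
  have hc0 : (c N : ℂ) ≠ 0 := by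
    have : 0 < c N := Nat.cast_pos.2 Nat.card_pos
    exact_mod_cast this.ne'
  have hv : hyperbolicVolume (heckeGroup N) = Real.pi / 3 * c N :=
    hyperbolicVolume_realImage (neg_one_mem_Gamma0 N)
  have hπ : (Real.pi : ℂ) ≠ 0 := by exact_mod_cast Real.pi_ne_zero
  rw [(isScatteringConstant_heckeGroup_iff N (C N)).1 (hC N hN.le), hv]
  change _ = 8 * (Real.pi : ℂ) * _ * _ * (_ * (K - _ + ∑ p ∈ N.primeFactors, (primeTerm p : ℂ))) - _
  simp only [δ, r]
  have hg : (genus (heckeGroup N) : ℂ) = (g N : ℂ) := by simp [g]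
  rw [hg]
  rw [Complex.natCast_log] at hL
  push_cast
  field_simp
  ring

end CuspScattering

end

theorem lemma6p1 :
    -- the scattering constant of `PSL(2, ℤ)`
    (∀ C : ℂ, CuspScattering.IsScatteringConstant CuspScattering.modularGroup
        OnePoint.infty OnePoint.infty C ↔
      C = 6 / (Real.pi : ℂ) * (1 - (Real.log (4 * Real.pi) : ℂ) - 12 * deriv riemannZeta (-1))) ∧
    -- the scattering constant of `Γ₀(N)` with respect to the cusps `0` and `∞`
    (∀ C₁ : ℂ, CuspScattering.IsScatteringConstant CuspScattering.modularGroup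
        OnePoint.infty OnePoint.infty C₁ →
      ∀ N : ℕ, 1 ≤ N → ∀ C : ℂ,
        CuspScattering.IsScatteringConstant (CuspScattering.heckeGroup N)
          ((0 : ℝ) : OnePoint ℝ) OnePoint.infty C ↔
        C = 1 / (CuspScattering.hyperbolicVolume (CuspScattering.heckeGroup N) : ℂ) *
          ((Real.pi : ℂ) / 3 * C₁ - (Real.log (N : ℝ) : ℂ) +
            ∑ p ∈ N.primeFactors,
              ((2 * (p : ℝ) * Real.log (p : ℝ) / ((p : ℝ) ^ 2 - 1) : ℝ) : ℂ))) ∧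
    -- the asymptotics as `N → ∞`
    (∀ C : ℕ → ℂ,
      (∀ N : ℕ, 1 ≤ N →
        CuspScattering.IsScatteringConstant (CuspScattering.heckeGroup N)
          ((0 : ℝ) : OnePoint ℝ) OnePoint.infty (C N)) →
      (fun N : ℕ ↦
        8 * (Real.pi : ℂ) * (CuspScattering.genus (CuspScattering.heckeGroup N) : ℂ) *
            (1 - (CuspScattering.genus (CuspScattering.heckeGroup N) : ℂ)) * C N -
          2 * (CuspScattering.genus (CuspScattering.heckeGroup N) : ℂ) *
            (Real.log (N : ℝ) : ℂ))
        =o[Filter.atTop]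
      (fun N : ℕ ↦ (CuspScattering.genus (CuspScattering.heckeGroup N) : ℝ) *
        Real.log (N : ℝ))) := by
  have h1 := CuspScattering.isScatteringConstant_modularGroup_iff
  refine ⟨h1, ?_, fun C hC ↦ CuspScattering.isLittleO_scatteringConstant hC⟩
  intro C₁ hC₁ N hN C
  have : NeZero N := ⟨by omega⟩
  rw [(h1 C₁).1 hC₁]
  exact CuspScattering.isScatteringConstant_heckeGroup_iff N C
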